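/- Let $F$ be a totally real number field of degree $n$ with ring of integers $\mathcal O_F$ and discriminant $d_F$, and let $K/F$ be a quadratic extension with $2r$ real and $c$ complex places, $r+c=n$. Order the real embeddings $v_1,\dots,v_n$ of $F$ so that $v_1,\dots,v_c$ become complex in $K$ and $v_{c+1},\dots,v_n$ split, and fix isomorphisms $K\otimes_{F,v_j}\mathbf R\simeq\mathbf C$ for $j\le c$ and $K\otimes_{F,v_j}\mathbf R\simeq\mathbf R\oplus\mathbf R$ for $j>c$, again denoted $v_j$. For $z\in\mathcal H^n$ ($\mathcal H$ the upper half plane), $y=\operatorname{Im} z$ and $\operatorname{Re}(s)>1$ put $$E(z,s)=\sum_{0\ne(\mu,\nu)\in\mathcal O_F^2/\mathcal O_F^\times}\ \prod_{j=1}^n\frac{y_j^{\,s}}{|v_j(\mu)z_j+v_j(\nu)|^{2s}} .$$ Let $I\neq0$ be an ideal of $\mathcal O_F$, $\mathcal O_I=\mathcal O_F+I\mathcal O_K$, and let $M\subset K$ be a projective $\mathcal O_I$-module having an $\mathcal O_F$-basis $(\omega_1,\omega_2)$ that is positive, that is, its images under all the $v_j$ are positively oriented for the orientations of $\mathbf C$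 and $\mathbf R\oplus\mathbf R$ given by $(1,i)$ and $((1,0),(0,1))$. (For nonzero $M$ such a basis always exists if $F$ has narrow class number one.) Let $V$ be the group of units of $\mathcal O_I$ of norm $1$ over $\mathbf Q$, $V_1$ the group of units of $\mathcal O_I$ of norm $1$ over $F$, $\tilde V$ the group generated by $V_1$ and $\mathcal O_F^\times$, $\delta_I=[V:\tilde V]$, let $\mathrm N M$ be the covolume of $M$ in $K\otimes_{\mathbf Q}\mathbf R\simeq\mathbf R^{2r}\times\mathbf C^c$ for the Lebesgue measure, and let $$L(M,s)=(\mathrm N M)^s\,\delta_I\sum_{0\ne x\in M/V}\operatorname{sign}(\mathrm N_{K/\mathbf Q}(x))\,|\mathrm N_{K/\mathbf Q}(x)|^{-s}.$$ Put $\tau=\omega_2/\omega_1$, and write $v_j(\tau)=\tau_j\in\mathcal H$ for $j\le c$ and $v_j(\tau)=(\tau_j,\tau_j')\in\mathbf R\oplus\mathbf R$ for $j>c$. For $j>c$ let $\Upsilon_j\subset\mathcal H$ be the hyperbolic geodesic with end points $\tau_j,\tau_j'$, oriented from $\tau_j$ to $\tau_j'$, and let $$R_\tau=\{\tau_1\}\times\cdots\times\{\tau_c\}\times\Upsilon_{c+1}\times\cdots\times\Upsilon_n$$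 with the product orientation. Let $\Delta_\tau\subset R_\tau$ be a measurable fundamental domain, up to null sets of the hyperbolic measure of $R_\tau$, for the action on $R_\tau$ of $\Gamma_\tau/\{\pm1\}$, where $\Gamma_\tau$ is the stabiliser of $\tau$ in $\mathrm{SL}_2(\mathcal O_F)$. (If $r=0$, then $R_\tau$ is a point, and a fundamental domain in this sense exists only if $\Gamma_\tau=\{\pm1\}$.) Then for every complex $s$ with $\operatorname{Re}(s)>1$ the series defining $E(z,s)$, for every $z\in\mathcal H^n$, and $L(M,s)$ converge absolutely, $E(\cdot,s)$ is of class $C^r$ on $\mathcal H^n$, the integral below converges absolutely, and $$\int_{\Delta_\tau}\frac{\partial^rE(z,s)}{\partial z_{c+1}\cdots\partial z_n}\,dz_{c+1}\wedge\cdots\wedge dz_n=\left(\frac{\Gamma\left(\frac{s+1}2\right)^2}{2i\,\Gamma(s)}\right)^{r}d_F^{-s}\,L(M,s),$$ where $\frac{\partial}{\partial z_j}=\frac12\left(\frac{\partial}{\partial x_j}-i\frac{\partial}{\partial y_j}\right)$ for $z_j=x_j+iy_j$. -/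

import Mathlib

open NumberField Module

noncomputable section

namespace HilbertEisenstein

/-! ### The Eisenstein series of weight `0` -/

section Eisenstein

variable {F : Type*} [Field F] [NumberField F] [IsTotallyReal F] {ι : Type*} [Fintype ι]

theorem abs_prod_embeddings (v : ι ≃ (F →+* ℝ)) (x : F) :
    |∏ i, v i x| = |(Algebra.norm ℚ x : ℝ)| := by
  classical
  have hbij : Function.Bijective (fun i => Complex.ofRealHom.comp (v i) : ι → (F →+* ℂ)) := by
    constructor
    · intro i j h
      apply v.injective
      ext y
      have := RingHom.congr_fun h y
      simpa using this
    · intro φ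
      have hφ := IsTotallyReal.complexEmbedding_isReal φ
      refine ⟨v.symm hφ.embedding, ?_⟩
      ext y
      simp
  have h1 := Algebra.norm_eq_prod_embeddings ℚ ℂ x
  have h2 : (∏ i, ((v i x : ℝ) : ℂ)) = ∏ σ : F →ₐ[ℚ] ℂ, σ x :=
    Fintype.prod_equiv ((Equiv.ofBijective _ hbij).trans (RingHom.equivRatAlgHom F ℂ))
      _ _ (fun i => by simp [RingHom.equivRatAlgHom_apply])
  have h3 : (∏ i, v i x : ℝ) = (Algebra.norm ℚ x : ℝ) := by
    rw [← h2] at h1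
    have h4 : ((Algebra.norm ℚ x : ℝ) : ℂ) = ((∏ i, v i x : ℝ) : ℂ) := by
      push_cast
      rw [← h1]
      simp
    exact_mod_cast h4.symm
  rw [h3]

theorem abs_prod_embeddings_unit (v : ι ≃ (F →+* ℝ)) (u : (𝓞 F)ˣ) :
    |∏ i, v i ((u : 𝓞 F) : F)| = 1 := by
  rw [abs_prod_embeddings]
  have := NumberField.isUnit_iff_norm.1 u.isUnit
  rw [RingOfIntegers.coe_norm] at this
  exact_mod_cast this

/-- The classes of pairs of integers of `F` modulo the diagonal action of the units. -/
abbrev PairClass (F : Type*) [Field F] : Type _ :=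
  MulAction.orbitRel.Quotient (𝓞 F)ˣ (𝓞 F × 𝓞 F)

/-- The general term `N(y)^s / |N(μ z + ν)|^(2s)`, a function of the class of `(μ, ν)`. -/
def eisensteinTerm (v : ι ≃ (F →+* ℝ)) (z : ι → ℂ) (s : ℂ) : PairClass F → ℂ :=
  Quotient.lift
    (fun p : 𝓞 F × 𝓞 F =>
      ((∏ i, (z i).im : ℝ) : ℂ) ^ s /
        ((‖∏ i, (((v i (p.1 : F) : ℝ) : ℂ) * z i + ((v i (p.2 : F) : ℝ) : ℂ))‖ : ℝ) : ℂ) ^ (2 * s))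
    (by
      rintro a b hab
      obtain ⟨u, rfl⟩ := (MulAction.orbitRel_apply).1 hab
      have hu := abs_prod_embeddings_unit v u
      have key : ‖∏ i, (((v i (((u • b).1 : 𝓞 F) : F) : ℝ) : ℂ) * z i
          + ((v i (((u • b).2 : 𝓞 F) : F) : ℝ) : ℂ))‖
          = ‖∏ i, (((v i (b.1 : F) : ℝ) : ℂ) * z i + ((v i (b.2 : F) : ℝ) : ℂ))‖ := by
        have h1 : ∀ i, (((v i (((u • b).1 : 𝓞 F) : F) : ℝ) : ℂ) * z i
            + ((v i (((u • b).2 : 𝓞 F) : F) : ℝ) : ℂ))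
            = ((v i ((u : 𝓞 F) : F) : ℝ) : ℂ) *
              (((v i (b.1 : F) : ℝ) : ℂ) * z i + ((v i (b.2 : F) : ℝ) : ℂ)) := by
          intro i
          simp only [Prod.smul_fst, Prod.smul_snd, Units.smul_def, smul_eq_mul, map_mul]
          push_cast
          ring
        rw [Finset.prod_congr rfl fun i _ => h1 i, Finset.prod_mul_distrib, norm_mul,
          ← Complex.ofReal_prod, Complex.norm_real, Real.norm_eq_abs, hu, one_mul]
      exact congrArg
        (fun t : ℝ => ((∏ i, (z i).im : ℝ) : ℂ) ^ s / ((t : ℝ) : ℂ) ^ (2 * s)) key)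

/-- `E(z, s)`: the sum over the nonzero classes of pairs `(μ, ν)` modulo units. -/
def eisenstein (v : ι ≃ (F →+* ℝ)) (z : ι → ℂ) (s : ℂ) : ℂ :=
  ∑' q : {q : PairClass F // q ≠ Quotient.mk _ 0}, eisensteinTerm v z s q

end Eisenstein

/-- The product of upper half planes indexed by `ι`. -/
def halfPlanes (ι : Type*) : Set (ι → ℂ) := {z | ∀ i, 0 < (z i).im}

/-- The operator `∂/∂z_j = (∂/∂x_j - i ∂/∂y_j) / 2`. -/
def wirtinger {ι : Type*} [DecidableEq ι] (j : ι) (f : (ι → ℂ) → ℂ) (z : ι → ℂ) : ℂ :=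
  (1 / 2) * (lineDeriv ℝ f z (Pi.single j 1) - Complex.I * lineDeriv ℝ f z (Pi.single j Complex.I))

/-- The operator `∂^r/∂z_{c+1} ⋯ ∂z_{c+r}`, in the variables of the second group. -/
def mixedWirtinger {c r : ℕ} (f : (Fin c ⊕ Fin r → ℂ) → ℂ) : (Fin c ⊕ Fin r → ℂ) → ℂ :=
  (List.finRange r).foldr (fun j g => wirtinger (Sum.inr j) g) f

/-! ### Orders, modules and their `L`-series -/

section Modules

variable {F K : Type*} [Field F] [NumberField F] [Field K] [NumberField K] [Algebra F K]

/-- The order `𝓞_F + I 𝓞_K` of conductor `I`. -/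
def conductorOrder (K : Type*) [Field K] [NumberField K] [Algebra F K] (I : Ideal (𝓞 F)) :
    Subalgebra (𝓞 F) K where
  carrier := {x | ∃ a : 𝓞 F, ∃ y ∈ I.map (algebraMap (𝓞 F) (𝓞 K)),
    x = algebraMap (𝓞 F) K a + algebraMap (𝓞 K) K y}
  mul_mem' := by
    rintro _ _ ⟨a, y, hy, rfl⟩ ⟨a', y', hy', rfl⟩
    refine ⟨a * a', algebraMap (𝓞 F) (𝓞 K) a * y' + algebraMap (𝓞 F) (𝓞 K) a' * y + y * y',
      add_mem (add_mem (Ideal.mul_mem_left _ _ hy') (Ideal.mul_mem_left _ _ hy))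
        (Ideal.mul_mem_left _ _ hy'), ?_⟩
    simp only [map_add, map_mul, ← IsScalarTower.algebraMap_apply (𝓞 F) (𝓞 K) K]
    ring
  add_mem' := by
    rintro _ _ ⟨a, y, hy, rfl⟩ ⟨a', y', hy', rfl⟩
    refine ⟨a + a', y + y', add_mem hy hy', ?_⟩
    simp only [map_add]
    ring
  algebraMap_mem' a := ⟨a, 0, zero_mem _, by simp⟩

/-- The group `V` of units of the order whose norm to `ℚ` is `1`. -/
def unitsNormOne (K : Type*) [Field K] [NumberField K] [Algebra F K] (I : Ideal (𝓞 F)) :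
    Subgroup (conductorOrder K I)ˣ where
  carrier := {u | Algebra.norm ℚ ((u : conductorOrder K I) : K) = 1}
  mul_mem' := by
    intro u w hu hw
    simp only [Set.mem_ofPred_eq] at hu hw
    simp [hu, hw]
  one_mem' := by simp
  inv_mem' := by
    intro u hu
    simp only [Set.mem_ofPred_eq] at hu ⊢
    have h : Algebra.norm ℚ (((u : conductorOrder K I) : K) *
        ((u⁻¹ : (conductorOrder K I)ˣ) : conductorOrder K I)) = 1 := by
      rw [← MulMemClass.coe_mul, Units.mul_inv]
      simp
    rwa [map_mul, hu, one_mul] at h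

/-- The group `V₁` of units of the order whose relative norm to `F` is `1`. -/
def unitsRelNormOne (K : Type*) [Field K] [NumberField K] [Algebra F K] (I : Ideal (𝓞 F)) :
    Subgroup (conductorOrder K I)ˣ where
  carrier := {u | Algebra.norm F ((u : conductorOrder K I) : K) = 1}
  mul_mem' := by
    intro u w hu hw
    simp only [Set.mem_ofPred_eq] at hu hw
    simp [hu, hw]
  one_mem' := by simp
  inv_mem' := by
    intro u hu
    simp only [Set.mem_ofPred_eq] at hu ⊢
    have h : Algebra.norm F (((u : conductorOrder K I) : K) *
        ((u⁻¹ : (conductorOrder K I)ˣ) : conductorOrder K I)) = 1 := by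
      rw [← MulMemClass.coe_mul, Units.mul_inv]
      simp
    rwa [map_mul, hu, one_mul] at h

/-- The index `δ_I = [V : Ṽ]`, where `Ṽ` is generated by `V₁` and the units of `F`. -/
def unitIndex (K : Type*) [Field K] [NumberField K] [Algebra F K] (I : Ideal (𝓞 F)) : ℕ :=
  (unitsRelNormOne K I ⊔
    (Units.map (algebraMap (𝓞 F) (conductorOrder K I)).toMonoidHom).range).relIndex
      (unitsNormOne K I)

variable {I : Ideal (𝓞 F)}

/-- The image of `M` in `K ⊗ ℝ`, as a product of copies of `ℝ` and `ℂ`. -/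
def moduleLattice (M : Submodule (conductorOrder K I) K) : Submodule ℤ (mixedEmbedding.mixedSpace K) :=
  AddSubgroup.toIntSubmodule (M.toAddSubgroup.map (mixedEmbedding K).toAddMonoidHom)

open scoped Classical in
/-- The norm `N M`: the covolume of `M` in `K ⊗ ℝ` for the Lebesgue measure. -/
def moduleNorm (M : Submodule (conductorOrder K I) K) : ℝ :=
  ZLattice.covolume (E := mixedEmbedding.mixedSpace K) (moduleLattice M)

/-- The set `M / V`. -/
abbrev ModuleClass (M : Submodule (conductorOrder K I) K) : Type _ :=
  MulAction.orbitRel.Quotient (unitsNormOne K I) M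

/-- The general term `sign(N x) |N x|^(-s)`, a function of the class of `x` modulo `V`. -/
def lTerm (M : Submodule (conductorOrder K I) K) (s : ℂ) : ModuleClass M → ℂ :=
  Quotient.lift
    (fun x : M =>
      ((SignType.sign (Algebra.norm ℚ (x : K)) : ℤ) : ℂ) *
        ((|(Algebra.norm ℚ (x : K) : ℝ)| : ℝ) : ℂ) ^ (-s))
    (by
      rintro a b hab
      obtain ⟨u, rfl⟩ := (MulAction.orbitRel_apply).1 hab
      have h : Algebra.norm ℚ (((u • b : M)) : K) = Algebra.norm ℚ (b : K) := by
        have h0 : ((u • b : M) : K)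
            = (((u : (conductorOrder K I)ˣ) : conductorOrder K I) : K) * (b : K) := rfl
        have hu : Algebra.norm ℚ (((u : (conductorOrder K I)ˣ) : conductorOrder K I) : K) = 1 := u.2
        rw [h0, map_mul, hu, one_mul]
      exact congrArg
        (fun t : ℚ => ((SignType.sign t : ℤ) : ℂ) * ((|(t : ℝ)| : ℝ) : ℂ) ^ (-s)) h)

/-- `L(M, s) = (N M)^s δ_I ∑' sign(N x) |N x|^(-s)`, over the nonzero classes of `M / V`. -/
def lSeries (M : Submodule (conductorOrder K I) K) (s : ℂ) : ℂ :=
  ((moduleNorm M : ℝ) : ℂ) ^ s * (unitIndex K I : ℂ) *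
    ∑' q : {q : ModuleClass M // q ≠ Quotient.mk _ 0}, lTerm M s q

end Modules

/-! ### Archimedean places and the cycle -/

/-- An ordering of the real places of `F` for which the first `c` become complex in `K` and the
last `r` split, and identifications of `K ⊗ ℝ` with `ℂ`, respectively `ℝ ⊕ ℝ`, at these places. -/
structure ArchData (F K : Type*) [Field F] [Field K] [Algebra F K] (c r : ℕ) where
  v : Fin c ⊕ Fin r ≃ (F →+* ℝ)
  toComplex : Fin c → (K →+* ℂ)
  toComplex_algebraMap : ∀ j a, toComplex j (algebraMap F K a) = ((v (Sum.inl j) a : ℝ) : ℂ)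
  toComplex_not_isReal : ∀ j, ¬ ComplexEmbedding.IsReal (toComplex j)
  fst : Fin r → (K →+* ℝ)
  snd : Fin r → (K →+* ℝ)
  fst_algebraMap : ∀ j a, fst j (algebraMap F K a) = v (Sum.inr j) a
  snd_algebraMap : ∀ j a, snd j (algebraMap F K a) = v (Sum.inr j) a
  fst_ne_snd : ∀ j, fst j ≠ snd j

/-- The geodesic of the upper half plane with end points `p` and `q`, parametrised by hyperbolic
arc length and oriented from `p` to `q`. -/
def geodesic (p q : ℝ) (x : ℝ) : ℂ :=
  (((p + q) / 2 + (q - p) / 2 * Real.tanh x : ℝ) : ℂ) +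
    ((|q - p| / 2 / Real.cosh x : ℝ) : ℂ) * Complex.I

section Cycle

variable {F K : Type*} [Field F] [Field K] [Algebra F K] {c r : ℕ}

/-- The images of the basis `(ω₁, ω₂)` under all `v_j` are positively oriented, for the
orientations of `ℂ` and `ℝ ⊕ ℝ` given by `(1, i)` and `((1, 0), (0, 1))`. -/
def ArchData.IsPositive (A : ArchData F K c r) (ω₁ ω₂ : K) : Prop :=
  (∀ j, 0 < (A.toComplex j ω₁).re * (A.toComplex j ω₂).im -
      (A.toComplex j ω₁).im * (A.toComplex j ω₂).re) ∧
  ∀ j, 0 < A.fst j ω₁ * A.snd j ω₂ - A.snd j ω₁ * A.fst j ω₂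

/-- The parametrisation of `R_τ = {τ_1} × ⋯ × {τ_c} × Υ_{c+1} × ⋯ × Υ_{c+r}`, where `Υ_j` is
oriented from `τ_j` to `τ_j'`. -/
def ArchData.param (A : ArchData F K c r) (τ : K) (x : Fin r → ℝ) : Fin c ⊕ Fin r → ℂ :=
  Sum.elim (fun j => A.toComplex j τ) (fun j => geodesic (A.fst j τ) (A.snd j τ) (x j))

/-- The region `R_τ`. -/
def ArchData.region (A : ArchData F K c r) (τ : K) : Set (Fin c ⊕ Fin r → ℂ) :=
  Set.range (A.param τ)

/-- The action of `SL₂(𝓞_F)` by fractional linear transformations. -/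
def moebius {ι : Type*} (v : ι → (F →+* ℝ)) (γ : Matrix.SpecialLinearGroup (Fin 2) (𝓞 F))
    (z : ι → ℂ) : ι → ℂ := fun i =>
  (((v i (γ 0 0 : F) : ℝ) : ℂ) * z i + ((v i (γ 0 1 : F) : ℝ) : ℂ)) /
    (((v i (γ 1 0 : F) : ℝ) : ℂ) * z i + ((v i (γ 1 1 : F) : ℝ) : ℂ))

/-- The stabiliser `Γ_τ` of `τ` in `SL₂(𝓞_F)`. -/
def fixing (F : Type*) [Field F] [Algebra F K] (τ : K) :
    Set (Matrix.SpecialLinearGroup (Fin 2) (𝓞 F)) :=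
  {γ | (algebraMap (𝓞 F) K (γ 0 0) * τ + algebraMap (𝓞 F) K (γ 0 1)) /
    (algebraMap (𝓞 F) K (γ 1 0) * τ + algebraMap (𝓞 F) K (γ 1 1)) = τ}

/-- `Δ` is a fundamental domain for the action of `Γ_τ / {±1}` on `R_τ`, up to null sets for the
hyperbolic measure of `R_τ`. -/
structure ArchData.IsFundDomain (A : ArchData F K c r) (τ : K)
    (Δ : Set (Fin c ⊕ Fin r → ℂ)) : Prop where
  subset_region : Δ ⊆ A.region τ
  nullMeasurable : MeasureTheory.NullMeasurableSet (A.param τ ⁻¹' Δ)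
  covers : ∀ᵐ x : Fin r → ℝ, ∃ γ ∈ fixing F τ, moebius A.v γ (A.param τ x) ∈ Δ
  disjoint : ∀ γ ∈ fixing F τ, γ ≠ 1 → γ ≠ -1 →
    MeasureTheory.volume {x : Fin r → ℝ | A.param τ x ∈ Δ ∧ moebius A.v γ (A.param τ x) ∈ Δ} = 0

/-- The pull-back of `f dz_{c+1} ∧ ⋯ ∧ dz_{c+r}` by the parametrisation of `R_τ`. -/
def ArchData.pullback (A : ArchData F K c r) (τ : K) (f : (Fin c ⊕ Fin r → ℂ) → ℂ)
    (x : Fin r → ℝ) : ℂ :=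
  f (A.param τ x) * ∏ j, deriv (geodesic (A.fst j τ) (A.snd j τ)) (x j)

/-- The integral of `f dz_{c+1} ∧ ⋯ ∧ dz_{c+r}` over the oriented subset `Δ` of `R_τ`. -/
def ArchData.integral (A : ArchData F K c r) (τ : K) (Δ : Set (Fin c ⊕ Fin r → ℂ))
    (f : (Fin c ⊕ Fin r → ℂ) → ℂ) : ℂ :=
  ∫ x in A.param τ ⁻¹' Δ, A.pullback τ f x

end Cycle

end HilbertEisenstein

end

open HilbertEisenstein

open NumberField Module

noncomputable section

namespace HilbertEisenstein

/-! The proof unfolds the integral. Sending `(μ, ν)` to `x = μ ω₂ + ν ω₁` identifies the pairs with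
`M`, and the term of `E` attached to `x` is a product over the places of `F` of local factors `(y /
|a z + b|²)^s`, where `(a, b)` is the image of `(μ, ν)`. The operator `∂/∂z_j` touches only the
`j`-th factor. On the cycle, the factors at the complex places are constants and each split place
contributes a one-variable form on a geodesic.

In the arc length coordinate the form at a split place depends only on the values `u`, `w` of `a z +
b` at the two end points (`localForm_eq`). Rescaling `u` and `w` translates the coordinate and
produces a power of the scaling factors (`localForm_smul`). After normalisation to `u, w = ±1` the
form is the sum of an odd part, whose integral vanishes, and a signed multiple of `(2 cosh)^(-s-1)`,
which is a beta integral (`integral_localForm`). This is the source of the Gamma factors and of the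
sign of the norm. Over the whole of `ℝ^r` the term of `x` therefore integrates to a constant times
`sign(N x) |N x|^(-s)` (`ArchData.integral_cycleTerm`).

A unit of relative norm one acts on `M` by a matrix in the basis `(ω₂, ω₁)`, and this gives the
stabiliser `Γ_τ`. That every element of `Γ_τ` arises in this way uses that the multiplier ring of
the projective module `M` is the order itself. The unit `ε` moves the cycle by the vector of `log
|ε'/ε|`, so `Δ` is a fundamental domain in `ℝ^r` for the group `Λ` of these vectors, and the
existence of `Δ` forces the kernel of `V₁ → Λ` to be `±1`. Hence the nonzero pairs modulo units of
`F` correspond bijectively to `(M ∖ 0)/V × V/Ṽ × Λ` (`ArchData.unfoldMap_bijective`). The sum over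
`Λ` turns the integral over `Δ` into one over `ℝ^r` (`integral_unfold`), the finite sum over `V/Ṽ`
gives `δ_I`, and the sum over `(M ∖ 0)/V` gives the `L`-series. The powers of the orientation
determinants combine to `(N M / d_F)^s` by the covolume formula `moduleNorm_eq`.

Convergence rests on choosing representatives that are balanced at all places
(`exists_unit_balanced`), which reduces both series to lattice sums. Normal convergence of all
derivatives of `E` follows from the homogeneity of the local factors in `(a, b)`
(`summableSmooth_prod_localFactor`). -/

/-! ### The local factors of the Eisenstein series -/

/-- The function `(y / |a z + b|²)^s` of `z`, where `m = (a, b)`. -/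
def localFactor (s : ℂ) (m : ℝ × ℝ) (z : ℂ) : ℂ :=
  ((z.im / Complex.normSq (m.1 * z + m.2) : ℝ) : ℂ) ^ s

/-- The operator `∂/∂z = (∂/∂x - i ∂/∂y) / 2` in one variable. -/
def localWirtinger (g : ℂ → ℂ) (z : ℂ) : ℂ :=
  (1 / 2) * (lineDeriv ℝ g z 1 - Complex.I * lineDeriv ℝ g z Complex.I)

theorem hasDerivAt_ofReal_cpow {x : ℝ} (hx : 0 < x) (s : ℂ) :
    HasDerivAt (fun y : ℝ => (y : ℂ) ^ s) (s * (x : ℂ) ^ (s - 1)) x := by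
  have h := (hasDerivAt_id (x : ℂ)).cpow_const (c := s) (Or.inl (by simpa using hx))
  simpa using h.comp_ofReal

theorem lineDeriv_localFactor (s : ℂ) (m : ℝ × ℝ) {z : ℂ} (hz : 0 < z.im)
    (hm : (m.1 * z + m.2 : ℂ) ≠ 0) (v : ℂ) :
    lineDeriv ℝ (localFactor s m) z v =
      s * ((v.im / z.im - 2 * m.1 * (v.re * (m.1 * z.re + m.2) + v.im * (m.1 * z.im)) /
        Complex.normSq (m.1 * z + m.2) : ℝ) : ℂ) * localFactor s m z := by
  obtain ⟨a, b⟩ := m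
  simp only at hm ⊢
  have hn : 0 < Complex.normSq (a * z + b) := Complex.normSq_pos.2 hm
  set N := Complex.normSq (a * z + b) with hN
  have hN' : N = (a * z.re + b) ^ 2 + (a * z.im) ^ 2 := by
    rw [hN, Complex.normSq_apply]; simp; ring
  have hR : 0 < z.im / N := div_pos hz hn
  have e1 : ∀ t : ℝ, localFactor s (a, b) (z + t • v) =
      (((z.im + t * v.im) / ((a * (z.re + t * v.re) + b) ^ 2 + (a * (z.im + t * v.im)) ^ 2) : ℝ) :
        ℂ) ^ s := by
    intro t
    simp only [localFactor, Complex.normSq_apply]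
    congr 2
    simp
    ring
  have d1 : HasDerivAt (fun t : ℝ => z.im + t * v.im) v.im 0 := by
    simpa using ((hasDerivAt_id (0 : ℝ)).mul_const v.im).const_add z.im
  have d2 : HasDerivAt (fun t : ℝ => z.re + t * v.re) v.re 0 := by
    simpa using ((hasDerivAt_id (0 : ℝ)).mul_const v.re).const_add z.re
  have d3 : HasDerivAt (fun t : ℝ => (a * (z.re + t * v.re) + b) ^ 2 +
      (a * (z.im + t * v.im)) ^ 2)
      (2 * (a * z.re + b) * (a * v.re) + 2 * (a * z.im) * (a * v.im)) 0 := by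
    convert! (((d2.const_mul a).add_const b).pow 2).add ((d1.const_mul a).pow 2) using 1
    simp
  have d4 : HasDerivAt (fun t : ℝ => (z.im + t * v.im) /
      ((a * (z.re + t * v.re) + b) ^ 2 + (a * (z.im + t * v.im)) ^ 2))
      ((v.im / z.im - 2 * a * (v.re * (a * z.re + b) + v.im * (a * z.im)) / N) * (z.im / N)) 0 := by
    convert! d1.div d3 (by simpa [← hN'] using hn.ne') using 1
    simp only [zero_mul, add_zero, ← hN']
    field_simp
  have hR0 : ((z.im + 0 * v.im) /
      ((a * (z.re + 0 * v.re) + b) ^ 2 + (a * (z.im + 0 * v.im)) ^ 2)) = z.im / N := by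
    simp [hN']
  have d5 := (hasDerivAt_ofReal_cpow (x := (z.im + 0 * v.im) /
      ((a * (z.re + 0 * v.re) + b) ^ 2 + (a * (z.im + 0 * v.im)) ^ 2)) (by rwa [hR0]) s).scomp
      (0 : ℝ) d4
  rw [lineDeriv]
  simp_rw [e1]
  refine (d5.deriv).trans ?_
  rw [hR0]
  have h3 : localFactor s (a, b) z = ((z.im / N : ℝ) : ℂ) ^ (s - 1) * ((z.im / N : ℝ) : ℂ) := by
    rw [localFactor, Complex.cpow_sub _ _ (by exact_mod_cast hR.ne'), Complex.cpow_one,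
      div_mul_cancel₀ _ (by exact_mod_cast hR.ne')]
  rw [h3, Complex.real_smul]
  push_cast
  ring

/-- The logarithmic derivative of `y / |a z + b|²` along `∂/∂z` is `1/(2iy) - a/(a z + b)`, and `z -
2iy` is the conjugate of `z`. -/
theorem localWirtinger_localFactor (s : ℂ) (m : ℝ × ℝ) {z : ℂ} (hz : 0 < z.im)
    (hm : (m.1 * z + m.2 : ℂ) ≠ 0) :
    localWirtinger (localFactor s m) z =
      s / (2 * Complex.I * z.im) * ((m.1 * (starRingEnd ℂ) z + m.2) / (m.1 * z + m.2)) *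
        localFactor s m z := by
  rw [localWirtinger, lineDeriv_localFactor s m hz hm, lineDeriv_localFactor s m hz hm]
  obtain ⟨a, b⟩ := m
  simp only at hm ⊢
  have hc : (starRingEnd ℂ) (a * z + b) = a * (starRingEnd ℂ) z + b := by simp
  have hc0 : (a * (starRingEnd ℂ) z + b : ℂ) ≠ 0 := by
    rw [← hc]; exact (map_ne_zero _).2 hm
  have hN : ((Complex.normSq (a * z + b) : ℝ) : ℂ) =
      (a * z + b) * (a * (starRingEnd ℂ) z + b) := by
    rw [Complex.normSq_eq_conj_mul_self, hc, mul_comm]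
  have hzi : (z.im : ℂ) ≠ 0 := by exact_mod_cast hz.ne'
  have key : (1 / 2 : ℂ) * (((0 / z.im - 2 * a * (1 * (a * z.re + b) + 0 * (a * z.im)) /
        Complex.normSq (a * z + b) : ℝ) : ℂ) - Complex.I *
        ((1 / z.im - 2 * a * (0 * (a * z.re + b) + 1 * (a * z.im)) /
        Complex.normSq (a * z + b) : ℝ) : ℂ)) =
      1 / (2 * Complex.I * z.im) * ((a * (starRingEnd ℂ) z + b) / (a * z + b)) := by
    push_cast
    rw [hN]
    have h1 : (z : ℂ) = z.re + z.im * Complex.I := (Complex.re_add_im z).symm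
    have h2 : (starRingEnd ℂ) z = z.re - z.im * Complex.I := by
      apply Complex.ext <;> simp
    field_simp
    rw [h2] at *
    generalize (z.re : ℂ) = x at *
    generalize (z.im : ℂ) = y at *
    subst h1
    ring_nf
    simp only [Complex.I_sq, Complex.I_pow_four]
    ring
  simp only [Complex.one_re, Complex.one_im, Complex.I_re, Complex.I_im] at *
  linear_combination (s * localFactor s (a, b) z) * key

/-! ### The geodesics -/

/-- The sign `±1` of `q - p`, with value `1` at `p = q`. -/
def orient (p q : ℝ) : ℝ := if p ≤ q then 1 else -1

theorem orient_sq (p q : ℝ) : orient p q ^ 2 = 1 := by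
  unfold orient; split_ifs <;> norm_num

theorem orient_mul (p q : ℝ) : orient p q * (q - p) = |q - p| := by
  unfold orient; split_ifs with h
  · rw [abs_of_nonneg (by linarith)]; ring
  · rw [abs_of_nonpos (by linarith)]; ring

theorem orient_ne_zero (p q : ℝ) : orient p q ≠ 0 := by
  unfold orient; split_ifs <;> norm_num

theorem ofReal_sub_ofReal_mul_I_ne_zero {a b : ℝ} (h : a ≠ 0 ∨ b ≠ 0) :
    (a - b * Complex.I : ℂ) ≠ 0 := by
  intro h0
  have h1 := congrArg Complex.re h0
  have h2 := congrArg Complex.im h0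
  simp at h1 h2
  tauto

/-- The geodesic is the image of the half line `i e^x` under the real matrix with rows `(q, η p)`
and `(1, η)`, which sends `0` to `p` and `∞` to `q`. The sign `η = orient p q` makes its determinant
`|q - p|`, so the upper half plane is preserved. -/
theorem geodesic_eq (p q x : ℝ) :
    geodesic p q x = ((q * Real.exp x : ℝ) - (orient p q * p : ℝ) * Complex.I) /
      ((Real.exp x : ℝ) - (orient p q : ℝ) * Complex.I) := by
  rw [eq_div_iff (ofReal_sub_ofReal_mul_I_ne_zero (Or.inl (Real.exp_pos x).ne'))]
  have h1 := orient_mul p q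
  have h2 := orient_sq p q
  have hx := Real.exp_pos x
  have hc : Real.cosh x = (Real.exp x ^ 2 + 1) / (2 * Real.exp x) := by
    rw [Real.cosh_eq, Real.exp_neg]; field_simp
  have hs : Real.sinh x = (Real.exp x ^ 2 - 1) / (2 * Real.exp x) := by
    rw [Real.sinh_eq, Real.exp_neg]; field_simp
  have hX : (p + q) / 2 + (q - p) / 2 * Real.tanh x =
      (p + q * Real.exp x ^ 2) / (Real.exp x ^ 2 + 1) := by
    rw [Real.tanh_eq_sinh_div_cosh, hc, hs]
    field_simp
    ring
  have hY : |q - p| / 2 / Real.cosh x =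
      orient p q * (q - p) * Real.exp x / (Real.exp x ^ 2 + 1) := by
    rw [hc, ← h1]
    field_simp
  rw [geodesic, hX, hY]
  generalize orient p q = η at *
  generalize Real.exp x = t at *
  have e1 : (p + q * t ^ 2) / (t ^ 2 + 1) * t + η * (q - p) * t / (t ^ 2 + 1) * η = q * t := by
    field_simp
    linear_combination (q - p) * h2
  have e2 : η * (q - p) * t / (t ^ 2 + 1) * t - (p + q * t ^ 2) / (t ^ 2 + 1) * η = -(η * p) := by
    field_simp
    ring
  generalize (p + q * t ^ 2) / (t ^ 2 + 1) = X at *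
  generalize η * (q - p) * t / (t ^ 2 + 1) = Y at *
  apply Complex.ext
  · simp
    linarith
  · simp
    linarith

theorem geodesic_im (p q x : ℝ) :
    (geodesic p q x).im = |q - p| * Real.exp x / (Real.exp x ^ 2 + 1) := by
  have hc : Real.cosh x = (Real.exp x ^ 2 + 1) / (2 * Real.exp x) := by
    rw [Real.cosh_eq, Real.exp_neg]
    have hx := Real.exp_pos x
    field_simp
  have hx := Real.exp_pos x
  simp only [geodesic, Complex.add_im, Complex.ofReal_im, zero_add, Complex.mul_im,
    Complex.ofReal_re, Complex.I_im, mul_one, Complex.I_re, mul_zero, add_zero]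
  rw [hc]
  field_simp

theorem geodesic_im_pos {p q : ℝ} (h : p ≠ q) (x : ℝ) : 0 < (geodesic p q x).im := by
  rw [geodesic_im]
  have : 0 < |q - p| := abs_pos.2 (sub_ne_zero.2 h.symm)
  positivity

theorem hasDerivAt_geodesic (p q x : ℝ) :
    HasDerivAt (geodesic p q) (-(Real.exp x * |q - p| : ℝ) * Complex.I /
      ((Real.exp x : ℝ) - (orient p q : ℝ) * Complex.I) ^ 2) x := by
  have h0 := ofReal_sub_ofReal_mul_I_ne_zero (b := orient p q) (Or.inl (Real.exp_pos x).ne')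
  have d1 : HasDerivAt (fun x : ℝ => ((Real.exp x : ℝ) : ℂ)) (Real.exp x : ℝ) x :=
    (Real.hasDerivAt_exp x).ofReal_comp
  have d2 := ((d1.const_mul (q : ℂ)).sub_const (((orient p q * p : ℝ) : ℂ) * Complex.I)).div
    (d1.sub_const (((orient p q : ℝ) : ℂ) * Complex.I)) h0
  have e : geodesic p q = fun x : ℝ =>
      ((q : ℂ) * (Real.exp x : ℝ) - (orient p q * p : ℝ) * Complex.I) /
      ((Real.exp x : ℝ) - (orient p q : ℝ) * Complex.I) := by
    funext x
    rw [geodesic_eq]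
    push_cast
    rfl
  rw [e]
  convert! d2 using 1
  congr 1
  rw [← orient_mul]
  push_cast
  ring

/-- The pull-back of `∂g dz` to the geodesic from `p` to `q`, where `g = (y / |a z + b|²)^s`,
`u = a p + b` and `w = a q + b`. -/
def localForm (s : ℂ) (p q u w x : ℝ) : ℂ :=
  -(s / 2) * (((w * Real.exp x : ℝ) + (orient p q * u : ℝ) * Complex.I) /
    ((w * Real.exp x : ℝ) - (orient p q * u : ℝ) * Complex.I)) *
    ((|q - p| * Real.exp x / (w ^ 2 * Real.exp x ^ 2 + u ^ 2) : ℝ) : ℂ) ^ s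

/-- With `T = e^x - η i`, the values of `a z + b`, `y` and `dz/dx` all have powers of `T` and its
conjugate as denominators. These cancel in the product, leaving only the end point values. -/
theorem localForm_eq (s : ℂ) {p q : ℝ} (hpq : p ≠ q) (a b x : ℝ) (hab : a ≠ 0 ∨ b ≠ 0) :
    localWirtinger (localFactor s (a, b)) (geodesic p q x) * deriv (geodesic p q) x =
      localForm s p q (a * p + b) (a * q + b) x := by
  have hy := geodesic_im_pos hpq x
  have hx := Real.exp_pos x
  have h2 := orient_sq p q
  have hη := orient_ne_zero p q
  have hd : 0 < |q - p| := abs_pos.2 (sub_ne_zero.2 hpq.symm)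
  have huw : (a * q + b) * Real.exp x ≠ 0 ∨ orient p q * (a * p + b) ≠ 0 := by
    by_contra! h
    have h3 : a * q + b = 0 := by simpa [hx.ne'] using h.1
    have h4 : a * p + b = 0 := by simpa [hη] using h.2
    have h5 : a = 0 := by
      have : a * (q - p) = 0 := by linarith
      simpa [sub_ne_zero.2 hpq.symm] using this
    subst h5
    simp at h3
    simp [h3] at hab
  have ht := ofReal_sub_ofReal_mul_I_ne_zero (b := orient p q) (Or.inl hx.ne')
  have ht' : ((Real.exp x : ℝ) + (orient p q : ℝ) * Complex.I : ℂ) ≠ 0 := by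
    simpa using ofReal_sub_ofReal_mul_I_ne_zero (b := -orient p q) (Or.inl hx.ne')
  have hξ := ofReal_sub_ofReal_mul_I_ne_zero huw
  have hz : (a * geodesic p q x + b : ℂ) =
      (((a * q + b) * Real.exp x : ℝ) - (orient p q * (a * p + b) : ℝ) * Complex.I) /
      ((Real.exp x : ℝ) - (orient p q : ℝ) * Complex.I) := by
    rw [geodesic_eq, eq_div_iff ht, add_mul, mul_assoc, div_mul_cancel₀ _ ht]
    push_cast
    ring
  have hzc : (a * (starRingEnd ℂ) (geodesic p q x) + b : ℂ) =
      (((a * q + b) * Real.exp x : ℝ) + (orient p q * (a * p + b) : ℝ) * Complex.I) /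
      ((Real.exp x : ℝ) + (orient p q : ℝ) * Complex.I) := by
    have : (a * (starRingEnd ℂ) (geodesic p q x) + b : ℂ) =
      (starRingEnd ℂ) (a * geodesic p q x + b) := by simp
    rw [this, hz]
    simp only [map_div₀, map_sub, map_mul, Complex.conj_ofReal, Complex.conj_I]
    congr 1 <;> ring
  have hz0 : (a * geodesic p q x + b : ℂ) ≠ 0 := by
    rw [hz]; exact div_ne_zero hξ ht
  have hnorm : ∀ c d : ℝ, Complex.normSq ((c : ℂ) - (d : ℂ) * Complex.I) = c ^ 2 + d ^ 2 := by
    intro c d; rw [Complex.normSq_apply]; simp; ring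
  have hR : (geodesic p q x).im / Complex.normSq (a * geodesic p q x + b) =
      |q - p| * Real.exp x / ((a * q + b) ^ 2 * Real.exp x ^ 2 + (a * p + b) ^ 2) := by
    rw [hz, Complex.normSq_div, hnorm, hnorm, geodesic_im, mul_pow, mul_pow, h2, one_mul]
    field_simp
  rw [localWirtinger_localFactor s (a, b) hy hz0, (hasDerivAt_geodesic p q x).deriv, localForm,
    localFactor]
  simp only
  rw [hR, hz, hzc, geodesic_im]
  generalize ((|q - p| * Real.exp x / ((a * q + b) ^ 2 * Real.exp x ^ 2 + (a * p + b) ^ 2) : ℝ) :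
    ℂ) ^ s = G
  have hd' : ((|q - p| : ℝ) : ℂ) ≠ 0 := by exact_mod_cast hd.ne'
  have hx' : ((Real.exp x : ℝ) : ℂ) ≠ 0 := by exact_mod_cast hx.ne'
  have h2' : ((orient p q : ℝ) : ℂ) ^ 2 = 1 := by exact_mod_cast h2
  have hprod : ((Real.exp x : ℝ) : ℂ) ^ 2 + 1 =
      ((Real.exp x : ℝ) + (orient p q : ℝ) * Complex.I) *
      ((Real.exp x : ℝ) - (orient p q : ℝ) * Complex.I) := by
    linear_combination (Complex.I ^ 2) * h2' + Complex.I_sq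
  generalize ((a * q + b) * Real.exp x : ℝ) = c at *
  generalize (orient p q * (a * p + b) : ℝ) = d at *
  simp only [Complex.ofReal_div, Complex.ofReal_mul, Complex.ofReal_add, Complex.ofReal_pow,
    Complex.ofReal_one]
  rw [hprod]
  generalize ((Real.exp x : ℝ) : ℂ) = t at *
  generalize ((orient p q : ℝ) : ℂ) = η at *
  generalize ((|q - p| : ℝ) : ℂ) = D at *
  have hI := Complex.I_ne_zero
  generalize ((c : ℂ) + d * Complex.I) = ξ' at *
  generalize ((c : ℂ) - d * Complex.I) = ξ at *
  generalize t + η * Complex.I = T' at *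
  generalize t - η * Complex.I = T at *
  field_simp

/-- The form depends on `w e^x` and `u`. Pulling out the common factor `e` replaces `e^x` by `e^x
e'/e`, which is a translation of `x`. -/
theorem localForm_smul (s : ℂ) (p q u w x e e' : ℝ) (he : 0 < e * e') :
    localForm s p q (e * u) (e' * w) x =
      ((e * e' : ℝ) : ℂ) ^ (-s) * localForm s p q u w (x + (Real.log e' - Real.log e)) := by
  have he0 : e ≠ 0 := left_ne_zero_of_mul he.ne'
  have he0' : e' ≠ 0 := right_ne_zero_of_mul he.ne'
  -- Both `e` and `e'` may be negative: `Real.log` sees only absolute values, and `e' / e` is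
  -- positive.
  have hexp : Real.exp (x + (Real.log e' - Real.log e)) = Real.exp x * (e' / e) := by
    have h1 : Real.log e' - Real.log e = Real.log (e' / e) := (Real.log_div he0' he0).symm
    have h2 : 0 < e' / e := by
      rw [← mul_div_mul_left _ _ he0]
      exact div_pos he (mul_self_pos.2 he0)
    rw [h1, Real.exp_add, Real.exp_log h2]
  have hx := Real.exp_pos x
  rw [localForm, localForm, hexp]
  have h1 : ((|q - p| * Real.exp x / ((e' * w) ^ 2 * Real.exp x ^ 2 + (e * u) ^ 2) : ℝ) : ℂ) ^ s =
      ((e * e' : ℝ) : ℂ) ^ (-s) * ((|q - p| * (Real.exp x * (e' / e)) /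
        (w ^ 2 * (Real.exp x * (e' / e)) ^ 2 + u ^ 2) : ℝ) : ℂ) ^ s := by
    have h2 : |q - p| * Real.exp x / ((e' * w) ^ 2 * Real.exp x ^ 2 + (e * u) ^ 2) =
        (e * e')⁻¹ * (|q - p| * (Real.exp x * (e' / e)) /
        (w ^ 2 * (Real.exp x * (e' / e)) ^ 2 + u ^ 2)) := by
      have h3 : w ^ 2 * (Real.exp x * (e' / e)) ^ 2 + u ^ 2 =
        ((e' * w) ^ 2 * Real.exp x ^ 2 + (e * u) ^ 2) / e ^ 2 := by
        field_simp
      rw [h3]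
      field_simp
    have h4 : 0 ≤ |q - p| * (Real.exp x * (e' / e)) /
        (w ^ 2 * (Real.exp x * (e' / e)) ^ 2 + u ^ 2) := by
      have h5 : 0 < e' / e := by
        rw [← mul_div_mul_left _ _ he0]
        exact div_pos he (mul_self_pos.2 he0)
      positivity
    rw [h2, Complex.ofReal_mul, Complex.mul_cpow_ofReal_nonneg (inv_nonneg.2 he.le) h4,
      Complex.ofReal_inv, Complex.inv_cpow_eq_ite, if_neg, Complex.cpow_neg]
    rw [Complex.arg_ofReal_of_nonneg he.le]
    exact Real.pi_pos.ne
  rw [h1]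
  have he1 : (e : ℂ) ≠ 0 := by exact_mod_cast he0
  have h6 : ∀ σ : ℂ, ((e' * w * Real.exp x : ℝ) : ℂ) + σ * ((orient p q * (e * u) : ℝ) * Complex.I) =
      e * (((w * (Real.exp x * (e' / e)) : ℝ) : ℂ) + σ * ((orient p q * u : ℝ) * Complex.I)) := by
    intro σ
    push_cast
    field_simp
  have h7 := h6 1
  have h8 := h6 (-1)
  rw [one_mul, one_mul] at h7
  rw [neg_one_mul, ← sub_eq_add_neg, neg_one_mul, ← sub_eq_add_neg] at h8
  rw [h7, h8, mul_div_mul_left _ _ he1]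
  ring

end HilbertEisenstein

/-! ### The beta integral and the integral of the form over one geodesic -/

namespace HilbertEisenstein

open MeasureTheory

theorem sigmoid_two_mul_mul (x : ℝ) :
    Real.sigmoid (2 * x) * (1 - Real.sigmoid (2 * x)) = (2 * Real.cosh x)⁻¹ ^ 2 := by
  rw [← Real.sigmoid_neg, Real.sigmoid_def, Real.sigmoid_def, Real.cosh_eq]
  have h : Real.exp (-x) = (Real.exp x)⁻¹ := Real.exp_neg x
  have h1 : Real.exp (-(2 * x)) = (Real.exp x)⁻¹ ^ 2 := by
    rw [← h, ← Real.exp_nat_mul]; congr 1; push_cast; ring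
  have h2 : Real.exp (-(-(2 * x))) = Real.exp x ^ 2 := by
    rw [← Real.exp_nat_mul]; congr 1; push_cast; ring
  rw [h, h1, h2]
  have := Real.exp_pos x
  field_simp
  ring

theorem image_sigmoid_two_mul : (fun x : ℝ => Real.sigmoid (2 * x)) '' Set.univ = Set.Ioo 0 1 := by
  rw [Set.image_univ, ← Real.range_sigmoid]
  exact (Equiv.mulLeft₀ (2 : ℝ) two_ne_zero).surjective.range_comp Real.sigmoid

/-- The substitution `t = sigmoid (2x)`, for which `t (1 - t) = (2 cosh x)⁻²` and `dt = 2 t (1 - t)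
dx`, carries the integral for `B(s/2, s/2)` to twice the integral of `(2 cosh x)^(-s)`. -/
theorem betaIntegrand_sigmoid (s : ℂ) (x : ℝ) :
    |2 * (Real.sigmoid (2 * x) * (1 - Real.sigmoid (2 * x)))| •
      (((Real.sigmoid (2 * x) : ℝ) : ℂ) ^ (s / 2 - 1) *
        (1 - ((Real.sigmoid (2 * x) : ℝ) : ℂ)) ^ (s / 2 - 1)) =
      2 * (((2 * Real.cosh x)⁻¹ : ℝ) : ℂ) ^ s := by
  have h0 : 0 < Real.sigmoid (2 * x) := Real.sigmoid_pos _
  have h1 : 0 < 1 - Real.sigmoid (2 * x) := sub_pos.2 (Real.sigmoid_lt_one _)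
  have hc : 0 < (2 * Real.cosh x)⁻¹ := by have := Real.cosh_pos x; positivity
  have h2 : (((Real.sigmoid (2 * x) : ℝ) : ℂ) ^ (s / 2 - 1) *
        (1 - ((Real.sigmoid (2 * x) : ℝ) : ℂ)) ^ (s / 2 - 1)) =
      (((2 * Real.cosh x)⁻¹ ^ 2 : ℝ) : ℂ) ^ (s / 2 - 1) := by
    rw [← sigmoid_two_mul_mul, Complex.ofReal_mul, Complex.mul_cpow_ofReal_nonneg h0.le h1.le]
    push_cast
    rfl
  rw [h2, sigmoid_two_mul_mul, abs_of_pos (by positivity), Complex.real_smul,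
    Complex.cpow_sub _ _ (by exact_mod_cast (pow_pos hc 2).ne'), Complex.cpow_one]
  have h3 : (((2 * Real.cosh x)⁻¹ ^ 2 : ℝ) : ℂ) ^ (s / 2) = (((2 * Real.cosh x)⁻¹ : ℝ) : ℂ) ^ s := by
    rw [pow_two, Complex.ofReal_mul, Complex.mul_cpow_ofReal_nonneg hc.le hc.le,
      ← Complex.cpow_add _ _ (by exact_mod_cast hc.ne')]
    congr 1
    ring
  rw [h3]
  have h4 : (((2 * Real.cosh x)⁻¹ ^ 2 : ℝ) : ℂ) ≠ 0 := by exact_mod_cast (pow_pos hc 2).ne'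
  rw [Complex.ofReal_mul]
  generalize (((2 * Real.cosh x)⁻¹ ^ 2 : ℝ) : ℂ) = Y at *
  push_cast
  field_simp

theorem hasDerivAt_sigmoid_two_mul (x : ℝ) :
    HasDerivAt (fun x : ℝ => Real.sigmoid (2 * x))
      (2 * (Real.sigmoid (2 * x) * (1 - Real.sigmoid (2 * x)))) x := by
  have h := (Real.hasDerivAt_sigmoid (2 * x)).comp x ((hasDerivAt_id x).const_mul 2)
  simpa [Function.comp_def, mul_comm] using h

theorem injOn_sigmoid_two_mul : Set.InjOn (fun x : ℝ => Real.sigmoid (2 * x)) Set.univ := by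
  intro x _ y _ h
  simpa using Real.sigmoid_injective h

theorem integrable_cosh_cpow {s : ℂ} (hs : 0 < s.re) :
    Integrable fun x : ℝ => (((2 * Real.cosh x)⁻¹ : ℝ) : ℂ) ^ s := by
  have hs2 : 0 < (s / 2).re := by simpa using hs
  have h := Complex.betaIntegral_convergent hs2 hs2
  rw [intervalIntegrable_iff_integrableOn_Ioo_of_le zero_le_one, ← image_sigmoid_two_mul,
    integrableOn_image_iff_integrableOn_abs_deriv_smul MeasurableSet.univ
      (fun x _ => (hasDerivAt_sigmoid_two_mul x).hasDerivWithinAt) injOn_sigmoid_two_mul] at h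
  simp_rw [betaIntegrand_sigmoid] at h
  rw [integrableOn_univ] at h
  exact (integrable_const_mul_iff (by simp) _).1 h

theorem integral_cosh_cpow {s : ℂ} (hs : 0 < s.re) :
    ∫ x : ℝ, (((2 * Real.cosh x)⁻¹ : ℝ) : ℂ) ^ s =
      Complex.Gamma (s / 2) ^ 2 / (2 * Complex.Gamma s) := by
  have hs2 : 0 < (s / 2).re := by simpa using hs
  have h := Complex.betaIntegral_eq_Gamma_mul_div (s / 2) (s / 2) hs2 hs2
  rw [Complex.betaIntegral, intervalIntegral.integral_of_le zero_le_one,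
    integral_Ioc_eq_integral_Ioo, ← image_sigmoid_two_mul,
    integral_image_eq_integral_abs_deriv_smul MeasurableSet.univ
      (fun x _ => (hasDerivAt_sigmoid_two_mul x).hasDerivWithinAt) injOn_sigmoid_two_mul] at h
  simp_rw [betaIntegrand_sigmoid] at h
  rw [Measure.restrict_univ, integral_const_mul, add_halves] at h
  have hG : Complex.Gamma s ≠ 0 := Complex.Gamma_ne_zero_of_re_pos hs
  rw [eq_div_iff (by simpa using hG)]
  rw [eq_div_iff hG] at h
  linear_combination h

/-- For `u, w = ±1` the unimodular quotient in the form has real part `tanh x` and imaginary part `±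
1 / cosh x`. The first part is odd; the second remembers the sign of `u w` and raises the exponent
to `s + 1`. -/
theorem localForm_of_sq_eq_one (s : ℂ) (p q : ℝ) {a b : ℝ} (ha : a ^ 2 = 1) (hb : b ^ 2 = 1)
    (x : ℝ) :
    localForm s p q a b x = -(s / 2) * ((|q - p| : ℝ) : ℂ) ^ s *
      ((Real.tanh x : ℝ) * (((2 * Real.cosh x)⁻¹ : ℝ) : ℂ) ^ s +
        (2 * Complex.I * (orient p q * a * b : ℝ)) *
          (((2 * Real.cosh x)⁻¹ : ℝ) : ℂ) ^ (s + 1)) := by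
  have hη := orient_sq p q
  have hx := Real.exp_pos x
  have hc0 := Real.cosh_pos x
  have hc : Real.cosh x = (Real.exp x ^ 2 + 1) / (2 * Real.exp x) := by
    rw [Real.cosh_eq, Real.exp_neg]; field_simp
  have hs : Real.sinh x = (Real.exp x ^ 2 - 1) / (2 * Real.exp x) := by
    rw [Real.sinh_eq, Real.exp_neg]; field_simp
  have hh : 0 < (2 * Real.cosh x)⁻¹ := by positivity
  have h1 : |q - p| * Real.exp x / (b ^ 2 * Real.exp x ^ 2 + a ^ 2) =
      |q - p| * (2 * Real.cosh x)⁻¹ := by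
    rw [ha, hb, hc]
    field_simp
  have h1' : ((|q - p| * (2 * Real.cosh x)⁻¹ : ℝ) : ℂ) ^ s =
      ((|q - p| : ℝ) : ℂ) ^ s * (((2 * Real.cosh x)⁻¹ : ℝ) : ℂ) ^ s := by
    rw [Complex.ofReal_mul, Complex.mul_cpow_ofReal_nonneg (abs_nonneg _) hh.le]
  rw [localForm, h1, h1',
    Complex.cpow_add _ _ (by exact_mod_cast hh.ne'), Complex.cpow_one]
  generalize (((2 * Real.cosh x)⁻¹ : ℝ) : ℂ) ^ s = G
  have h2 : (((b * Real.exp x : ℝ) : ℂ) + (orient p q * a : ℝ) * Complex.I) /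
      ((b * Real.exp x : ℝ) - (orient p q * a : ℝ) * Complex.I) =
      (Real.tanh x : ℝ) + 2 * Complex.I * (orient p q * a * b : ℝ) *
        (((2 * Real.cosh x)⁻¹ : ℝ) : ℂ) := by
    have hb0 : b ≠ 0 := by rintro rfl; simp at hb
    rw [div_eq_iff (ofReal_sub_ofReal_mul_I_ne_zero (Or.inl (mul_ne_zero hb0 hx.ne'))),
      Real.tanh_eq_sinh_div_cosh]
    have e1 : Real.sinh x / Real.cosh x = (Real.exp x ^ 2 - 1) / (Real.exp x ^ 2 + 1) := by
      rw [hc, hs]; field_simp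
    have e2 : (2 * Real.cosh x)⁻¹ = Real.exp x / (Real.exp x ^ 2 + 1) := by
      rw [hc]; field_simp
    rw [e1, e2]
    generalize Real.exp x = t at *
    generalize orient p q = η at *
    have e3 : (t ^ 2 - 1) / (t ^ 2 + 1) * (b * t) +
        2 * (η * a * b) * (t / (t ^ 2 + 1)) * (η * a) = b * t := by
      have : η ^ 2 * a ^ 2 = 1 := by rw [ha, hη, one_mul]
      field_simp
      linear_combination 2 * this
    have e4 : 2 * (η * a * b) * (t / (t ^ 2 + 1)) * (b * t) -
        (t ^ 2 - 1) / (t ^ 2 + 1) * (η * a) = η * a := by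
      field_simp
      linear_combination (2 * t ^ 2 * η * a) * hb
    generalize (t ^ 2 - 1) / (t ^ 2 + 1) = X at *
    generalize (t / (t ^ 2 + 1)) = Y at *
    apply Complex.ext
    · simp
      linarith
    · simp
      linarith
  rw [h2]
  ring

theorem norm_localForm (s : ℂ) {p q u w : ℝ} (hpq : p ≠ q) (hu : u ≠ 0) (x : ℝ) :
    ‖localForm s p q u w x‖ =
      ‖s / 2‖ * (|q - p| * Real.exp x / (w ^ 2 * Real.exp x ^ 2 + u ^ 2)) ^ s.re := by
  have hx := Real.exp_pos x
  have hd : 0 < |q - p| := abs_pos.2 (sub_ne_zero.2 hpq.symm)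
  rw [localForm, norm_mul, norm_mul, norm_neg, norm_div (_ + _) _,
    Complex.norm_cpow_eq_rpow_re_of_pos (by positivity)]
  have h0 := ofReal_sub_ofReal_mul_I_ne_zero (a := w * Real.exp x) (b := orient p q * u)
    (Or.inr (mul_ne_zero (orient_ne_zero p q) hu))
  have h1 : ‖((w * Real.exp x : ℝ) : ℂ) + (orient p q * u : ℝ) * Complex.I‖ =
      ‖((w * Real.exp x : ℝ) : ℂ) - (orient p q * u : ℝ) * Complex.I‖ := by
    rw [← Complex.norm_conj]
    congr 1
    simp only [map_add, map_mul, Complex.conj_ofReal, Complex.conj_I]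
    ring
  rw [h1, div_self (norm_ne_zero_iff.2 h0), mul_one]

/-- Scaling by `|u|` and `|w|` leaves only the signs, so integrals over the line reduce to the case
`u, w = ±1`. -/
theorem localForm_eq_shift (s : ℂ) (p q : ℝ) {u w : ℝ} (hu : u ≠ 0) (hw : w ≠ 0) (x : ℝ) :
    localForm s p q u w x = ((|u * w| : ℝ) : ℂ) ^ (-s) *
      localForm s p q (SignType.sign u : ℝ) (SignType.sign w : ℝ)
        (x + (Real.log |w| - Real.log |u|)) := by
  have h := localForm_smul s p q (SignType.sign u : ℝ) (SignType.sign w : ℝ) x |u| |w|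
    (by positivity)
  rw [abs_mul_sign, abs_mul_sign, ← abs_mul] at h
  exact h

theorem sign_sq {u : ℝ} (hu : u ≠ 0) : ((SignType.sign u : ℝ)) ^ 2 = 1 := by
  rcases hu.lt_or_gt with h | h <;> simp [h]

theorem continuous_real_tanh : Continuous Real.tanh := by
  have : Real.tanh = fun x => Real.sinh x / Real.cosh x := funext Real.tanh_eq_sinh_div_cosh
  rw [this]
  exact Real.continuous_sinh.div Real.continuous_cosh fun x => (Real.cosh_pos x).ne'

theorem integrable_localForm_sign {s : ℂ} (hs : 0 < s.re) (p q : ℝ) {a b : ℝ} (ha : a ^ 2 = 1)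
    (hb : b ^ 2 = 1) : Integrable (localForm s p q a b) := by
  have h1 := integrable_cosh_cpow hs
  have h2 := integrable_cosh_cpow (s := s + 1) (by simpa using by linarith)
  have h3 : Integrable fun x : ℝ => ((Real.tanh x : ℝ) : ℂ) *
      (((2 * Real.cosh x)⁻¹ : ℝ) : ℂ) ^ s := by
    refine h1.bdd_mul (c := 1) ?_ ?_
    · exact (Complex.continuous_ofReal.comp continuous_real_tanh).aestronglyMeasurable
    · refine Filter.Eventually.of_forall fun x => ?_
      rw [Complex.norm_real, Real.norm_eq_abs]
      exact (Real.abs_tanh_lt_one x).le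
  have h4 := (h3.add (h2.const_mul (2 * Complex.I * (orient p q * a * b : ℝ)))).const_mul
    (-(s / 2) * ((|q - p| : ℝ) : ℂ) ^ s)
  refine h4.congr (Filter.Eventually.of_forall fun x => ?_)
  exact (localForm_of_sq_eq_one s p q ha hb x).symm

theorem integrable_localForm {s : ℂ} (hs : 0 < s.re) (p q : ℝ) {u w : ℝ} (hu : u ≠ 0)
    (hw : w ≠ 0) : Integrable (localForm s p q u w) := by
  have h := ((integrable_localForm_sign hs p q (sign_sq hu) (sign_sq hw)).comp_add_right
    (Real.log |w| - Real.log |u|)).const_mul (((|u * w| : ℝ) : ℂ) ^ (-s))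
  refine h.congr (Filter.Eventually.of_forall fun x => ?_)
  exact (localForm_eq_shift s p q hu hw x).symm

theorem integral_localForm {s : ℂ} (hs : 0 < s.re) (p q : ℝ) {u w : ℝ} (hu : u ≠ 0)
    (hw : w ≠ 0) :
    ∫ x, localForm s p q u w x =
      Complex.Gamma ((s + 1) / 2) ^ 2 / (2 * Complex.I * Complex.Gamma s) *
        (orient p q * SignType.sign (u * w) : ℝ) * ((|q - p| : ℝ) : ℂ) ^ s *
          ((|u * w| : ℝ) : ℂ) ^ (-s) := by
  have h1 := integrable_cosh_cpow hs
  have h2 := integrable_cosh_cpow (s := s + 1) (by simpa using by linarith)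
  -- The integrand is odd, so its integral equals its own negative.
  have h3 : ∫ x : ℝ, ((Real.tanh x : ℝ) : ℂ) * (((2 * Real.cosh x)⁻¹ : ℝ) : ℂ) ^ s = 0 := by
    have h := integral_neg_eq_self
      (fun x : ℝ => ((Real.tanh x : ℝ) : ℂ) * (((2 * Real.cosh x)⁻¹ : ℝ) : ℂ) ^ s) volume
    simp only [Real.tanh_neg, Real.cosh_neg, Complex.ofReal_neg, neg_mul, integral_neg] at h
    have h' : (2 : ℂ) * ∫ x : ℝ, ((Real.tanh x : ℝ) : ℂ) *
      (((2 * Real.cosh x)⁻¹ : ℝ) : ℂ) ^ s = 0 := by linear_combination -h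
    simpa using h'
  have h3' : Integrable fun x : ℝ => ((Real.tanh x : ℝ) : ℂ) *
      (((2 * Real.cosh x)⁻¹ : ℝ) : ℂ) ^ s := by
    refine h1.bdd_mul (c := 1) ?_ ?_
    · exact (Complex.continuous_ofReal.comp continuous_real_tanh).aestronglyMeasurable
    · refine Filter.Eventually.of_forall fun x => ?_
      rw [Complex.norm_real, Real.norm_eq_abs]
      exact (Real.abs_tanh_lt_one x).le
  simp_rw [localForm_eq_shift s p q hu hw]
  rw [integral_const_mul, integral_add_right_eq_self (localForm s p q _ _)]
  simp_rw [localForm_of_sq_eq_one s p q (sign_sq hu) (sign_sq hw)]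
  rw [integral_const_mul, integral_add h3' (h2.const_mul _), h3, integral_const_mul,
    integral_cosh_cpow (by simpa using by linarith)]
  have hs0 : s ≠ 0 := by rintro rfl; simp at hs
  have hG : Complex.Gamma s ≠ 0 := Complex.Gamma_ne_zero_of_re_pos hs
  rw [Complex.Gamma_add_one s hs0, sign_mul, SignType.coe_mul]
  have hI := Complex.I_ne_zero
  push_cast
  field_simp
  generalize ((|u * w| : ℝ) : ℂ) ^ (-s) = X
  linear_combination (-X * ((|q - p| : ℝ) : ℂ) ^ s * orient p q * (SignType.sign u : ℝ) *
    (SignType.sign w : ℝ) * Complex.Gamma ((s + 1) / 2) ^ 2) * Complex.I_sq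

/-- The quotient in the form has absolute value one, so the norm does not see the signs of `u` and
`w`. This gives one constant for all `u, w`, as is needed to sum the `L¹` norms over the module. -/
theorem integral_norm_localForm {s : ℂ} {p q : ℝ} (hpq : p ≠ q) :
    ∃ C : ℝ, ∀ u w : ℝ, u ≠ 0 → w ≠ 0 →
      ∫ x, ‖localForm s p q u w x‖ = C * |u * w| ^ (-s.re) := by
  refine ⟨∫ x, ‖s / 2‖ * (|q - p| * Real.exp x / (Real.exp x ^ 2 + 1)) ^ s.re, fun u w hu hw => ?_⟩
  simp_rw [localForm_eq_shift s p q hu hw, norm_mul]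
  rw [integral_const_mul, integral_add_right_eq_self (fun x => ‖localForm s p q _ _ x‖),
    Complex.norm_cpow_eq_rpow_re_of_pos (abs_pos.2 (mul_ne_zero hu hw)), mul_comm, Complex.neg_re]
  congr 2
  funext x
  rw [norm_localForm s hpq, sign_sq hu, sign_sq hw, one_mul]
  intro h
  have := sign_sq hu
  rw [h] at this
  norm_num at this

end HilbertEisenstein

namespace HilbertEisenstein

open Filter Topology
open scoped ContDiff

universe u

/-! ### Series of smooth functions -/

/-- A family of functions, smooth on `U`, such that the series of their derivatives of any order
converge normally near every point of `U`. -/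
def SummableSmooth {Q E G : Type*} [NormedAddCommGroup E] [NormedSpace ℝ E] [NormedAddCommGroup G]
    [NormedSpace ℝ G] (f : Q → E → G) (U : Set E) : Prop :=
  (∀ q, ContDiffOn ℝ ∞ (f q) U) ∧
    ∀ k : ℕ, ∀ x ∈ U, ∃ W ∈ 𝓝 x, ∃ b : Q → ℝ, Summable b ∧
      ∀ q, ∀ y ∈ W, ‖iteratedFDeriv ℝ k (f q) y‖ ≤ b q

section SmoothSums

variable {Q E G H : Type*} [NormedAddCommGroup E] [NormedSpace ℝ E] [NormedAddCommGroup G]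
  [NormedSpace ℝ G] [NormedAddCommGroup H] [NormedSpace ℝ H] {f : Q → E → G} {U : Set E}

theorem SummableSmooth.summable [CompleteSpace G] (hf : SummableSmooth f U) {x : E} (hx : x ∈ U) :
    Summable fun q => f q x := by
  obtain ⟨W, hW, b, hb, h⟩ := hf.2 0 x hx
  exact Summable.of_norm_bounded hb fun q => by simpa using h q x (mem_of_mem_nhds hW)

theorem SummableSmooth.contDiffAt (hf : SummableSmooth f U) (hU : IsOpen U) {x : E} (hx : x ∈ U)
    (q : Q) : ContDiffAt ℝ ∞ (f q) x :=
  (hf.1 q).contDiffAt (hU.mem_nhds hx)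

theorem SummableSmooth.congr {g : Q → E → G} (hf : SummableSmooth f U) (hU : IsOpen U)
    (h : ∀ q, ∀ x ∈ U, g q x = f q x) : SummableSmooth g U := by
  refine ⟨fun q => (hf.1 q).congr (h q), fun k x hx => ?_⟩
  obtain ⟨W, hW, b, hb, hWb⟩ := hf.2 k x hx
  refine ⟨W ∩ U, inter_mem hW (hU.mem_nhds hx), b, hb, fun q y hy => ?_⟩
  have h1 : g q =ᶠ[𝓝 y] f q := by
    filter_upwards [hU.mem_nhds hy.2] with y' hy' using h q y' hy'
  rw [(h1.iteratedFDeriv ℝ k).eq_of_nhds]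
  exact hWb q y hy.1

theorem SummableSmooth.fderiv (hf : SummableSmooth f U) (hU : IsOpen U) :
    SummableSmooth (fun q => fderiv ℝ (f q)) U := by
  refine ⟨fun q => (hf.1 q).fderiv_of_isOpen hU (by simp), fun k x hx => ?_⟩
  obtain ⟨W, hW, b, hb, h⟩ := hf.2 (k + 1) x hx
  exact ⟨W, hW, b, hb, fun q y hy => by rw [norm_iteratedFDeriv_fderiv]; exact h q y hy⟩

theorem SummableSmooth.clm_comp (hf : SummableSmooth f U) (hU : IsOpen U) (L : G →L[ℝ] H) :
    SummableSmooth (fun q => L ∘ f q) U := by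
  refine ⟨fun q => L.contDiff.comp_contDiffOn (hf.1 q), fun k x hx => ?_⟩
  obtain ⟨W, hW, b, hb, h⟩ := hf.2 k x hx
  refine ⟨W ∩ U, inter_mem hW (hU.mem_nhds hx), fun q => ‖L‖ * b q, hb.mul_left _,
    fun q y hy => ?_⟩
  refine (L.norm_iteratedFDeriv_comp_left (hf.contDiffAt hU hy.2 q)
    (by exact_mod_cast le_top)).trans ?_
  exact mul_le_mul_of_nonneg_left (h q y hy.1) (norm_nonneg _)

theorem SummableSmooth.hasFDerivAt_tsum [CompleteSpace G] (hf : SummableSmooth f U)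
    (hU : IsOpen U) {x : E} (hx : x ∈ U) :
    HasFDerivAt (fun y => ∑' q, f q y) (∑' q, _root_.fderiv ℝ (f q) x) x := by
  obtain ⟨W, hW, b, hb, h⟩ := hf.2 1 x hx
  obtain ⟨ε, hε, hball⟩ := Metric.mem_nhds_iff.1 (inter_mem hW (hU.mem_nhds hx))
  refine hasFDerivAt_tsum_of_isPreconnected (𝕜 := ℝ) (s := Metric.ball x ε) hb
    Metric.isOpen_ball (convex_ball x ε).isPreconnected (fun q y hy => ?_) (fun q y hy => ?_)
    (Metric.mem_ball_self hε) (hf.summable hx) (Metric.mem_ball_self hε)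
  · exact ((hf.contDiffAt hU (hball hy).2 q).differentiableAt (by simp)).hasFDerivAt
  · rw [← norm_iteratedFDeriv_one]
    exact h q y (hball hy).1

end SmoothSums

/-- The induction differentiates term by term and replaces `G` by `E →L[ℝ] G`, which is why `E` and
`G` share a universe. -/
theorem SummableSmooth.contDiffOn_tsum {Q : Type*} {E G : Type u}
    [NormedAddCommGroup E] [NormedSpace ℝ E]
    [NormedAddCommGroup G] [NormedSpace ℝ G] [CompleteSpace G] {f : Q → E → G} {U : Set E}
    (hf : SummableSmooth f U) (hU : IsOpen U) (n : ℕ) :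
    ContDiffOn ℝ n (fun y => ∑' q, f q y) U := by
  induction n generalizing G with
  | zero =>
    refine contDiffOn_zero.2 fun x hx => ?_
    exact (hf.hasFDerivAt_tsum hU hx).continuousAt.continuousWithinAt
  | succ n ih =>
    rw [show ((n + 1 : ℕ) : WithTop ℕ∞) = (n : WithTop ℕ∞) + 1 by push_cast; rfl,
      contDiffOn_succ_iff_fderiv_of_isOpen hU]
    refine ⟨fun x hx => (hf.hasFDerivAt_tsum hU hx).differentiableAt.differentiableWithinAt,
      by simp, ?_⟩
    exact (ih (hf.fderiv hU)).congr fun x hx => (hf.hasFDerivAt_tsum hU hx).fderiv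

/-! ### Uniform bounds for a smooth family with parameters in a compact set -/

section Bounds

variable {Q P E G : Type*} [NormedAddCommGroup P] [NormedSpace ℝ P] [NormedAddCommGroup E]
  [NormedSpace ℝ E] [NormedAddCommGroup G] [NormedSpace ℝ G]

/-- The slice is the composite of `Φ` with a translation and the inclusion `inr`, which has norm at
most one. -/
theorem norm_iteratedFDeriv_section_le {Φ : P × E → G} {S : Set (P × E)} (hS : IsOpen S)
    (hΦ : ContDiffOn ℝ ∞ Φ S) {m : P} {z : E} (h : (m, z) ∈ S) (k : ℕ) :
    ‖iteratedFDeriv ℝ k (fun z => Φ (m, z)) z‖ ≤ ‖iteratedFDeriv ℝ k Φ (m, z)‖ := by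
  set Ψ : P × E → G := fun x => Φ ((m, 0) + x) with hΨ
  set T : Set (P × E) := (fun x => (m, (0 : E)) + x) ⁻¹' S with hT
  have hTo : IsOpen T := hS.preimage (by fun_prop)
  have hΨT : ContDiffOn ℝ ∞ Ψ T := hΦ.comp (by fun_prop) fun x hx => hx
  set g : E →L[ℝ] P × E := ContinuousLinearMap.inr ℝ P E with hg
  have hzT : g z ∈ T := by simpa [hT, hg] using h
  have hgT : IsOpen (g ⁻¹' T) := hTo.preimage g.continuous
  have e : (fun z => Φ (m, z)) = Ψ ∘ g := by
    funext z
    simp [hΨ, hg]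
  rw [e, ← iteratedFDerivWithin_of_isOpen k hgT hzT,
    g.iteratedFDerivWithin_comp_right hΨT hTo.uniqueDiffOn hgT.uniqueDiffOn hzT
      (by exact_mod_cast le_top), iteratedFDerivWithin_of_isOpen k hTo hzT,
    hΨ, iteratedFDeriv_comp_add_left]
  refine (ContinuousMultilinearMap.norm_compContinuousLinearMap_le _ _).trans ?_
  have h1 : (∏ _i : Fin k, ‖g‖) ≤ 1 :=
    Finset.prod_le_one (fun _ _ => norm_nonneg _) fun _ _ => ContinuousLinearMap.norm_inr_le_one ..
  have h2 : ((m, (0 : E)) + g z) = (m, z) := by simp [hg]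
  rw [h2]
  exact mul_le_of_le_one_right (norm_nonneg _) h1

/-- Near a given point the variable stays in a compact set `W`. Each derivative of `Φ` is bounded on
the compact set `T × W`, and the summable coefficients do the rest. -/
theorem summableSmooth_smul_section [NormedSpace ℂ G] [SMulCommClass ℝ ℂ G]
    [LocallyCompactSpace E] {Φ : P × E → G} {S : Set (P × E)}
    (hS : IsOpen S) (hΦ : ContDiffOn ℝ ∞ Φ S) {T : Set P} (hT : IsCompact T) {U : Set E}
    (hU : IsOpen U) (hTU : T ×ˢ U ⊆ S) (m : Q → P) (hm : ∀ q, m q ∈ T) (c : Q → ℂ)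
    (hc : Summable fun q => ‖c q‖) : SummableSmooth (fun q z => c q • Φ (m q, z)) U := by
  have h0 : ∀ q, ContDiffOn ℝ ∞ (fun z => Φ (m q, z)) U := fun q =>
    hΦ.comp (by fun_prop) fun z hz => hTU ⟨hm q, hz⟩
  refine ⟨fun q => (h0 q).const_smul (c q), fun k x hx => ?_⟩
  obtain ⟨W, hW, hWU, hWc⟩ := local_compact_nhds (hU.mem_nhds hx)
  have hcont : ContinuousOn (fun p => ‖iteratedFDeriv ℝ k Φ p‖) (T ×ˢ W) := by
    intro p hp
    have hpS : p ∈ S := hTU ⟨hp.1, hWU hp.2⟩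
    exact ((hΦ.contDiffAt (hS.mem_nhds hpS)).continuousAt_iteratedFDeriv
      (by exact_mod_cast le_top)).norm.continuousWithinAt
  obtain ⟨B, hB⟩ := ((hT.prod hWc).image_of_continuousOn hcont).bddAbove
  refine ⟨interior W, interior_mem_nhds.2 hW, fun q => ‖c q‖ * B, hc.mul_right B, fun q y hy => ?_⟩
  have hyW := interior_subset hy
  have h1 : iteratedFDeriv ℝ k (fun z => c q • Φ (m q, z)) y =
      c q • iteratedFDeriv ℝ k (fun z => Φ (m q, z)) y :=
    iteratedFDeriv_const_smul_apply (((h0 q).contDiffAt (hU.mem_nhds (hWU hyW))).of_le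
      (by exact_mod_cast le_top))
  rw [h1, norm_smul]
  refine mul_le_mul_of_nonneg_left ?_ (norm_nonneg _)
  refine (norm_iteratedFDeriv_section_le hS hΦ (hTU ⟨hm q, hWU hyW⟩) k).trans ?_
  exact hB ⟨(m q, y), ⟨hm q, hyW⟩, rfl⟩

end Bounds

/-! ### The operators `∂/∂z_j` on series and products -/

section Wirtinger

variable {ι : Type*}

theorem isOpen_halfPlanes [Finite ι] : IsOpen (halfPlanes ι) := by
  have : halfPlanes ι = ⋂ i, {z : ι → ℂ | 0 < (z i).im} := by ext; simp [halfPlanes]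
  rw [this]
  exact isOpen_iInter_of_finite fun i =>
    isOpen_lt continuous_const (Complex.continuous_im.comp (continuous_apply i))

variable [DecidableEq ι]

theorem wirtinger_congr {j : ι} {f g : (ι → ℂ) → ℂ} {U : Set (ι → ℂ)} (hU : IsOpen U)
    (h : Set.EqOn f g U) : Set.EqOn (wirtinger j f) (wirtinger j g) U := by
  intro z hz
  have h1 : ∀ v : ι → ℂ, lineDeriv ℝ f z v = lineDeriv ℝ g z v := fun v => by
    refine Filter.EventuallyEq.deriv_eq ?_
    have hc : ContinuousAt (fun t : ℝ => z + t • v) 0 := by fun_prop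
    have := hc.eventually (by simpa using hU.mem_nhds hz : U ∈ 𝓝 (z + (0 : ℝ) • v))
    filter_upwards [this] with t ht using h ht
  simp [wirtinger, h1]

variable [Fintype ι]

/-- The operator `∂/∂z_j` as a linear function of the total derivative. -/
def wirtingerCLM (j : ι) : ((ι → ℂ) →L[ℝ] ℂ) →L[ℝ] ℂ :=
  (1 / 2 : ℂ) • (ContinuousLinearMap.apply ℝ ℂ (Pi.single j (1 : ℂ) : ι → ℂ) -
    Complex.I • ContinuousLinearMap.apply ℝ ℂ (Pi.single j Complex.I : ι → ℂ))

theorem wirtinger_eq_clm {j : ι} {f : (ι → ℂ) → ℂ} {z : ι → ℂ} (h : DifferentiableAt ℝ f z) :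
    wirtinger j f z = wirtingerCLM j (fderiv ℝ f z) := by
  rw [wirtinger, h.lineDeriv_eq_fderiv, h.lineDeriv_eq_fderiv]
  simp [wirtingerCLM]

theorem SummableSmooth.wirtinger {Q : Type*} {f : Q → (ι → ℂ) → ℂ} {U : Set (ι → ℂ)}
    (hf : SummableSmooth f U) (hU : IsOpen U) (j : ι) :
    SummableSmooth (fun q => HilbertEisenstein.wirtinger j (f q)) U :=
  ((hf.fderiv hU).clm_comp hU (wirtingerCLM j)).congr hU fun q x hx =>
    wirtinger_eq_clm ((hf.contDiffAt hU hx q).differentiableAt (by simp))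

theorem SummableSmooth.wirtinger_tsum {Q : Type*} {f : Q → (ι → ℂ) → ℂ} {U : Set (ι → ℂ)}
    (hf : SummableSmooth f U) (hU : IsOpen U) (j : ι) :
    Set.EqOn (HilbertEisenstein.wirtinger j fun z => ∑' q, f q z)
      (fun z => ∑' q, HilbertEisenstein.wirtinger j (f q) z) U := by
  intro z hz
  have h := hf.hasFDerivAt_tsum hU hz
  simp only
  rw [wirtinger_eq_clm h.differentiableAt, h.fderiv,
    (wirtingerCLM j).map_tsum ((hf.fderiv hU).summable hz)]
  refine tsum_congr fun q => ?_
  exact (wirtinger_eq_clm ((hf.contDiffAt hU hz q).differentiableAt (by simp))).symm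

/-- Along the `j`-th coordinate all other factors are constant. A constant factor comes out of
`deriv` over a field without differentiability, so none is assumed. -/
theorem wirtinger_prod (j : ι) (g : ι → ℂ → ℂ) (z : ι → ℂ) :
    wirtinger j (fun z => ∏ i, g i (z i)) z =
      ∏ i, Function.update g j (localWirtinger (g j)) i (z i) := by
  have h1 : ∀ v : ℂ, lineDeriv ℝ (fun z : ι → ℂ => ∏ i, g i (z i)) z (Pi.single j v) =
      (∏ i ∈ Finset.univ.erase j, g i (z i)) * lineDeriv ℝ (g j) (z j) v := by
    intro v
    rw [lineDeriv, lineDeriv, ← deriv_const_mul_field]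
    congr 1
    funext t
    rw [← Finset.mul_prod_erase _ _ (Finset.mem_univ j), mul_comm]
    congr 1
    · refine Finset.prod_congr rfl fun i hi => ?_
      simp [Finset.ne_of_mem_erase hi]
    · simp
  rw [wirtinger, h1, h1, ← Finset.mul_prod_erase _ _ (Finset.mem_univ j), Function.update_self,
    localWirtinger]
  have h2 : ∏ i ∈ Finset.univ.erase j, Function.update g j (localWirtinger (g j)) i (z i) =
      ∏ i ∈ Finset.univ.erase j, g i (z i) :=
    Finset.prod_congr rfl fun i hi => by rw [Function.update_of_ne (Finset.ne_of_mem_erase hi)]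
  rw [h2]
  ring

end Wirtinger

section MixedWirtinger

variable {c r : ℕ}

theorem foldr_wirtinger_congr {f g : (Fin c ⊕ Fin r → ℂ) → ℂ} {U : Set (Fin c ⊕ Fin r → ℂ)}
    (hU : IsOpen U) (h : Set.EqOn f g U) (l : List (Fin r)) :
    Set.EqOn (l.foldr (fun j g => wirtinger (Sum.inr j) g) f)
      (l.foldr (fun j g => wirtinger (Sum.inr j) g) g) U := by
  induction l with
  | nil => exact h
  | cons j l ih => exact wirtinger_congr hU ih

theorem foldr_wirtinger_tsum {Q : Type*} {f : Q → (Fin c ⊕ Fin r → ℂ) → ℂ}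
    {U : Set (Fin c ⊕ Fin r → ℂ)} (hf : SummableSmooth f U) (hU : IsOpen U) (l : List (Fin r)) :
    SummableSmooth (fun q => l.foldr (fun j g => wirtinger (Sum.inr j) g) (f q)) U ∧
    Set.EqOn (l.foldr (fun j g => wirtinger (Sum.inr j) g) fun z => ∑' q, f q z)
      (fun z => ∑' q, l.foldr (fun j g => wirtinger (Sum.inr j) g) (f q) z) U := by
  induction l with
  | nil => exact ⟨hf, fun _ _ => rfl⟩
  | cons j l ih =>
    refine ⟨ih.1.wirtinger hU _, fun z hz => ?_⟩
    exact (wirtinger_congr hU ih.2 hz).trans (ih.1.wirtinger_tsum hU _ hz)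

/-- Each further operator meets a product in which its own coordinate is still untouched, because
`l` has no repetition. The differentiated coordinates are those in `l`. -/
theorem foldr_wirtinger_prod (g : Fin c ⊕ Fin r → ℂ → ℂ) {l : List (Fin r)} (hl : l.Nodup) :
    l.foldr (fun j g => wirtinger (Sum.inr j) g) (fun z => ∏ i, g i (z i)) =
      fun z => (∏ i, g (Sum.inl i) (z (Sum.inl i))) *
        ∏ j, (if j ∈ l then localWirtinger (g (Sum.inr j)) else g (Sum.inr j)) (z (Sum.inr j)) := by
  induction l with
  | nil => funext z; simp [Fintype.prod_sum_type]
  | cons j l ih =>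
    rw [List.nodup_cons] at hl
    set g' : Fin c ⊕ Fin r → ℂ → ℂ := Sum.elim (fun i => g (Sum.inl i))
      (fun j => if j ∈ l then localWirtinger (g (Sum.inr j)) else g (Sum.inr j)) with hg'
    have e : (fun z : Fin c ⊕ Fin r → ℂ => (∏ i, g (Sum.inl i) (z (Sum.inl i))) *
        ∏ j, (if j ∈ l then localWirtinger (g (Sum.inr j)) else g (Sum.inr j)) (z (Sum.inr j))) =
        fun z => ∏ i, g' i (z i) := by
      funext z
      rw [Fintype.prod_sum_type]
      rfl
    rw [List.foldr_cons, ih hl.2, e]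
    funext z
    rw [wirtinger_prod, Fintype.prod_sum_type]
    congr 1
    refine Finset.prod_congr rfl fun i _ => ?_
    by_cases hij : i = j
    · subst hij
      rw [Function.update_self]
      simp [hg', hl.1]
    · rw [Function.update_of_ne (by simpa using hij)]
      simp [hg', hij]

theorem mixedWirtinger_prod (g : Fin c ⊕ Fin r → ℂ → ℂ) (z : Fin c ⊕ Fin r → ℂ) :
    mixedWirtinger (fun z => ∏ i, g i (z i)) z = (∏ i, g (Sum.inl i) (z (Sum.inl i))) *
      ∏ j, localWirtinger (g (Sum.inr j)) (z (Sum.inr j)) := by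
  rw [mixedWirtinger, foldr_wirtinger_prod g (List.nodup_finRange r)]
  simp

end MixedWirtinger

/-! ### Smoothness of the terms of the Eisenstein series -/

section Terms

theorem localFactor_smul (s : ℂ) {ρ : ℝ} (hρ : 0 < ρ) (m : ℝ × ℝ) {z : ℂ} (hz : 0 < z.im) :
    localFactor s (ρ • m) z = ((ρ : ℝ) : ℂ) ^ (-(2 * s)) * localFactor s m z := by
  obtain ⟨a, b⟩ := m
  have h1 : z.im / Complex.normSq (((ρ * a : ℝ) : ℂ) * z + (ρ * b : ℝ)) =
      (ρ⁻¹ * ρ⁻¹) * (z.im / Complex.normSq (a * z + b)) := by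
    have : ((ρ * a : ℝ) : ℂ) * z + (ρ * b : ℝ) = (ρ : ℂ) * (a * z + b) := by push_cast; ring
    rw [this, Complex.normSq_mul, Complex.normSq_ofReal]
    field_simp
  have h2 : 0 ≤ z.im / Complex.normSq (a * z + b) := div_nonneg hz.le (Complex.normSq_nonneg _)
  have hi : 0 < ρ⁻¹ := inv_pos.2 hρ
  have h3 : ((ρ⁻¹ : ℝ) : ℂ) ^ s = (ρ : ℂ) ^ (-s) := by
    rw [Complex.ofReal_inv, Complex.inv_cpow_eq_ite, if_neg, Complex.cpow_neg]
    rw [Complex.arg_ofReal_of_nonneg hρ.le]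
    exact Real.pi_pos.ne
  simp only [localFactor, Prod.smul_mk, smul_eq_mul]
  rw [h1, Complex.ofReal_mul, Complex.mul_cpow_ofReal_nonneg (by positivity) h2,
    Complex.ofReal_mul, Complex.mul_cpow_ofReal_nonneg hi.le hi.le, h3,
    ← Complex.cpow_add _ _ (by exact_mod_cast hρ.ne')]
  congr 2
  ring

theorem mul_add_ne_zero {m : ℝ × ℝ} (hm : m ≠ 0) {z : ℂ} (hz : 0 < z.im) :
    (m.1 * z + m.2 : ℂ) ≠ 0 := by
  intro h
  have h1 := congrArg Complex.im h
  have h2 := congrArg Complex.re h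
  simp [hz.ne'] at h1
  simp [h1] at h2
  exact hm (Prod.ext h1 h2)

/-- Smoothness is joint in `(a, b)` and `z`, so that `(a, b)` can serve as the parameter. The base
of the power is positive, hence locally the power is `exp (s log)` of it. -/
theorem contDiffAt_localFactor (s : ℂ) {p : (ℝ × ℝ) × ℂ} (hm : p.1 ≠ 0) (hz : 0 < p.2.im) :
    ContDiffAt ℝ ∞ (fun p : (ℝ × ℝ) × ℂ => localFactor s p.1 p.2) p := by
  have hpos : 0 < p.2.im / Complex.normSq (p.1.1 * p.2 + p.1.2) :=
    div_pos hz (Complex.normSq_pos.2 (mul_add_ne_zero hm hz))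
  have him : ContDiff ℝ ∞ (fun p : (ℝ × ℝ) × ℂ => p.2.im) :=
    Complex.imCLM.contDiff.comp contDiff_snd
  have hre : ContDiff ℝ ∞ (fun p : (ℝ × ℝ) × ℂ => p.2.re) :=
    Complex.reCLM.contDiff.comp contDiff_snd
  have hN : ContDiff ℝ ∞ (fun p : (ℝ × ℝ) × ℂ => Complex.normSq (p.1.1 * p.2 + p.1.2)) := by
    have : (fun p : (ℝ × ℝ) × ℂ => Complex.normSq (p.1.1 * p.2 + p.1.2)) =
        fun p => (p.1.1 * p.2.re + p.1.2) ^ 2 + (p.1.1 * p.2.im) ^ 2 := by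
      funext p
      rw [Complex.normSq_apply]
      simp
      ring
    rw [this]
    fun_prop
  have hR : ContDiffAt ℝ ∞ (fun p : (ℝ × ℝ) × ℂ =>
      p.2.im / Complex.normSq (p.1.1 * p.2 + p.1.2)) p :=
    him.contDiffAt.div hN.contDiffAt (Complex.normSq_pos.2 (mul_add_ne_zero hm hz)).ne'
  have h1 : ContDiffAt ℝ ∞ (fun p : (ℝ × ℝ) × ℂ => Complex.exp
      (((Real.log (p.2.im / Complex.normSq (p.1.1 * p.2 + p.1.2)) : ℝ) : ℂ) * s)) p := by
    refine ContDiffAt.cexp (ContDiffAt.mul ?_ contDiffAt_const)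
    exact Complex.ofRealCLM.contDiff.contDiffAt.comp p (hR.log hpos.ne')
  refine h1.congr_of_eventuallyEq ?_
  filter_upwards [hR.continuousAt.eventually (lt_mem_nhds hpos)] with x hx
  rw [localFactor, Complex.cpow_def_of_ne_zero (by exact_mod_cast hx.ne'), Complex.ofReal_log hx.le]

/-- A local factor is homogeneous of degree `-2s` in `(a, b)`. Dividing each pair by its norm puts
the parameters on a product of spheres, which is compact, and the scalars that come out are summable
by `hs`. -/
theorem summableSmooth_prod_localFactor {Q ι : Type*} [Fintype ι] [DecidableEq ι] (s : ℂ)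
    (m : Q → ι → ℝ × ℝ) (hm : ∀ q i, m q i ≠ 0)
    (hs : Summable fun q => ∏ i, ‖m q i‖ ^ (-(2 * s.re))) :
    SummableSmooth (fun q (z : ι → ℂ) => ∏ i, localFactor s (m q i) (z i)) (halfPlanes ι) := by
  set S : Set ((ι → ℝ × ℝ) × (ι → ℂ)) := {p | ∀ i, p.1 i ≠ 0 ∧ 0 < (p.2 i).im} with hSdef
  have hS : IsOpen S := by
    have : S = ⋂ i, ({p | p.1 i ≠ 0} ∩ {p | 0 < (p.2 i).im}) := by
      ext; simp [hSdef]
    rw [this]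
    exact isOpen_iInter_of_finite fun i =>
      (isOpen_ne_fun (by fun_prop) continuous_const).inter
      (isOpen_lt continuous_const (Complex.continuous_im.comp (by fun_prop)))
  set Φ : (ι → ℝ × ℝ) × (ι → ℂ) → ℂ := fun p => ∏ i, localFactor s (p.1 i) (p.2 i) with hΦdef
  have hΦ : ContDiffOn ℝ ∞ Φ S := by
    intro p hp
    refine (ContDiffAt.contDiffWithinAt ?_)
    refine contDiffAt_prod fun i _ => ?_
    have hlin : ContDiff ℝ ∞ (fun p : (ι → ℝ × ℝ) × (ι → ℂ) => (p.1 i, p.2 i)) := by fun_prop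
    exact ContDiffAt.comp p (g := fun p : (ℝ × ℝ) × ℂ => localFactor s p.1 p.2)
      (contDiffAt_localFactor s (p := (p.1 i, p.2 i)) (hp i).1 (hp i).2) hlin.contDiffAt
  set T : Set (ι → ℝ × ℝ) := Set.univ.pi fun _ => Metric.sphere 0 1 with hT
  have hTc : IsCompact T := isCompact_univ_pi fun _ => isCompact_sphere 0 1
  have h := summableSmooth_smul_section hS hΦ hTc (U := halfPlanes ι) isOpen_halfPlanes
    (fun p hp i => ⟨by
      have := hp.1 i (Set.mem_univ i)
      rw [mem_sphere_zero_iff_norm] at this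
      exact norm_ne_zero_iff.1 (by rw [this]; exact one_ne_zero), hp.2 i⟩)
    (fun q i => ‖m q i‖⁻¹ • m q i)
    (fun q i _ => by
      rw [mem_sphere_zero_iff_norm, norm_smul, norm_inv, norm_norm,
        inv_mul_cancel₀ (norm_ne_zero_iff.2 (hm q i))])
    (fun q => ∏ i, ((‖m q i‖ : ℝ) : ℂ) ^ (-(2 * s))) (by
      refine hs.congr fun q => ?_
      rw [norm_prod]
      refine Finset.prod_congr rfl fun i _ => ?_
      rw [Complex.norm_cpow_eq_rpow_re_of_pos (norm_pos_iff.2 (hm q i))]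
      simp)
  refine h.congr isOpen_halfPlanes fun q z hz => ?_
  simp only [hΦdef, smul_eq_mul]
  rw [← Finset.prod_mul_distrib]
  refine Finset.prod_congr rfl fun i _ => ?_
  rw [← localFactor_smul s (norm_pos_iff.2 (hm q i)) _ (hz i), smul_smul,
    mul_inv_cancel₀ (norm_ne_zero_iff.2 (hm q i)), one_smul]

end Terms

end HilbertEisenstein

namespace HilbertEisenstein

/-! ### The embeddings of `K` -/

section Embeddings

variable {F K : Type*} [Field F] [Field K] [Algebra F K] {c r : ℕ}

/-- The two complex embeddings of `K` above the place `i` of `F`. -/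
def ArchData.emb (A : ArchData F K c r) : Fin c ⊕ Fin r → Fin 2 → (K →+* ℂ)
  | Sum.inl j => ![A.toComplex j, ComplexEmbedding.conjugate (A.toComplex j)]
  | Sum.inr j => ![Complex.ofRealHom.comp (A.fst j), Complex.ofRealHom.comp (A.snd j)]

/-- The local orientation determinants of `(ω₁, ω₂)`. -/
def ArchData.det (A : ArchData F K c r) (ω₁ ω₂ : K) : Fin c ⊕ Fin r → ℝ :=
  Sum.elim
    (fun j => (A.toComplex j ω₁).re * (A.toComplex j ω₂).im -
      (A.toComplex j ω₁).im * (A.toComplex j ω₂).re)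
    (fun j => A.fst j ω₁ * A.snd j ω₂ - A.snd j ω₁ * A.fst j ω₂)

theorem ArchData.IsPositive.det_pos {A : ArchData F K c r} {ω₁ ω₂ : K} (h : A.IsPositive ω₁ ω₂)
    (i : Fin c ⊕ Fin r) : 0 < A.det ω₁ ω₂ i := by
  rcases i with j | j
  exacts [h.1 j, h.2 j]

theorem ArchData.emb_algebraMap (A : ArchData F K c r) (i : Fin c ⊕ Fin r) (e : Fin 2) (a : F) :
    A.emb i e (algebraMap F K a) = ((A.v i a : ℝ) : ℂ) := by
  rcases i with j | j <;> fin_cases e <;>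
    simp [ArchData.emb, A.toComplex_algebraMap, A.fst_algebraMap, A.snd_algebraMap,
      ComplexEmbedding.conjugate_coe_eq]

/-- Restriction to `F` recovers the place. Above one place the two embeddings differ, by
`toComplex_not_isReal` or by `fst_ne_snd`. -/
theorem ArchData.emb_injective (A : ArchData F K c r) :
    Function.Injective fun p : Fin 2 × (Fin c ⊕ Fin r) => A.emb p.2 p.1 := by
  rintro ⟨e, i⟩ ⟨e', i'⟩ h
  simp only at h
  have hi : i = i' := by
    apply A.v.injective
    ext a
    have := RingHom.congr_fun h (algebraMap F K a)
    rw [A.emb_algebraMap, A.emb_algebraMap] at this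
    exact_mod_cast this
  subst hi
  have h01 : A.emb i 0 ≠ A.emb i 1 := by
    rcases i with j | j
    · intro h
      exact A.toComplex_not_isReal j h.symm
    · intro h
      apply A.fst_ne_snd j
      ext x
      have := RingHom.congr_fun h x
      simpa [ArchData.emb] using this
  fin_cases e <;> fin_cases e' <;> simp_all

/-- At a complex place the determinant against the conjugate embedding is `-2i` times the oriented
area. These factors `2` cancel the `2^(-c)` of the Lebesgue measure in `moduleNorm_eq`. -/
theorem ArchData.emb_det (A : ArchData F K c r) (ω₁ ω₂ : K) (i : Fin c ⊕ Fin r) :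
    ‖A.emb i 0 ω₁ * A.emb i 1 ω₂ - A.emb i 1 ω₁ * A.emb i 0 ω₂‖ =
      Sum.elim (fun _ => (2 : ℝ)) (fun _ => 1) i * |A.det ω₁ ω₂ i| := by
  rcases i with j | j
  · have : A.toComplex j ω₁ * (starRingEnd ℂ) (A.toComplex j ω₂) -
        (starRingEnd ℂ) (A.toComplex j ω₁) * A.toComplex j ω₂ =
        -(2 * (((A.toComplex j ω₁).re * (A.toComplex j ω₂).im -
      (A.toComplex j ω₁).im * (A.toComplex j ω₂).re : ℝ) : ℂ) * Complex.I) := by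
      apply Complex.ext <;> simp
      ring
    simp only [ArchData.emb, ArchData.det, Sum.elim_inl, Matrix.cons_val_zero, Matrix.cons_val_one,
      ComplexEmbedding.conjugate_coe_eq]
    rw [this, norm_neg, norm_mul, norm_mul, Complex.norm_real, Complex.norm_I]
    simp
  · simp only [ArchData.emb, ArchData.det, Sum.elim_inr, Matrix.cons_val_zero, Matrix.cons_val_one,
      RingHom.comp_apply, Complex.ofRealHom_eq_coe]
    rw [one_mul, ← Real.norm_eq_abs, ← Complex.norm_real]
    push_cast
    rfl

end Embeddings

/-! ### Real embeddings and the discriminant of a totally real field -/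

section TotallyReal

variable {F : Type*} [Field F] [IsTotallyReal F]

theorem bijective_ofReal_comp {ι : Type*} (v : ι ≃ (F →+* ℝ)) :
    Function.Bijective (fun i => Complex.ofRealHom.comp (v i) : ι → (F →+* ℂ)) := by
  constructor
  · intro i j h
    apply v.injective
    ext y
    have := RingHom.congr_fun h y
    simpa using this
  · intro φ
    have hφ := IsTotallyReal.complexEmbedding_isReal φ
    refine ⟨v.symm hφ.embedding, ?_⟩
    ext y
    simp

variable [NumberField F]

theorem card_eq_finrank {ι : Type*} [Fintype ι] (v : ι ≃ (F →+* ℝ)) :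
    Fintype.card ι = finrank ℚ F := by
  rw [← NumberField.Embeddings.card F ℂ]
  exact Fintype.card_of_bijective (bijective_ofReal_comp v)

/-- The matrix of the embeddings of a basis of `𝓞 F` has determinant of square `discr F`. -/
theorem det_embeddings_sq {ι : Type*} [Fintype ι] [DecidableEq ι] (v : ι ≃ (F →+* ℝ))
    (b : Basis ι ℤ (𝓞 F)) :
    (Matrix.of fun i k => v i (b k : F)).det ^ 2 = (discr F : ℝ) := by
  have h1 := Algebra.discr_eq_det_embeddingsMatrixReindex_pow_two ℚ ℂ
    (fun k => (b k : F)) ((Equiv.ofBijective _ (bijective_ofReal_comp v)).trans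
      (RingHom.equivRatAlgHom F ℂ))
  have h2 : Algebra.discr ℚ (fun k => (b k : F)) = (discr F : ℚ) := by
    have h := Algebra.discr_localizationLocalization (Rₘ := ℚ) ℤ (nonZeroDivisors ℤ) F b
    rw [NumberField.discr_eq_discr F b, eq_intCast] at h
    rw [← h]
    congr 1
    funext k
    simp
  rw [h2] at h1
  have h3 : ((((Matrix.of fun i k => v i (b k : F)).det ^ 2 : ℝ)) : ℂ) = ((discr F : ℝ) : ℂ) := by
    have h4 : (((Matrix.of fun i k => v i (b k : F)).det : ℝ) : ℂ) =
        (Algebra.embeddingsMatrixReindex ℚ ℂ (fun k => (b k : F))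
          ((Equiv.ofBijective _ (bijective_ofReal_comp v)).trans
            (RingHom.equivRatAlgHom F ℂ))).det := by
      rw [← Matrix.det_transpose, ← Complex.ofRealHom_eq_coe, RingHom.map_det]
      congr 1
    push_cast
    rw [h4, ← h1]
    simp
  exact_mod_cast h3

theorem discr_pos {ι : Type*} [Fintype ι] (v : ι ≃ (F →+* ℝ)) : 0 < (discr F : ℝ) := by
  classical
  have hcard : Fintype.card ι = finrank ℤ (𝓞 F) := by
    rw [card_eq_finrank v, RingOfIntegers.rank]
  let b : Basis ι ℤ (𝓞 F) := (Module.finBasisOfFinrankEq ℤ (𝓞 F) hcard.symm).reindex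
    (Fintype.equivFin ι).symm
  have h := det_embeddings_sq v b
  have h0 : (discr F : ℝ) ≠ 0 := by exact_mod_cast discr_ne_zero F
  rw [← h] at h0 ⊢
  exact lt_of_le_of_ne (sq_nonneg _) h0.symm

end TotallyReal

/-! ### The norm of `K` at the places and the covolume of `M` -/

section NumberFields

variable {F K : Type*} [Field F] [NumberField F] [IsTotallyReal F] [Field K] [NumberField K]
  [Algebra F K] {c r : ℕ}

theorem ArchData.emb_bijective (A : ArchData F K c r) (hFK : finrank F K = 2) :
    Function.Bijective fun p : Fin 2 × (Fin c ⊕ Fin r) => A.emb p.2 p.1 := by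
  rw [Fintype.bijective_iff_injective_and_card]
  refine ⟨A.emb_injective, ?_⟩
  rw [NumberField.Embeddings.card K ℂ, Fintype.card_prod, card_eq_finrank A.v, Fintype.card_fin,
    ← finrank_mul_finrank ℚ F K, hFK, mul_comm]

theorem ArchData.norm_eq (A : ArchData F K c r) (hFK : finrank F K = 2) (x : K) :
    (Algebra.norm ℚ x : ℝ) = (∏ j, Complex.normSq (A.toComplex j x)) *
      ∏ j, (A.fst j x * A.snd j x) := by
  have h1 := Algebra.norm_eq_prod_embeddings ℚ ℂ x
  have h2 : ∏ p : Fin 2 × (Fin c ⊕ Fin r), A.emb p.2 p.1 x = ∏ σ : K →ₐ[ℚ] ℂ, σ x :=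
    Fintype.prod_equiv ((Equiv.ofBijective _ (A.emb_bijective hFK)).trans
      (RingHom.equivRatAlgHom K ℂ)) _ _ (fun i => by simp [RingHom.equivRatAlgHom_apply])
  rw [← h2, Fintype.prod_prod_type, Fin.prod_univ_two, ← Finset.prod_mul_distrib,
    Fintype.prod_sum_type] at h1
  have h3 : ∀ j, A.emb (Sum.inl j) 0 x * A.emb (Sum.inl j) 1 x =
      ((Complex.normSq (A.toComplex j x) : ℝ) : ℂ) := fun j => by
    simp [ArchData.emb, ComplexEmbedding.conjugate_coe_eq, Complex.mul_conj]
  have h4 : ∀ j, A.emb (Sum.inr j) 0 x * A.emb (Sum.inr j) 1 x =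
      ((A.fst j x * A.snd j x : ℝ) : ℂ) := fun j => by
    simp [ArchData.emb]
  simp_rw [h3, h4] at h1
  have h5 : ((Algebra.norm ℚ x : ℝ) : ℂ) = (((∏ j, Complex.normSq (A.toComplex j x)) *
      ∏ j, (A.fst j x * A.snd j x) : ℝ) : ℂ) := by
    push_cast
    rw [eq_ratCast] at h1
    rw [h1]
    simp
  exact_mod_cast h5

theorem nrComplexPlaces_eq (A : ArchData F K c r) (hFK : finrank F K = 2) :
    InfinitePlace.nrComplexPlaces K = c := by
  classical
  have h := InfinitePlace.card_complex_embeddings K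
  have h1 : ∀ e j, ComplexEmbedding.IsReal (A.emb (Sum.inr j) e) := by
    intro e j
    rw [ComplexEmbedding.isReal_iff]
    ext x
    fin_cases e <;> simp [ArchData.emb, ComplexEmbedding.conjugate_coe_eq]
  have h2 : ∀ e j, ¬ ComplexEmbedding.IsReal (A.emb (Sum.inl j) e) := by
    intro e j h
    apply A.toComplex_not_isReal j
    fin_cases e
    · exact h
    · exact ComplexEmbedding.isReal_conjugate_iff.1 h
  have hb : Function.Bijective fun p : Fin 2 × Fin c =>
      (⟨A.emb (Sum.inl p.2) p.1, h2 _ _⟩ : {φ : K →+* ℂ // ¬ ComplexEmbedding.IsReal φ}) := by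
    constructor
    · intro p q hpq
      have := A.emb_injective (a₁ := (p.1, Sum.inl p.2)) (a₂ := (q.1, Sum.inl q.2))
        (congrArg Subtype.val hpq)
      simp only [Prod.mk.injEq, Sum.inl.injEq] at this
      exact Prod.ext this.1 this.2
    · rintro ⟨φ, hφ⟩
      obtain ⟨⟨e, i⟩, rfl⟩ := (A.emb_bijective hFK).2 φ
      rcases i with j | j
      · exact ⟨(e, j), rfl⟩
      · exact absurd (h1 e j) hφ
  have h3 := Fintype.card_of_bijective hb
  rw [h, Fintype.card_prod, Fintype.card_fin, Fintype.card_fin] at h3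
  omega

-- The products of a `ℤ`-basis of `𝓞 F` with `(ω₁, ω₂)` form a `ℤ`-basis of `M`. Its matrix of
-- embeddings factors into `2 × 2` blocks, one for each place, and two copies of the embedding
-- matrix of `F`. The latter give `|det B|² = d_F`, the former the orientation determinants.
open scoped Classical in
theorem moduleNorm_eq {I : Ideal (𝓞 F)} (A : ArchData F K c r) (hFK : finrank F K = 2)
    (M : Submodule (conductorOrder K I) K) (ω : Basis (Fin 2) (𝓞 F) M)
    (hω : A.IsPositive (ω 0 : K) (ω 1 : K)) :
    moduleNorm M = discr F * ∏ i, A.det (ω 0 : K) (ω 1 : K) i := by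
  classical
  have hcard : Fintype.card (Fin c ⊕ Fin r) = finrank ℤ (𝓞 F) := by
    rw [card_eq_finrank A.v, RingOfIntegers.rank]
  let b : Basis (Fin c ⊕ Fin r) ℤ (𝓞 F) :=
    (Module.finBasisOfFinrankEq ℤ (𝓞 F) hcard.symm).reindex (Fintype.equivFin _).symm
  let e : mixedEmbedding.index K ≃ Fin 2 × (Fin c ⊕ Fin r) :=
    (mixedEmbedding.indexEquiv K).trans (Equiv.ofBijective _ (A.emb_bijective hFK)).symm
  have he : ∀ p, mixedEmbedding.indexEquiv K (e.symm p) = A.emb p.2 p.1 := by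
    intro p
    simp [e]
  let x : Fin 2 × (Fin c ⊕ Fin r) → K := fun p => (b p.2 : F) • (ω p.1 : K)
  let b₀ := (mixedEmbedding.stdBasis K).reindex e
  let T : Matrix (Fin 2 × (Fin c ⊕ Fin r)) (Fin 2 × (Fin c ⊕ Fin r)) ℝ :=
    b₀.toMatrix fun p => mixedEmbedding K (x p)
  let Ω : Fin c ⊕ Fin r → Matrix (Fin 2) (Fin 2) ℂ :=
    fun i => Matrix.of fun k l => A.emb i k (ω l : K)
  let B : Matrix (Fin c ⊕ Fin r) (Fin c ⊕ Fin r) ℝ := Matrix.of fun i k => A.v i (b k : F)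
  -- The embedding `(k, i)` sends `b_j ω_l` to `v_i(b_j)` times the image of `ω_l`, so the matrix of
  -- embeddings is `blockDiagonal Ω` times `1 ⊗ B`; `matrixToStdBasis` passes from complex
  -- embeddings to real coordinates.
  have hT : T.map Complex.ofRealHom =
      (mixedEmbedding.matrixToStdBasis K).reindex e e *
        (Matrix.blockDiagonal Ω * Matrix.kroneckerMap (· * ·) 1 (B.map Complex.ofRealHom)) := by
    have h5 : ∀ p q : Fin 2 × (Fin c ⊕ Fin r), (Matrix.blockDiagonal Ω *
        Matrix.kroneckerMap (· * ·) 1 (B.map Complex.ofRealHom) : Matrix _ _ ℂ) p q = A.emb p.2 p.1 (x q) := by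
      rintro ⟨k, i⟩ ⟨l, j⟩
      have h6 : A.emb i k (x (l, j)) = (A.v i (b j : F) : ℂ) * A.emb i k (ω l : K) := by
        simp only [x, Algebra.smul_def, map_mul, A.emb_algebraMap]
      rw [h6, Matrix.mul_apply, Fintype.sum_eq_single (l, i)]
      · simp [Matrix.blockDiagonal_apply, Ω, B, mul_comm]
      · rintro ⟨l', i'⟩ hne
        by_cases hi : i = i'
        · subst hi
          have hl : l' ≠ l := fun h => hne (by rw [h])
          simp [hl]
        · simp [Matrix.blockDiagonal_apply, hi]
    ext p q
    have h7 := mixedEmbedding.stdBasis_repr_eq_matrixToStdBasis_mul K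
      (canonicalEmbedding K (x q)) (fun φ => by
        simp [canonicalEmbedding.apply_at, ComplexEmbedding.conjugate_coe_eq]) (e.symm p)
    rw [mixedEmbedding.commMap_canonical_eq_mixed] at h7
    have h8 : (T.map Complex.ofRealHom) p q =
        (((mixedEmbedding.stdBasis K).repr (mixedEmbedding K (x q)) (e.symm p) : ℝ) : ℂ) := by
      simp [T, b₀, Basis.toMatrix_apply]
    rw [h8, h7, Matrix.mul_apply, Matrix.mulVec, dotProduct]
    refine Fintype.sum_equiv e _ _ fun a => ?_
    rw [h5, ← he]
    simp [canonicalEmbedding.apply_at]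
  have hdet : |T.det| = discr F * ∏ i, A.det (ω 0 : K) (ω 1 : K) i := by
    have h1 : ‖(T.map Complex.ofRealHom).det‖ = |T.det| := by
      have : T.map Complex.ofRealHom = Complex.ofRealHom.mapMatrix T := rfl
      rw [this, ← RingHom.map_det, Complex.ofRealHom_eq_coe, Complex.norm_real, Real.norm_eq_abs]
    have h2 : (B.map Complex.ofRealHom).det = ((B.det : ℝ) : ℂ) := by
      have : B.map Complex.ofRealHom = Complex.ofRealHom.mapMatrix B := rfl
      rw [this, ← RingHom.map_det, Complex.ofRealHom_eq_coe]
    have h3 : ∀ i, ‖(Ω i).det‖ = Sum.elim (fun _ => (2 : ℝ)) (fun _ => 1) i *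
        A.det (ω 0 : K) (ω 1 : K) i := by
      intro i
      rw [← abs_of_pos (hω.det_pos i), ← A.emb_det, Matrix.det_fin_two]
      congr 1
      simp only [Ω, Matrix.of_apply]
      ring
    rw [← h1, hT, Matrix.det_mul, Matrix.det_mul, Matrix.det_reindex_self,
      mixedEmbedding.det_matrixToStdBasis, Matrix.det_blockDiagonal, Matrix.det_kronecker,
      Matrix.det_one, one_pow, one_mul, h2, norm_mul, norm_mul, norm_prod, norm_pow, norm_pow,
      norm_mul, Complex.norm_I, nrComplexPlaces_eq A hFK, Finset.prod_congr rfl fun i _ => h3 i,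
      Finset.prod_mul_distrib, Fintype.prod_sum_type, Complex.norm_real, Real.norm_eq_abs,
      Fintype.card_fin, sq_abs, det_embeddings_sq A.v b]
    simp
    field_simp
  have hpos : 0 < (discr F : ℝ) * ∏ i, A.det (ω 0 : K) (ω 1 : K) i :=
    mul_pos (discr_pos A.v) (Finset.prod_pos fun i _ => hω.det_pos i)
  have hunit : IsUnit (b₀.det fun p => mixedEmbedding K (x p)) := by
    rw [isUnit_iff_ne_zero]
    intro h0
    have : T.det = 0 := h0
    rw [this, abs_zero] at hdet
    exact hpos.ne hdet
  obtain ⟨hli, hsp⟩ := (Module.Basis.is_basis_iff_det b₀).2 hunit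
  let X := Basis.mk hli hsp.ge
  have hX : ∀ p, X p = mixedEmbedding K (x p) := fun p => by simp [X]
  have hlat : moduleLattice M = Submodule.span ℤ (Set.range X) := by
    let β := (b.smulTower' ω)
    have hβ : ∀ p, mixedEmbedding K ((β p : M) : K) = X p := by
      intro p
      rw [hX, Basis.smulTower'_apply]
      simp only [x]
      congr 1
    let g : M →+ mixedEmbedding.mixedSpace K :=
      (mixedEmbedding K).toAddMonoidHom.comp M.toAddSubgroup.subtype
    have h1 : moduleLattice M = (⊤ : Submodule ℤ M).map g.toIntLinearMap := by
      ext y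
      constructor
      · rintro ⟨m, hm, rfl⟩
        exact ⟨⟨m, hm⟩, trivial, rfl⟩
      · rintro ⟨m, -, rfl⟩
        exact ⟨m, m.2, rfl⟩
    rw [h1, ← β.span_eq, Submodule.map_span, ← Set.range_comp]
    congr 2
    funext p
    exact hβ p
  rw [moduleNorm, hlat, ZLattice.covolume_eq_measure_fundamentalDomain _ _
    (ZSpan.isAddFundamentalDomain X MeasureTheory.volume),
    ZSpan.measureReal_fundamentalDomain X _ b₀]
  have h2 : b₀.det X = T.det := by
    rw [Basis.det_apply]
    congr 2
    funext p
    exact hX p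
  have h3 : MeasureTheory.volume.real (ZSpan.fundamentalDomain b₀) = 1 := by
    rw [MeasureTheory.measureReal_def, ZSpan.fundamentalDomain_reindex,
      mixedEmbedding.volume_fundamentalDomain_stdBasis]
    simp
  rw [h2, h3, mul_one, hdet]

end NumberFields

end HilbertEisenstein

namespace HilbertEisenstein

/-! ### Convergence -/

/-! ### Balancing the absolute values by units -/

section Balanced

open scoped Classical

variable (K : Type*) [Field K] [NumberField K]

/-- Minkowski space modulo units has a fundamental cone whose part of norm at most one is bounded.
Applied to the vector of `k`-th roots of `t`, moved by a unit and scaled to norm one, this bounds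
every coordinate; the `k`-th power is the claim. The exponent is there because only certain powers
of units lie in `V`. -/
theorem exists_unit_balanced {k : ℕ} (hk : k ≠ 0) :
    ∃ C : ℝ, 0 < C ∧ ∀ t : InfinitePlace K → ℝ, (∀ w, 0 < t w) → ∃ u : (𝓞 K)ˣ, ∀ w,
      w ((u : 𝓞 K) : K) ^ k * t w ≤ C * (∏ w, t w ^ w.mult) ^ ((finrank ℚ K : ℝ)⁻¹) := by
  have hn : 0 < (finrank ℚ K : ℝ) := by exact_mod_cast finrank_pos
  have hk0 : (k : ℝ) ≠ 0 := by exact_mod_cast hk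
  obtain ⟨C, hC0, hC⟩ := (mixedEmbedding.fundamentalCone.isBounded_normLeOne K).exists_pos_norm_le
  refine ⟨C ^ k, by positivity, fun t ht => ?_⟩
  set N := ∏ w, t w ^ w.mult with hN
  have hN0 : 0 < N := Finset.prod_pos fun w _ => pow_pos (ht w) _
  set x := mixedEmbedding.mixedSpaceOfRealSpace (fun w => t w ^ ((k : ℝ)⁻¹)) with hx
  have hxw : ∀ w, mixedEmbedding.normAtPlace w x = t w ^ ((k : ℝ)⁻¹) := fun w =>
    mixedEmbedding.normAtPlace_mixedSpaceOfRealSpace (Real.rpow_nonneg (ht w).le _)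
  have hxN : mixedEmbedding.norm x = N ^ ((k : ℝ)⁻¹) := by
    rw [mixedEmbedding.norm_apply, hN, ← Real.finsetProd_rpow _ _ fun w _ => (pow_pos (ht w) _).le]
    refine Finset.prod_congr rfl fun w _ => ?_
    rw [hxw, ← Real.rpow_natCast, ← Real.rpow_natCast, ← Real.rpow_mul (ht w).le,
      ← Real.rpow_mul (ht w).le, mul_comm]
  have hxN0 : 0 < mixedEmbedding.norm x := by rw [hxN]; positivity
  obtain ⟨u, hu⟩ := mixedEmbedding.fundamentalCone.exists_unit_smul_mem hxN0.ne'
  refine ⟨u, fun w => ?_⟩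
  set a : ℝ := (mixedEmbedding.norm x) ^ (-(finrank ℚ K : ℝ)⁻¹) with ha
  have ha0 : 0 < a := by positivity
  have hmem : a • (u • x) ∈ mixedEmbedding.fundamentalCone.normLeOne K := by
    refine ⟨mixedEmbedding.fundamentalCone.smul_mem_of_mem hu ha0.ne', ?_⟩
    rw [Set.mem_ofPred_eq, mixedEmbedding.norm_smul, mixedEmbedding.norm_unit_smul, abs_of_pos ha0,
      ha, ← Real.rpow_natCast, ← Real.rpow_mul hxN0.le]
    rw [neg_mul, inv_mul_cancel₀ hn.ne', Real.rpow_neg_one, inv_mul_cancel₀ hxN0.ne']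
  have h1 := hC _ hmem
  have h2 : mixedEmbedding.normAtPlace w (a • (u • x)) ≤ ‖a • (u • x)‖ := by
    rw [mixedEmbedding.norm_eq_sup'_normAtPlace (a • (u • x))]
    exact Finset.le_sup' (fun w => mixedEmbedding.normAtPlace w (a • (u • x))) (Finset.mem_univ w)
  have h3 : mixedEmbedding.normAtPlace w (a • (u • x)) =
      a * (w ((u : 𝓞 K) : K) * t w ^ ((k : ℝ)⁻¹)) := by
    rw [mixedEmbedding.normAtPlace_smul, abs_of_pos ha0, mixedEmbedding.unitSMul_smul, map_mul,
      mixedEmbedding.normAtPlace_apply, hxw]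
  have h4 : (a * (w ((u : 𝓞 K) : K) * t w ^ ((k : ℝ)⁻¹))) ^ k ≤ C ^ k := by
    rw [← h3]
    exact pow_le_pow_left₀ (mixedEmbedding.normAtPlace_nonneg _ _) (h2.trans h1) k
  have h5 : (t w ^ ((k : ℝ)⁻¹)) ^ k = t w := Real.rpow_inv_natCast_pow (ht w).le hk
  have h6 : a ^ k = (N ^ ((finrank ℚ K : ℝ)⁻¹))⁻¹ := by
    rw [ha, hxN, ← Real.rpow_mul hN0.le, ← Real.rpow_natCast, ← Real.rpow_mul hN0.le,
      ← Real.rpow_neg hN0.le]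
    congr 1
    field_simp
  rw [mul_pow, mul_pow, h5, h6, inv_mul_le_iff₀ (by positivity)] at h4
  linarith

/-- This is the convergence criterion for the lattice `𝓞 K` of rank `[K : ℚ]`. The term at `0` is a
negative power of zero, which is `0` by convention. -/
theorem summable_norm_mixedEmbedding {ρ : ℝ} (hρ : (finrank ℚ K : ℝ) < ρ) :
    Summable fun a : 𝓞 K => ‖mixedEmbedding K (a : K)‖ ^ (-ρ) := by
  have h : Summable fun z : mixedEmbedding.integerLattice K =>
      ‖(z : mixedEmbedding.mixedSpace K)‖ ^ (-ρ) :=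
    ZLattice.summable_norm_rpow (mixedEmbedding.integerLattice K) (-ρ) (by
      rw [ZLattice.rank ℝ (mixedEmbedding.integerLattice K), mixedEmbedding.finrank]
      linarith)
  have hmem : ∀ a : 𝓞 K, mixedEmbedding K (a : K) ∈ mixedEmbedding.integerLattice K :=
    fun a => ⟨a, rfl⟩
  have hf : Function.Injective fun a : 𝓞 K =>
      (⟨mixedEmbedding K (a : K), hmem a⟩ : mixedEmbedding.integerLattice K) := fun a b hab =>
    RingOfIntegers.ext (mixedEmbedding_injective K (congrArg Subtype.val hab))
  have h2 := h.comp_injective hf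
  simpa only [Function.comp_def] using h2

variable {K}

theorem le_norm_mixedEmbedding (w : InfinitePlace K) (x : K) : w x ≤ ‖mixedEmbedding K x‖ := by
  rw [mixedEmbedding.norm_eq_sup'_normAtPlace, ← mixedEmbedding.normAtPlace_apply w x]
  exact Finset.le_sup' (fun w => mixedEmbedding.normAtPlace w (mixedEmbedding K x))
    (Finset.mem_univ w)

theorem norm_mixedEmbedding_le {x : K} {B : ℝ} (h : ∀ w : InfinitePlace K, w x ≤ B) :
    ‖mixedEmbedding K x‖ ≤ B := by
  rw [mixedEmbedding.norm_eq_sup'_normAtPlace]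
  refine Finset.sup'_le _ _ fun w _ => ?_
  rw [mixedEmbedding.normAtPlace_apply]
  exact h w

/-- Balanced values at all places bound a power of the norm. -/
theorem rpow_le_of_balanced {n : ℕ} (hn : n ≠ 0) {C N B σ : ℝ} (hC : 0 < C) (hN : 0 < N)
    (hB : 0 < B) (hσ : 0 ≤ σ) (h : B ≤ C * N ^ ((n : ℝ)⁻¹)) :
    N ^ (-σ) ≤ C ^ (n * σ) * B ^ (-(n * σ)) := by
  have hn0 : (n : ℝ) ≠ 0 := by exact_mod_cast hn
  have h1 : (C * N ^ ((n : ℝ)⁻¹)) ^ (-(n * σ)) ≤ B ^ (-(n * σ)) :=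
    Real.rpow_le_rpow_of_nonpos hB h (by
      have : 0 ≤ (n : ℝ) * σ := by positivity
      linarith)
  rw [Real.mul_rpow hC.le (by positivity), ← Real.rpow_mul hN.le, Real.rpow_neg hC.le,
    inv_mul_le_iff₀ (by positivity)] at h1
  have h2 : (n : ℝ)⁻¹ * -(n * σ) = -σ := by field_simp
  rwa [h2] at h1

end Balanced

/-! ### Convergence of the Eisenstein series -/

section Pairs

open scoped Classical

variable {F : Type*} [Field F] [NumberField F]

/-- Moving each representative inside its own orbit still gives a system of representatives, so a
sum over orbits is dominated by a sum over points. -/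
theorem smul_out_injective {G X : Type*} [Group G] [MulAction G X] {P : MulAction.orbitRel.Quotient G X → Prop}
    (u : {q : MulAction.orbitRel.Quotient G X // P q} → G) :
    Function.Injective fun q : {q : MulAction.orbitRel.Quotient G X // P q} =>
      u q • Quotient.out q.1 := by
  intro q q' h
  have h1 : ∀ q : {q : MulAction.orbitRel.Quotient G X // P q},
      (Quotient.mk _ (u q • Quotient.out q.1) : MulAction.orbitRel.Quotient G X) = q.1 := by
    intro q
    rw [← Quotient.out_eq q.1]
    refine Quotient.sound ?_
    rw [Quotient.out_eq]
    exact MulAction.mem_orbit _ _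
  apply Subtype.ext
  simp only at h
  rw [← h1 q, ← h1 q', h]

theorem out_ne_zero (q : {q : PairClass F // q ≠ Quotient.mk _ 0}) : Quotient.out q.1 ≠ 0 := by
  intro h
  exact q.2 ((Quotient.out_eq q.1).symm.trans (congrArg _ h))

theorem summable_pair_bound {ρ : ℝ} (hρ : (finrank ℚ F : ℝ) < ρ) :
    Summable fun p : 𝓞 F × 𝓞 F =>
      if p = 0 then 0 else
        (max ‖mixedEmbedding F (p.1 : F)‖ ‖mixedEmbedding F (p.2 : F)‖) ^ (-(2 * ρ)) := by
  classical
  have hn : 0 < (finrank ℚ F : ℝ) := by exact_mod_cast finrank_pos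
  set h : 𝓞 F → ℝ := fun a => ‖mixedEmbedding F (a : F)‖ ^ (-ρ) with hh
  set k : 𝓞 F → ℝ := fun a => ‖mixedEmbedding F (a : F)‖ ^ (-(2 * ρ)) with hk
  set δ : 𝓞 F → ℝ := fun a => if a = 0 then 1 else 0 with hδ
  have sh : Summable h := summable_norm_mixedEmbedding F hρ
  have sk : Summable k := summable_norm_mixedEmbedding F (by linarith)
  have sδ : Summable δ := (hasSum_ite_eq 0 1).summable
  have ph : 0 ≤ h := fun a => by positivity
  have pk : 0 ≤ k := fun a => by positivity
  have pδ : 0 ≤ δ := fun a => by simp only [hδ]; split_ifs <;> simp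
  refine Summable.of_nonneg_of_le (fun p => by split_ifs <;> positivity) (fun p => ?_)
    -- The product `h a * h b` dominates when `a` and `b` are both nonzero. It vanishes when one of
    -- them is `0`, so those pairs need the terms with `δ`.
    (((sh.mul_of_nonneg sh ph ph).add (sδ.mul_of_nonneg sk pδ pk)).add
      (sk.mul_of_nonneg sδ pk pδ))
  obtain ⟨a, b⟩ := p
  have hpos : ∀ a : 𝓞 F, a ≠ 0 → 0 < ‖mixedEmbedding F (a : F)‖ := fun a ha => by
    rw [norm_pos_iff, map_ne_zero_iff _ (mixedEmbedding_injective F)]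
    exact RingOfIntegers.coe_ne_zero_iff.2 ha
  have e1 := mul_nonneg (ph a) (ph b)
  have e2 := mul_nonneg (pδ a) (pk b)
  have e3 := mul_nonneg (pk a) (pδ b)
  simp only at e1 e2 e3
  by_cases ha : a = 0
  · by_cases hb : b = 0
    · rw [if_pos (by simp [ha, hb])]
      simp only
      linarith
    · rw [if_neg (by simp [hb])]
      have : max ‖mixedEmbedding F (a : F)‖ ‖mixedEmbedding F (b : F)‖ =
          ‖mixedEmbedding F (b : F)‖ := by
        simp [ha]
      simp only [this]
      have e4 : δ a * k b = ‖mixedEmbedding F (b : F)‖ ^ (-(2 * ρ)) := by simp [hδ, hk, ha]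
      linarith
  · by_cases hb : b = 0
    · rw [if_neg (by simp [ha])]
      have : max ‖mixedEmbedding F (a : F)‖ ‖mixedEmbedding F (b : F)‖ =
          ‖mixedEmbedding F (a : F)‖ := by
        simp [hb]
      simp only [this]
      have e4 : k a * δ b = ‖mixedEmbedding F (a : F)‖ ^ (-(2 * ρ)) := by simp [hδ, hk, hb]
      linarith
    · rw [if_neg (by simp [ha])]
      have e5 : (max ‖mixedEmbedding F (a : F)‖ ‖mixedEmbedding F (b : F)‖) ^ (-(2 * ρ)) ≤
          h a * h b := by
        have hB : 0 < max ‖mixedEmbedding F (a : F)‖ ‖mixedEmbedding F (b : F)‖ :=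
          lt_max_of_lt_left (hpos a ha)
        rw [show -(2 * ρ) = -ρ + -ρ by ring, Real.rpow_add hB]
        exact mul_le_mul
          (Real.rpow_le_rpow_of_nonpos (hpos a ha) (le_max_left _ _) (by linarith))
          (Real.rpow_le_rpow_of_nonpos (hpos b hb) (le_max_right _ _) (by linarith))
          (by positivity) (ph a)
      simp only
      linarith

/-- In each class a unit makes the numbers `max(|μ|_w, |ν|_w)` balanced. The product over the places
is then bounded below by a multiple of the `n`-th power of the largest one, and distinct classes
give distinct points of `𝓞 F × 𝓞 F`. -/
theorem summable_pairClass_places {σ : ℝ} (hσ : 1 < σ) :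
    Summable fun q : {q : PairClass F // q ≠ Quotient.mk _ 0} =>
      (∏ w : InfinitePlace F, (max (w ((Quotient.out q.1).1 : F)) (w ((Quotient.out q.1).2 : F))) ^
        w.mult) ^ (-(2 * σ)) := by
  have hn : 0 < (finrank ℚ F : ℝ) := by exact_mod_cast finrank_pos
  obtain ⟨C, hC, hbal⟩ := exists_unit_balanced F one_ne_zero
  have htpos : ∀ (p : 𝓞 F × 𝓞 F), p ≠ 0 → ∀ w : InfinitePlace F,
      0 < max (w (p.1 : F)) (w (p.2 : F)) := by
    intro p hp w
    by_cases h1 : p.1 = 0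
    · have h2 : p.2 ≠ 0 := fun h2 => hp (Prod.ext h1 h2)
      exact lt_max_of_lt_right (InfinitePlace.pos_iff.2 (RingOfIntegers.coe_ne_zero_iff.2 h2))
    · exact lt_max_of_lt_left (InfinitePlace.pos_iff.2 (RingOfIntegers.coe_ne_zero_iff.2 h1))
  choose u hu using fun q : {q : PairClass F // q ≠ Quotient.mk _ 0} =>
    hbal (fun w => max (w ((Quotient.out q.1).1 : F)) (w ((Quotient.out q.1).2 : F)))
      (htpos _ (out_ne_zero q))
  have hinj := smul_out_injective (G := (𝓞 F)ˣ) (X := 𝓞 F × 𝓞 F) u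
  have hs := ((summable_pair_bound (F := F) (ρ := finrank ℚ F * σ) (by nlinarith)).comp_injective
    hinj).mul_left (C ^ (finrank ℚ F * (2 * σ)))
  refine Summable.of_nonneg_of_le (fun q => ?_) (fun q => ?_) hs
  · exact Real.rpow_nonneg (Finset.prod_nonneg fun w _ =>
      pow_nonneg (htpos _ (out_ne_zero q) w).le _) _
  · set p := Quotient.out q.1 with hp
    have hne : u q • p ≠ 0 := by
      intro h
      apply out_ne_zero q
      rw [← hp, ← inv_smul_smul (u q) p, h, smul_zero]
    set B := max ‖mixedEmbedding F ((u q • p).1 : F)‖ ‖mixedEmbedding F ((u q • p).2 : F)‖ with hB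
    simp only [Function.comp_apply]
    rw [if_neg hne]
    have hN0 : 0 < ∏ w : InfinitePlace F, (max (w (p.1 : F)) (w (p.2 : F))) ^ w.mult :=
      Finset.prod_pos fun w _ => pow_pos (htpos _ (out_ne_zero q) w) _
    have hw : ∀ w : InfinitePlace F, max (w ((u q • p).1 : F)) (w ((u q • p).2 : F)) ≤
        C * (∏ w : InfinitePlace F, (max (w (p.1 : F)) (w (p.2 : F))) ^ w.mult) ^
          ((finrank ℚ F : ℝ)⁻¹) := by
      intro w
      refine le_trans (le_of_eq ?_) (hu q w)
      simp only [Prod.smul_fst, Prod.smul_snd, Units.smul_def, smul_eq_mul, map_mul, pow_one]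
      rw [mul_max_of_nonneg _ _ (apply_nonneg _ _)]
    have hB0 : 0 < B := by
      obtain ⟨w⟩ := (inferInstance : Nonempty (InfinitePlace F))
      refine (htpos _ hne w).trans_le ?_
      exact max_le_max (le_norm_mixedEmbedding w _) (le_norm_mixedEmbedding w _)
    have hBle : B ≤ C * (∏ w : InfinitePlace F, (max (w (p.1 : F)) (w (p.2 : F))) ^ w.mult) ^
          ((finrank ℚ F : ℝ)⁻¹) :=
      max_le (norm_mixedEmbedding_le fun w => (le_max_left _ _).trans (hw w))
        (norm_mixedEmbedding_le fun w => (le_max_right _ _).trans (hw w))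
    have := rpow_le_of_balanced (n := finrank ℚ F) (σ := 2 * σ) finrank_pos.ne' hC hN0 hB0
      (by linarith) hBle
    rwa [show -((finrank ℚ F : ℝ) * (2 * σ)) = -(2 * (finrank ℚ F * σ)) by ring] at this

theorem bijective_mk_ofReal [IsTotallyReal F] {ι : Type*} (v : ι ≃ (F →+* ℝ)) :
    Function.Bijective fun i => InfinitePlace.mk (Complex.ofRealHom.comp (v i)) := by
  constructor
  · intro i j h
    simp only at h
    apply (bijective_ofReal_comp v).1
    rcases InfinitePlace.mk_eq_iff.1 h with h | h
    · exact h
    · exact (ComplexEmbedding.isReal_iff.1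
        (IsTotallyReal.complexEmbedding_isReal (Complex.ofRealHom.comp (v i)))).symm.trans h
  · intro w
    obtain ⟨i, hi⟩ := (bijective_ofReal_comp v).2 w.embedding
    exact ⟨i, by simp only at hi ⊢; rw [hi, InfinitePlace.mk_embedding]⟩

/-- The coordinates of a pair of integers at the real places of `F`. -/
def pairCoord {ι : Type*} (v : ι → (F →+* ℝ)) (p : 𝓞 F × 𝓞 F) (i : ι) : ℝ × ℝ :=
  (v i (p.1 : F), v i (p.2 : F))

theorem pairCoord_ne_zero {ι : Type*} (v : ι → (F →+* ℝ)) {p : 𝓞 F × 𝓞 F} (hp : p ≠ 0) (i : ι) :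
    pairCoord v p i ≠ 0 := by
  intro h
  apply hp
  simpa [pairCoord, Prod.ext_iff] using h

theorem summable_pairCoord [IsTotallyReal F] {ι : Type*} [Fintype ι] (v : ι ≃ (F →+* ℝ)) {σ : ℝ}
    (hσ : 1 < σ) : Summable fun q : {q : PairClass F // q ≠ Quotient.mk _ 0} =>
      ∏ i, ‖pairCoord v (Quotient.out q.1) i‖ ^ (-(2 * σ)) := by
  refine (summable_pairClass_places hσ).congr fun q => ?_
  rw [← Real.finsetProd_rpow _ _ fun w _ => pow_nonneg (le_max_of_le_left (apply_nonneg w _)) _]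
  symm
  refine Fintype.prod_bijective _ (bijective_mk_ofReal v) _ _ fun i => ?_
  simp [pairCoord, Prod.norm_def, InfinitePlace.apply]

end Pairs

end HilbertEisenstein

namespace HilbertEisenstein

/-! ### Convergence of the `L`-series of the module -/

section ModuleSeries

open scoped Classical

variable {F K : Type*} [Field F] [NumberField F] [Field K] [NumberField K] [Algebra F K]

theorem unit_mem_conductorOrder {I : Ideal (𝓞 F)} {x : 𝓞 K}
    (h : x - 1 ∈ I.map (algebraMap (𝓞 F) (𝓞 K))) : (x : K) ∈ conductorOrder K I :=
  ⟨1, x - 1, h, by simp⟩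

variable (K) in
/-- A fixed power of every unit of `𝓞 K` lies in the group of units of norm one of the order. -/
theorem exists_pow_mem_unitsNormOne {I : Ideal (𝓞 F)} (hI : I ≠ ⊥) :
    ∃ k : ℕ, k ≠ 0 ∧ ∀ u : (𝓞 K)ˣ, ∃ v : unitsNormOne K I,
      (((v : (conductorOrder K I)ˣ) : conductorOrder K I) : K) = ((u : 𝓞 K) : K) ^ k := by
  set J := I.map (algebraMap (𝓞 F) (𝓞 K)) with hJ
  have hJ0 : J ≠ ⊥ := by
    rw [hJ, Ne, Ideal.map_eq_bot_iff_of_injective]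
    · exact hI
    · exact FaithfulSMul.algebraMap_injective (𝓞 F) (𝓞 K)
  have : Finite (𝓞 K ⧸ J) := Ideal.finiteQuotientOfFreeOfNeBot J hJ0
  set k₀ := Nat.card (𝓞 K ⧸ J)ˣ with hk₀
  -- The power `k₀` makes a unit congruent to `1` modulo `J`, hence an element of the order; the
  -- factor `2` turns the norm `±1` into `1`.
  have hk : 2 * k₀ ≠ 0 := mul_ne_zero two_ne_zero Nat.card_pos.ne'
  have hmem : ∀ u : (𝓞 K)ˣ, (((u ^ (2 * k₀) : (𝓞 K)ˣ) : 𝓞 K) : K) ∈ conductorOrder K I := by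
    intro u
    refine unit_mem_conductorOrder (Ideal.Quotient.eq.1 ?_)
    have h := congrArg Units.val
      (pow_card_eq_one' (x := Units.map (Ideal.Quotient.mk J).toMonoidHom u))
    rw [← hk₀] at h
    have h' : Ideal.Quotient.mk J (u : 𝓞 K) ^ k₀ = 1 := by simpa using h
    rw [Units.val_pow_eq_pow_val, map_pow, pow_mul', h', one_pow, map_one]
  have hmul : ∀ u : (𝓞 K)ˣ, (((u ^ (2 * k₀) : (𝓞 K)ˣ) : 𝓞 K) : K) *
      (((u⁻¹ ^ (2 * k₀) : (𝓞 K)ˣ) : 𝓞 K) : K) = 1 := by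
    intro u
    rw [← map_mul, ← Units.val_mul, ← mul_pow, mul_inv_cancel, one_pow, Units.val_one, map_one]
  refine ⟨2 * k₀, hk, fun u => ⟨⟨⟨⟨_, hmem u⟩, ⟨_, hmem u⁻¹⟩, Subtype.ext (hmul u),
    Subtype.ext ((mul_comm _ _).trans (hmul u))⟩, ?_⟩, ?_⟩⟩
  · change Algebra.norm ℚ (((u ^ (2 * k₀) : (𝓞 K)ˣ) : 𝓞 K) : K) = 1
    have h := NumberField.isUnit_iff_norm.1 u.isUnit
    rw [RingOfIntegers.coe_norm] at h
    rw [Units.val_pow_eq_pow_val, RingOfIntegers.coe_eq_algebraMap, map_pow, map_pow, pow_mul, ← sq_abs, h, one_pow, one_pow]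
  · change (((u ^ (2 * k₀) : (𝓞 K)ˣ) : 𝓞 K) : K) = _
    rw [Units.val_pow_eq_pow_val, RingOfIntegers.coe_eq_algebraMap, map_pow]

variable {I : Ideal (𝓞 F)} {M : Submodule (conductorOrder K I) K}

theorem coe_unitsNormOne_smul (v : unitsNormOne K I) (x : M) :
    ((v • x : M) : K) = (((v : (conductorOrder K I)ˣ) : conductorOrder K I) : K) * (x : K) := rfl

theorem exists_mul_integral (ω : Basis (Fin 2) (𝓞 F) M) :
    ∃ m : 𝓞 K, m ≠ 0 ∧ ∀ x : M, ∃ a : 𝓞 K, (a : K) = (m : K) * (x : K) := by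
  obtain ⟨b, hb⟩ := IsLocalization.exist_integer_multiples_of_finite (nonZeroDivisors (𝓞 K))
    (fun i => ((ω i : M) : K))
  refine ⟨b, nonZeroDivisors.coe_ne_zero b, fun x => ?_⟩
  choose a ha using hb
  refine ⟨∑ i, algebraMap (𝓞 F) (𝓞 K) (ω.repr x i) * a i, ?_⟩
  have hx : (x : K) = ∑ i, algebraMap (𝓞 F) K (ω.repr x i) * (ω i : K) := by
    conv_lhs => rw [← ω.sum_repr x]
    rw [Submodule.coe_sum]
    exact Finset.sum_congr rfl fun i _ => Algebra.smul_def _ _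
  rw [hx, RingOfIntegers.coe_eq_algebraMap, map_sum, Finset.mul_sum]
  refine Finset.sum_congr rfl fun i _ => ?_
  have h1 : algebraMap (𝓞 K) K (a i) = (b : 𝓞 K) * (ω i : K) := by
    rw [ha i, Algebra.smul_def]
  rw [map_mul, h1, ← IsScalarTower.algebraMap_apply]
  ring

theorem out_coe_ne_zero (q : {q : ModuleClass M // q ≠ Quotient.mk _ 0}) :
    ((Quotient.out q.1 : M) : K) ≠ 0 := by
  intro h
  exact q.2 ((Quotient.out_eq q.1).symm.trans (congrArg _ (Subtype.ext h)))

/-- A `k`-th power of a unit, which lies in `V`, makes the representative balanced. A common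
denominator `m` carries `M` into `𝓞 K`, where the lattice sum with exponent `[K : ℚ] σ` converges.
-/
theorem summable_moduleClass (hI : I ≠ ⊥) (ω : Basis (Fin 2) (𝓞 F) M) {σ : ℝ} (hσ : 1 < σ) :
    Summable fun q : {q : ModuleClass M // q ≠ Quotient.mk _ 0} =>
      |(Algebra.norm ℚ ((Quotient.out q.1 : M) : K) : ℝ)| ^ (-σ) := by
  have hn : 0 < (finrank ℚ K : ℝ) := by exact_mod_cast finrank_pos
  obtain ⟨k, hk, hpow⟩ := exists_pow_mem_unitsNormOne K hI
  obtain ⟨C, hC, hbal⟩ := exists_unit_balanced K hk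
  obtain ⟨m, hm, hint⟩ := exists_mul_integral ω
  choose u hu using fun q : {q : ModuleClass M // q ≠ Quotient.mk _ 0} =>
    hbal (fun w => w ((Quotient.out q.1 : M) : K)) fun w => InfinitePlace.pos_iff.2 (out_coe_ne_zero q)
  choose v hv using hpow
  choose a ha using hint
  have hmK : (m : K) ≠ 0 := RingOfIntegers.coe_ne_zero_iff.2 hm
  have hm0 : 0 < ‖mixedEmbedding K (m : K)‖ := by
    rw [norm_pos_iff, map_ne_zero_iff _ (mixedEmbedding_injective K)]
    exact hmK
  have hainj : Function.Injective a := fun x y hxy => by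
    have h := (ha x).symm.trans ((congrArg (algebraMap (𝓞 K) K) hxy).trans (ha y))
    exact Subtype.ext (mul_left_cancel₀ hmK h)
  have hs := ((summable_norm_mixedEmbedding K (ρ := finrank ℚ K * σ)
    (by nlinarith)).comp_injective (hainj.comp
      (smul_out_injective (G := unitsNormOne K I) (X := M) fun q => v (u q)))).mul_left
        ((‖mixedEmbedding K (m : K)‖ * C) ^ (finrank ℚ K * σ))
  refine Summable.of_nonneg_of_le (fun q => by positivity) (fun q => ?_) hs
  set x : K := ((Quotient.out q.1 : M) : K) with hx
  have hN0 : 0 < |(Algebra.norm ℚ x : ℝ)| := by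
    rw [abs_pos]
    exact_mod_cast (Algebra.norm_ne_zero_iff.2 (out_coe_ne_zero q))
  simp only [Function.comp_apply]
  set z := a (v (u q) • Quotient.out q.1) with hz
  have hzK : (z : K) = m * (((u q : 𝓞 K) : K) ^ k * x) := by
    rw [hz, ha, coe_unitsNormOne_smul, hv]
  have hz0 : 0 < ‖mixedEmbedding K (z : K)‖ := by
    rw [norm_pos_iff, map_ne_zero_iff _ (mixedEmbedding_injective K), hzK]
    exact mul_ne_zero hmK (mul_ne_zero
      (pow_ne_zero _ (RingOfIntegers.coe_ne_zero_iff.2 (u q).ne_zero)) (out_coe_ne_zero q))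
  refine rpow_le_of_balanced (n := finrank ℚ K) finrank_pos.ne' (by positivity) hN0 hz0
    (by linarith) (norm_mixedEmbedding_le fun w => ?_)
  rw [hzK, map_mul, map_mul, map_pow, mul_assoc]
  have h1 := hu q w
  have h2 : ∏ w : InfinitePlace K, w x ^ w.mult = |(Algebra.norm ℚ x : ℝ)| := by
    rw [InfinitePlace.prod_eq_abs_norm]
    push_cast
    rfl
  rw [← hx, h2] at h1
  exact mul_le_mul (le_norm_mixedEmbedding w _) h1 (by positivity) hm0.le

end ModuleSeries

end HilbertEisenstein

namespace HilbertEisenstein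

/-! ### Relative norms at the places -/

section RelNorm

variable {F K : Type*} [Field F] [NumberField F] [Field K] [NumberField K]
  [Algebra F K] {c r : ℕ}

/-- When `ℂ` is an `F`-algebra through `v_i`, the two embeddings above `i` are all the
`F`-embeddings of `K`, so their product is the relative norm. -/
theorem ArchData.emb_mul_emb (A : ArchData F K c r) (hFK : finrank F K = 2) (i : Fin c ⊕ Fin r)
    (x : K) : A.emb i 0 x * A.emb i 1 x = ((A.v i (Algebra.norm F x) : ℝ) : ℂ) := by
  let _ : Algebra F ℂ := (Complex.ofRealHom.comp (A.v i)).toAlgebra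
  have : FiniteDimensional F K := Module.finite_of_finrank_pos (by omega)
  let f : Fin 2 → (K →ₐ[F] ℂ) := fun e =>
    { A.emb i e with commutes' := fun a => A.emb_algebraMap i e a }
  have hf : ∀ e, f e x = A.emb i e x := fun _ => rfl
  have hinj : Function.Injective f := by
    intro e e' h
    have h1 : A.emb i e = A.emb i e' := by
      ext y
      exact DFunLike.congr_fun h y
    exact congrArg Prod.fst (A.emb_injective (a₁ := (e, i)) (a₂ := (e', i)) h1)
  have hbij : Function.Bijective f := by
    rw [Fintype.bijective_iff_injective_and_card]
    exact ⟨hinj, by rw [AlgHom.card F K ℂ, hFK, Fintype.card_fin]⟩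
  have h1 := Algebra.norm_eq_prod_embeddings F ℂ x
  rw [← Fintype.prod_bijective f hbij _ _ fun _ => rfl, Fin.prod_univ_two, hf, hf] at h1
  exact h1.symm

theorem ArchData.fst_mul_snd (A : ArchData F K c r) (hFK : finrank F K = 2) (j : Fin r) (x : K) :
    A.fst j x * A.snd j x = A.v (Sum.inr j) (Algebra.norm F x) := by
  have h := A.emb_mul_emb hFK (Sum.inr j) x
  simp only [ArchData.emb, Matrix.cons_val_zero, Matrix.cons_val_one, RingHom.comp_apply,
    Complex.ofRealHom_eq_coe] at h
  exact_mod_cast h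

theorem ArchData.normSq_toComplex (A : ArchData F K c r) (hFK : finrank F K = 2) (j : Fin c)
    (x : K) : Complex.normSq (A.toComplex j x) = A.v (Sum.inl j) (Algebra.norm F x) := by
  have h := A.emb_mul_emb hFK (Sum.inl j) x
  simp only [ArchData.emb, Matrix.cons_val_zero, Matrix.cons_val_one,
    ComplexEmbedding.conjugate_coe_eq, Complex.mul_conj] at h
  exact_mod_cast h

end RelNorm

/-! ### The order and its units -/

section Order

variable {F K : Type*} [Field F] [NumberField F] [Field K] [NumberField K] [Algebra F K]
  {I : Ideal (𝓞 F)}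

theorem isIntegral_of_mem_conductorOrder {x : K} (h : x ∈ conductorOrder K I) : IsIntegral ℤ x := by
  obtain ⟨a, y, -, rfl⟩ := h
  refine IsIntegral.add ?_ (RingOfIntegers.isIntegral_coe y)
  rw [IsScalarTower.algebraMap_apply (𝓞 F) (𝓞 K) K]
  exact RingOfIntegers.isIntegral_coe _

/-- Every element of `K` is a fraction of elements of the order. -/
theorem exists_fraction_conductorOrder (hI : I ≠ ⊥) (x : K) :
    ∃ a b : conductorOrder K I, b ≠ 0 ∧ (b : K) * x = a := by
  obtain ⟨t, ht, ht0⟩ := Submodule.exists_mem_ne_zero_of_ne_bot hI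
  have hmem : ∀ y : 𝓞 K, algebraMap (𝓞 K) K (algebraMap (𝓞 F) (𝓞 K) t * y) ∈ conductorOrder K I :=
    fun y => ⟨0, algebraMap (𝓞 F) (𝓞 K) t * y,
      Ideal.mul_mem_right _ _ (Ideal.mem_map_of_mem _ ht), by simp⟩
  obtain ⟨a, b, hb, rfl⟩ := IsFractionRing.div_surjective (A := 𝓞 K) x
  have hb0 : algebraMap (𝓞 K) K b ≠ 0 := by
    simpa using nonZeroDivisors.ne_zero hb
  have ht1 : algebraMap (𝓞 K) K (algebraMap (𝓞 F) (𝓞 K) t) ≠ 0 := by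
    rw [Ne, FaithfulSMul.algebraMap_eq_zero_iff, FaithfulSMul.algebraMap_eq_zero_iff]
    exact ht0
  refine ⟨⟨_, hmem a⟩, ⟨_, hmem b⟩, ?_, ?_⟩
  · rw [Ne, Subtype.ext_iff]
    simpa using ⟨ht0, nonZeroDivisors.ne_zero hb⟩
  · simp only [map_mul]
    field_simp

/-- The ring of multipliers of a projective module is the order. -/
theorem mem_conductorOrder_of_forall_mul_mem (hI : I ≠ ⊥) (M : Submodule (conductorOrder K I) K)
    (hM : Module.Projective (conductorOrder K I) M) {x₀ : M} (hx₀ : (x₀ : K) ≠ 0) {ε : K}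
    (h : ∀ x : M, ε * (x : K) ∈ M) : ε ∈ conductorOrder K I := by
  -- A splitting of the canonical surjection onto `M` from the free module on its elements is a dual
  -- basis: `x = ∑ f_i(x) i`, with `i` running over elements of `M`.
  obtain ⟨f, hf⟩ := hM.out
  -- A linear form on a module inside `K` is multiplication by a constant of `K`, because two
  -- nonzero elements have proportional multiples over the order.
  have key : ∀ i x y : M, ((f y i : conductorOrder K I) : K) * (x : K) =
      ((f x i : conductorOrder K I) : K) * (y : K) := by
    intro i x y
    by_cases hx : (x : K) = 0
    · have : x = 0 := Subtype.ext hx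
      simp [this]
    obtain ⟨a, b, hb, hab⟩ := exists_fraction_conductorOrder hI ((y : K) / x)
    have h1 : b • y = a • x := by
      apply Subtype.ext
      change (b : K) * (y : K) = (a : K) * (x : K)
      rw [← hab]
      field_simp
    have h2 := congrArg (fun g : M →₀ conductorOrder K I => ((g i : conductorOrder K I) : K))
      ((map_smul f b y).symm.trans ((congrArg f h1).trans (map_smul f a x)))
    simp only [Finsupp.smul_apply, smul_eq_mul, MulMemClass.coe_mul] at h2
    have hb' : (b : K) ≠ 0 := fun h => hb (Subtype.ext h)
    apply mul_left_cancel₀ hb'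
    rw [← mul_assoc, h2, ← hab]
    field_simp
  have h3 := congrArg (Subtype.val : M → K) (hf x₀)
  rw [Finsupp.linearCombination_apply, Finsupp.sum, Submodule.coe_sum] at h3
  -- The proportionality moves `ε` into the argument: `f_i(x₀) ε i = f_i(ε i) x₀`. Thus `ε` is the
  -- sum of the `f_i(ε i)`, which lie in the order.
  have h4 : ε * (x₀ : K) = (∑ i ∈ (f x₀).support,
      ((f ⟨ε * (i : K), h i⟩ i : conductorOrder K I) : K)) * (x₀ : K) := by
    conv_lhs => rw [← h3]
    rw [Finset.mul_sum, Finset.sum_mul]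
    refine Finset.sum_congr rfl fun i _ => ?_
    rw [key i x₀ ⟨ε * (i : K), h i⟩]
    change ε * (((f x₀ i : conductorOrder K I) : K) * (i : K)) = _
    ring
  rw [mul_right_cancel₀ hx₀ h4]
  exact sum_mem fun i _ => (f _ i).2

variable (K I) in
/-- The group generated by the units of relative norm one and the units of `F`. -/
abbrev tildeUnits : Subgroup (conductorOrder K I)ˣ :=
  unitsRelNormOne K I ⊔
    (Units.map (algebraMap (𝓞 F) (conductorOrder K I)).toMonoidHom).range

theorem mem_tildeUnits {ε : (conductorOrder K I)ˣ} : ε ∈ tildeUnits K I ↔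
    ∃ v ∈ unitsRelNormOne K I, ∃ u : (𝓞 F)ˣ,
      v * Units.map (algebraMap (𝓞 F) (conductorOrder K I)).toMonoidHom u = ε := by
  rw [Subgroup.mem_sup]
  simp

theorem norm_unit (hFK : finrank F K = 2) (u : (𝓞 F)ˣ) :
    Algebra.norm F (((Units.map (algebraMap (𝓞 F) (conductorOrder K I)).toMonoidHom u :
      (conductorOrder K I)ˣ) : conductorOrder K I) : K) = ((u : 𝓞 F) : F) ^ 2 := by
  rw [← hFK, ← Algebra.norm_algebraMap]
  rfl

theorem norm_of_mem_tildeUnits (hFK : finrank F K = 2) {ε : (conductorOrder K I)ˣ}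
    (h : ε ∈ tildeUnits K I) :
    ∃ u : (𝓞 F)ˣ, Algebra.norm F ((ε : conductorOrder K I) : K) = ((u : 𝓞 F) : F) ^ 2 := by
  obtain ⟨v, hv, u, rfl⟩ := mem_tildeUnits.1 h
  refine ⟨u, ?_⟩
  have hv' : Algebra.norm F ((v : conductorOrder K I) : K) = 1 := hv
  rw [Units.val_mul, MulMemClass.coe_mul, map_mul, hv', one_mul, norm_unit hFK]

theorem tildeUnits_le (hFK : finrank F K = 2) : tildeUnits K I ≤ unitsNormOne K I := by
  intro ε hε
  obtain ⟨u, hu⟩ := norm_of_mem_tildeUnits hFK hε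
  change Algebra.norm ℚ ((ε : conductorOrder K I) : K) = 1
  rw [← Algebra.norm_norm (S := F), hu, map_pow, ← sq_abs]
  have := NumberField.isUnit_iff_norm.1 u.isUnit
  rw [RingOfIntegers.coe_norm] at this
  rw [this, one_pow]

variable (K I) in
/-- The relative norm of units of the order. -/
def unitsRelNorm : (conductorOrder K I)ˣ →* (𝓞 F)ˣ :=
  Units.map (RingOfIntegers.restrict_monoidHom
    ((Algebra.norm F).comp (conductorOrder K I).val.toMonoidHom)
    fun x => Algebra.isIntegral_norm F (isIntegral_of_mem_conductorOrder x.2))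

theorem coe_unitsRelNorm (ε : (conductorOrder K I)ˣ) :
    ((unitsRelNorm K I ε : 𝓞 F) : F) = Algebra.norm F ((ε : conductorOrder K I) : K) := rfl

/-- A unit whose relative norm is a square `u²` is `u` times a unit of relative norm one, and the
squares have finite index in the finitely generated group `(𝓞 F)ˣ`. Finiteness matters because
`unitIndex` would be `0` for an infinite index. -/
theorem finite_quotient_tildeUnits (hFK : finrank F K = 2) :
    Finite (unitsNormOne K I ⧸ (tildeUnits K I).subgroupOf (unitsNormOne K I)) := by
  let P : Subgroup (𝓞 F)ˣ := (powMonoidHom 2).range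
  have hfin : Finite ((𝓞 F)ˣ ⧸ P) := by
    have hfg : Group.FG (𝓞 F)ˣ := Group.fg_iff_monoid_fg.2 inferInstance
    have hfg' : Group.FG ((𝓞 F)ˣ ⧸ P) := QuotientGroup.fg P
    apply CommGroup.finite_of_fg_isMulTorsion
    intro x
    induction x using QuotientGroup.induction_on with
    | H x =>
      rw [isOfFinOrder_iff_pow_eq_one]
      exact ⟨2, two_pos, (QuotientGroup.eq_one_iff (x ^ 2)).2 ⟨x, rfl⟩⟩
  have hP : P.FiniteIndex := Subgroup.finiteIndex_of_finite_quotient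
  have hle : P.comap (unitsRelNorm K I) ≤ tildeUnits K I := by
    rintro ε ⟨u, hu⟩
    rw [mem_tildeUnits]
    refine ⟨ε * (Units.map (algebraMap (𝓞 F) (conductorOrder K I)).toMonoidHom u)⁻¹, ?_, u,
      inv_mul_cancel_right _ _⟩
    have h1 : unitsRelNorm K I (Units.map (algebraMap (𝓞 F) (conductorOrder K I)).toMonoidHom u) =
        u ^ 2 := by
      apply Units.ext
      apply RingOfIntegers.ext
      rw [coe_unitsRelNorm, norm_unit hFK]
      simp
    have h2 : unitsRelNorm K I
        (ε * (Units.map (algebraMap (𝓞 F) (conductorOrder K I)).toMonoidHom u)⁻¹) = 1 := by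
      rw [map_mul, map_inv, h1, ← hu]
      simp
    change Algebra.norm F _ = 1
    rw [← coe_unitsRelNorm, h2]
    simp
  have h2 : (P.comap (unitsRelNorm K I)).FiniteIndex := ⟨by
    rw [Subgroup.index_comap]
    exact fun h => hP.index_ne_zero (Nat.eq_zero_of_zero_dvd
      (h ▸ Subgroup.relIndex_dvd_index_of_normal P _))⟩
  have h3 : (tildeUnits K I).FiniteIndex := Subgroup.finiteIndex_of_le hle
  exact Subgroup.finite_quotient_of_finiteIndex

theorem unitIndex_eq : unitIndex K I =
    Nat.card (unitsNormOne K I ⧸ (tildeUnits K I).subgroupOf (unitsNormOne K I)) := rfl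

theorem countable_units_conductorOrder : Countable (conductorOrder K I)ˣ := by
  have : Countable K := (Module.finBasis ℚ K).equivFun.toEquiv.countable_iff.2 inferInstance
  exact Function.Injective.countable (f := fun u : (conductorOrder K I)ˣ =>
    ((u : conductorOrder K I) : K)) fun u v h => Units.ext (Subtype.ext h)

end Order

end HilbertEisenstein

namespace HilbertEisenstein

/-! ### Translations of the cycle -/

section LogRatio

variable {F K : Type*} [Field F] [Field K] [Algebra F K] {c r : ℕ}

/-- The translation lengths on the geodesics attached to an element of `K`. -/
def ArchData.logRatio (A : ArchData F K c r) (x : K) : Fin r → ℝ :=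
  fun j => Real.log (A.snd j x) - Real.log (A.fst j x)

theorem ArchData.logRatio_mul (A : ArchData F K c r) {x y : K} (hx : x ≠ 0) (hy : y ≠ 0) :
    A.logRatio (x * y) = A.logRatio x + A.logRatio y := by
  funext j
  simp only [ArchData.logRatio, Pi.add_apply, map_mul]
  rw [Real.log_mul (by simpa using hx) (by simpa using hy),
    Real.log_mul (by simpa using hx) (by simpa using hy)]
  ring

theorem ArchData.logRatio_algebraMap (A : ArchData F K c r) (a : F) :
    A.logRatio (algebraMap F K a) = 0 := by
  funext j
  simp [ArchData.logRatio, A.fst_algebraMap, A.snd_algebraMap]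

theorem ArchData.logRatio_neg (A : ArchData F K c r) (x : K) :
    A.logRatio (-x) = A.logRatio x := by
  funext j
  simp [ArchData.logRatio]

end LogRatio

/-- The vectors `(p, 1)` and `(q, 1)` are eigenvectors with eigenvalues `e` and `e'`. In the
parameter `e^x`, the transformation is multiplication by `e' / e`. -/
theorem geodesic_moebius {p q e e' a b c d : ℝ} (he : 0 < e * e') (hp : a * p + b = e * p)
    (hq : a * q + b = e' * q) (hp' : c * p + d = e) (hq' : c * q + d = e') (x : ℝ) :
    ((a : ℂ) * geodesic p q x + b) / ((c : ℂ) * geodesic p q x + d) =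
      geodesic p q (x + (Real.log e' - Real.log e)) := by
  have he0 : e ≠ 0 := left_ne_zero_of_mul he.ne'
  have he0' : e' ≠ 0 := right_ne_zero_of_mul he.ne'
  have hη := orient_ne_zero p q
  have hexp : Real.exp (x + (Real.log e' - Real.log e)) = Real.exp x * (e' / e) := by
    have hpos : 0 < e' / e := by
      rw [div_eq_mul_inv, ← mul_self_mul_inv e]
      have : 0 < (e * e') * (e⁻¹ * e⁻¹) := mul_pos he (mul_self_pos.2 (inv_ne_zero he0))
      field_simp at this ⊢
      simpa using this
    rw [Real.exp_add, ← Real.log_div he0' he0, Real.exp_log hpos]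
  rw [geodesic_eq, geodesic_eq, hexp]
  set η := orient p q
  set X := Real.exp x with hX
  have h1 : ((X : ℝ) : ℂ) - (η : ℝ) * Complex.I ≠ 0 :=
    ofReal_sub_ofReal_mul_I_ne_zero (Or.inr hη)
  have h2 : ((e' * X : ℝ) : ℂ) - ((e * η : ℝ) : ℂ) * Complex.I ≠ 0 :=
    ofReal_sub_ofReal_mul_I_ne_zero (Or.inr (mul_ne_zero he0 hη))
  have h3 : ((X * (e' / e) : ℝ) : ℂ) - (η : ℝ) * Complex.I ≠ 0 :=
    ofReal_sub_ofReal_mul_I_ne_zero (Or.inr hη)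
  have e0 : (e : ℂ) ≠ 0 := by exact_mod_cast he0
  have hpC : (a : ℂ) * p + b = e * p := by exact_mod_cast hp
  have hqC : (a : ℂ) * q + b = e' * q := by exact_mod_cast hq
  have hpC' : (c : ℂ) * p + d = e := by exact_mod_cast hp'
  have hqC' : (c : ℂ) * q + d = e' := by exact_mod_cast hq'
  have hnum : ∀ a b P Q : ℂ, a * p + b = P → a * q + b = Q →
      a * ((((q * X : ℝ) : ℂ) - ((η * p : ℝ) : ℂ) * Complex.I) /
        (((X : ℝ) : ℂ) - (η : ℝ) * Complex.I)) + b =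
      (Q * X - P * η * Complex.I) / (((X : ℝ) : ℂ) - (η : ℝ) * Complex.I) := by
    rintro a b P Q rfl rfl
    rw [eq_div_iff h1, add_mul, mul_assoc, div_mul_cancel₀ _ h1]
    push_cast
    ring
  rw [hnum a b _ _ hpC hqC, hnum c d _ _ hpC' hqC', div_div_div_cancel_right₀ h1,
    div_eq_div_iff (by push_cast at h2; convert h2 using 1) h3]
  push_cast
  field_simp

/-! ### Matrices of multiplications in the basis of `M` -/

section Stabiliser

variable {F K : Type*} [Field F] [NumberField F] [Field K] [NumberField K] [Algebra F K]
  {c r : ℕ} {I : Ideal (𝓞 F)} {M : Submodule (conductorOrder K I) K}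

theorem basis_coe_ne_zero (ω : Basis (Fin 2) (𝓞 F) M) (i : Fin 2) : ((ω i : M) : K) ≠ 0 := by
  intro h
  exact ω.ne_zero i (Subtype.ext h)

theorem coe_smul_add_smul (ω : Basis (Fin 2) (𝓞 F) M) (a b : 𝓞 F) :
    ((a • ω 1 + b • ω 0 : M) : K) =
      algebraMap (𝓞 F) K a * (ω 1 : K) + algebraMap (𝓞 F) K b * (ω 0 : K) :=
  congrArg₂ (· + ·) (Algebra.smul_def a (ω 1 : K)) (Algebra.smul_def b (ω 0 : K))

theorem coe_eq_basis (ω : Basis (Fin 2) (𝓞 F) M) (x : M) :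
    (x : K) = algebraMap (𝓞 F) K (ω.repr x 1) * (ω 1 : K) +
      algebraMap (𝓞 F) K (ω.repr x 0) * (ω 0 : K) := by
  conv_lhs => rw [← ω.sum_repr x]
  rw [Fin.sum_univ_two, add_comm, coe_smul_add_smul]

theorem mem_of_basis (ω : Basis (Fin 2) (𝓞 F) M) (a b : 𝓞 F) :
    algebraMap (𝓞 F) K a * (ω 1 : K) + algebraMap (𝓞 F) K b * (ω 0 : K) ∈ M := by
  rw [← coe_smul_add_smul]
  exact Subtype.prop _

theorem basis_coe_inj (ω : Basis (Fin 2) (𝓞 F) M) {a b a' b' : 𝓞 F}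
    (h : algebraMap (𝓞 F) K a * (ω 1 : K) + algebraMap (𝓞 F) K b * (ω 0 : K) =
      algebraMap (𝓞 F) K a' * (ω 1 : K) + algebraMap (𝓞 F) K b' * (ω 0 : K)) :
    a = a' ∧ b = b' := by
  rw [← coe_smul_add_smul, ← coe_smul_add_smul] at h
  have h1 := congrArg ω.repr (Subtype.ext h)
  have h2 := DFunLike.congr_fun h1 1
  have h3 := DFunLike.congr_fun h1 0
  simp at h2 h3
  exact ⟨h2, h3⟩

theorem norm_eq_of_basis {F K : Type*} [Field F] [Field K] [Algebra F K] (B : Basis (Fin 2) F K)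
    {ε : K} {a b c d : F} (h0 : ε * B 0 = a • B 0 + b • B 1) (h1 : ε * B 1 = c • B 0 + d • B 1) :
    Algebra.norm F ε = a * d - b * c := by
  rw [Algebra.norm_eq_matrix_det B, Matrix.det_fin_two]
  simp only [Algebra.leftMulMatrix_eq_repr_mul, h0, h1]
  simp
  ring

/-- The relation between a matrix `γ` and the multiplication by `ε` in the basis `(τ, 1)`. -/
def Represents (τ : K) (γ : Matrix.SpecialLinearGroup (Fin 2) (𝓞 F)) (ε : K) : Prop :=
  algebraMap (𝓞 F) K (γ 0 0) * τ + algebraMap (𝓞 F) K (γ 0 1) = ε * τ ∧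
    algebraMap (𝓞 F) K (γ 1 0) * τ + algebraMap (𝓞 F) K (γ 1 1) = ε

theorem Represents.mem_fixing {τ ε : K} {γ : Matrix.SpecialLinearGroup (Fin 2) (𝓞 F)}
    (h : Represents τ γ ε) (hε : ε ≠ 0) : γ ∈ fixing F τ := by
  change _ / _ = τ
  rw [h.1, h.2, mul_div_cancel_left₀ _ hε]

/-- The determinant of the multiplication by `ε` is its relative norm. -/
theorem relNorm_eq_of_basis {τ ε : K} {a b c' d : 𝓞 F} (hFK : finrank F K = 2)
    (hli : ∀ a b : 𝓞 F, algebraMap (𝓞 F) K a * τ + algebraMap (𝓞 F) K b = 0 → a = 0 ∧ b = 0)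
    (h1 : algebraMap (𝓞 F) K a * τ + algebraMap (𝓞 F) K b = ε * τ)
    (h2 : algebraMap (𝓞 F) K c' * τ + algebraMap (𝓞 F) K d = ε) :
    Algebra.norm F ε = algebraMap (𝓞 F) F (a * d - b * c') := by
  -- Independence over `𝓞 F` extends to `F` by clearing denominators.
  have hli' : LinearIndependent F ![τ, (1 : K)] := by
    rw [LinearIndependent.pair_iff]
    intro s t hst
    obtain ⟨x, y, hy, rfl⟩ := IsFractionRing.div_surjective (A := 𝓞 F) s
    obtain ⟨x', y', hy', rfl⟩ := IsFractionRing.div_surjective (A := 𝓞 F) t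
    have hy0 : algebraMap (𝓞 F) K y ≠ 0 := by simpa using nonZeroDivisors.ne_zero hy
    have hy0' : algebraMap (𝓞 F) K y' ≠ 0 := by simpa using nonZeroDivisors.ne_zero hy'
    have h3 : algebraMap (𝓞 F) K (x * y') * τ + algebraMap (𝓞 F) K (x' * y) = 0 := by
      simp only [Algebra.smul_def, map_div₀, ← IsScalarTower.algebraMap_apply, mul_one] at hst
      field_simp at hst
      simp only [map_mul]
      linear_combination hst
    obtain ⟨h4, h5⟩ := hli _ _ h3
    have h6 : x = 0 := (mul_eq_zero.1 h4).resolve_right (nonZeroDivisors.ne_zero hy')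
    have h7 : x' = 0 := (mul_eq_zero.1 h5).resolve_right (nonZeroDivisors.ne_zero hy)
    simp [h6, h7]
  let B : Basis (Fin 2) F K := basisOfLinearIndependentOfCardEqFinrank hli' (by simp [hFK])
  have hB0 : B 0 = τ := by simp [B]
  have hB1 : B 1 = 1 := by simp [B]
  have e1 : ε * B 0 = (a : F) • B 0 + (b : F) • B 1 := by
    rw [hB0, hB1, ← h1]
    simp only [Algebra.smul_def, mul_one]
    rfl
  have e2 : ε * B 1 = (c' : F) • B 0 + (d : F) • B 1 := by
    rw [hB0, hB1, mul_one, ← h2]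
    simp only [Algebra.smul_def, mul_one]
    rfl
  rw [norm_eq_of_basis B e1 e2]
  simp

end Stabiliser

end HilbertEisenstein

namespace HilbertEisenstein

/-! ### The stabiliser of the cycle -/

section Cycle

variable {F K : Type*} [Field F] [NumberField F] [Field K] [NumberField K] [Algebra F K]
  {c r : ℕ} {I : Ideal (𝓞 F)} {M : Submodule (conductorOrder K I) K}

/-- The vector `(τ, 1)` is an eigenvector of `γ` with eigenvalue `ε`, so under each embedding the
image of `τ` is fixed. At a split place the eigenvalues at the two end points are the two images of
`ε`, whose product is the relative norm, here `1`. -/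
theorem Represents.moebius_param {A : ArchData F K c r} (hFK : finrank F K = 2) {τ ε : K}
    {γ : Matrix.SpecialLinearGroup (Fin 2) (𝓞 F)} (h : Represents τ γ ε)
    (hε : Algebra.norm F ε = 1) (x : Fin r → ℝ) :
    moebius A.v γ (A.param τ x) = A.param τ (x + A.logRatio ε) := by
  have hε0 : ε ≠ 0 := fun h0 => by simp [h0, Algebra.norm_zero] at hε
  have key : ∀ {R : Type _} [Field R] (σ : K →+* R),
      σ (algebraMap F K (γ 0 0 : F)) * σ τ + σ (algebraMap F K (γ 0 1 : F)) = σ ε * σ τ ∧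
      σ (algebraMap F K (γ 1 0 : F)) * σ τ + σ (algebraMap F K (γ 1 1 : F)) = σ ε := by
    intro R _ σ
    rw [← map_mul, ← map_mul, ← map_add, ← map_mul, ← map_add]
    exact ⟨congrArg σ h.1, congrArg σ h.2⟩
  funext i
  rcases i with j | j
  · obtain ⟨h1, h2⟩ := key (A.toComplex j)
    simp only [A.toComplex_algebraMap] at h1 h2
    simp only [moebius, ArchData.param, Sum.elim_inl]
    rw [h1, h2, mul_div_cancel_left₀ _ (by simpa using hε0)]
  · obtain ⟨h1, h2⟩ := key (A.fst j)
    obtain ⟨h3, h4⟩ := key (A.snd j)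
    simp only [A.fst_algebraMap, A.snd_algebraMap] at h1 h2 h3 h4
    refine geodesic_moebius ?_ h1 h3 h2 h4 (x j)
    rw [A.fst_mul_snd hFK, hε, map_one]
    exact one_pos

variable (ω : Basis (Fin 2) (𝓞 F) M)

theorem eq_zero_of_basis {a b : 𝓞 F}
    (h : algebraMap (𝓞 F) K a * ((ω 1 : K) / (ω 0 : K)) + algebraMap (𝓞 F) K b = 0) :
    a = 0 ∧ b = 0 := by
  have h0 := basis_coe_ne_zero ω 0
  refine basis_coe_inj ω ?_
  field_simp at h
  simp only [map_zero, zero_mul, add_zero]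
  linear_combination h

/-- Units of relative norm one are represented by matrices. -/
theorem exists_represents (hFK : finrank F K = 2) {ε : (conductorOrder K I)ˣ}
    (hε : ε ∈ unitsRelNormOne K I) : ∃ γ : Matrix.SpecialLinearGroup (Fin 2) (𝓞 F),
      Represents ((ω 1 : K) / (ω 0 : K)) γ ((ε : conductorOrder K I) : K) := by
  have h0 := basis_coe_ne_zero ω 0
  have h1 : ∀ x : M, ((((ε : conductorOrder K I) • x : M)) : K) =
      ((ε : conductorOrder K I) : K) * (x : K) := fun _ => rfl
  have e0 := (h1 (ω 0)).symm.trans (coe_eq_basis ω _)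
  have e1 := (h1 (ω 1)).symm.trans (coe_eq_basis ω _)
  set a := ω.repr ((ε : conductorOrder K I) • ω 1) 1
  set b := ω.repr ((ε : conductorOrder K I) • ω 1) 0
  set c' := ω.repr ((ε : conductorOrder K I) • ω 0) 1
  set d := ω.repr ((ε : conductorOrder K I) • ω 0) 0
  have f1 : algebraMap (𝓞 F) K a * ((ω 1 : K) / (ω 0 : K)) + algebraMap (𝓞 F) K b =
      ((ε : conductorOrder K I) : K) * ((ω 1 : K) / (ω 0 : K)) := by
    field_simp
    linear_combination -e1
  have f2 : algebraMap (𝓞 F) K c' * ((ω 1 : K) / (ω 0 : K)) + algebraMap (𝓞 F) K d =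
      ((ε : conductorOrder K I) : K) := by
    field_simp
    linear_combination -e0
  have hdet := relNorm_eq_of_basis hFK (fun a b => eq_zero_of_basis ω) f1 f2
  have hε' : Algebra.norm F ((ε : conductorOrder K I) : K) = 1 := hε
  have hdet1 : a * d - b * c' = 1 := by
    apply FaithfulSMul.algebraMap_injective (𝓞 F) F
    rw [← hdet, hε', map_one]
  exact ⟨⟨!![a, b; c', d], by rw [Matrix.det_fin_two_of]; exact hdet1⟩, f1, f2⟩

/-- The elements of the stabiliser are represented by units of relative norm one. -/
theorem exists_unit_represents (hFK : finrank F K = 2) (hI : I ≠ ⊥)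
    (hM : Module.Projective (conductorOrder K I) M)
    {γ : Matrix.SpecialLinearGroup (Fin 2) (𝓞 F)} (hγ : γ ∈ fixing F ((ω 1 : K) / (ω 0 : K))) :
    ∃ ε ∈ unitsRelNormOne K I,
      Represents ((ω 1 : K) / (ω 0 : K)) γ ((ε : conductorOrder K I) : K) := by
  have h0 := basis_coe_ne_zero ω 0
  have h1 := basis_coe_ne_zero ω 1
  have hdet : γ 0 0 * γ 1 1 - γ 0 1 * γ 1 0 = 1 := by
    rw [← Matrix.det_fin_two]
    exact γ.2
  set τ := (ω 1 : K) / (ω 0 : K) with hτ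
  have hτ0 : τ ≠ 0 := div_ne_zero h1 h0
  set a := γ 0 0
  set b := γ 0 1
  set c' := γ 1 0
  set d := γ 1 1
  have hdetK : algebraMap (𝓞 F) K a * algebraMap (𝓞 F) K d -
      algebraMap (𝓞 F) K b * algebraMap (𝓞 F) K c' = 1 := by
    rw [← map_mul, ← map_mul, ← map_sub, hdet, map_one]
  set ε := algebraMap (𝓞 F) K c' * τ + algebraMap (𝓞 F) K d with hε
  have hγ' : (algebraMap (𝓞 F) K a * τ + algebraMap (𝓞 F) K b) / ε = τ := hγ
  -- Division by zero gives `0`, and `τ ≠ 0`, so the fixed point equation excludes a zero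
  -- denominator.
  have hε0 : ε ≠ 0 := by
    intro h
    rw [h, div_zero] at hγ'
    exact hτ0 hγ'.symm
  have hετ : algebraMap (𝓞 F) K a * τ + algebraMap (𝓞 F) K b = ε * τ := by
    rw [div_eq_iff hε0] at hγ'
    rw [hγ', mul_comm]
  have hnorm : Algebra.norm F ε = 1 := by
    rw [relNorm_eq_of_basis hFK (fun a b => eq_zero_of_basis ω) hετ hε.symm, hdet, map_one]
  -- An eigenvalue of an integral matrix on `(τ, 1)` maps `M` into itself, hence is a multiplier of
  -- `M` and lies in the order.
  have hmul : ∀ {δ : K} {a b c' d : 𝓞 F}, algebraMap (𝓞 F) K a * τ + algebraMap (𝓞 F) K b = δ * τ →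
      algebraMap (𝓞 F) K c' * τ + algebraMap (𝓞 F) K d = δ → δ ∈ conductorOrder K I := by
    intro δ a b c' d h2 h3
    refine mem_conductorOrder_of_forall_mul_mem hI M hM h0 fun x => ?_
    have h4 : δ * (x : K) = algebraMap (𝓞 F) K (ω.repr x 1 * a + ω.repr x 0 * c') * (ω 1 : K) +
        algebraMap (𝓞 F) K (ω.repr x 1 * b + ω.repr x 0 * d) * (ω 0 : K) := by
      have hω : (ω 1 : K) = τ * (ω 0 : K) := by rw [hτ, div_mul_cancel₀ _ h0]
      rw [coe_eq_basis ω x, hω]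
      simp only [map_add, map_mul]
      linear_combination (-algebraMap (𝓞 F) K (ω.repr x 1) * (ω 0 : K)) * h2 -
        (algebraMap (𝓞 F) K (ω.repr x 0) * (ω 0 : K)) * h3
    rw [h4]
    exact mem_of_basis ω _ _
  -- The inverse of `ε` is the eigenvalue of the adjugate matrix, which has lower row `(-c', a)`.
  have hinv : ε * (algebraMap (𝓞 F) K (-c') * τ + algebraMap (𝓞 F) K a) = 1 := by
    rw [map_neg]
    linear_combination algebraMap (𝓞 F) K c' * hετ + algebraMap (𝓞 F) K a * hε + hdetK
  have hmem := hmul hετ hε.symm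
  have hmem' : algebraMap (𝓞 F) K (-c') * τ + algebraMap (𝓞 F) K a ∈ conductorOrder K I := by
    refine hmul (a := d) (b := -b) ?_ rfl
    apply mul_left_cancel₀ hε0
    rw [← mul_assoc, hinv, map_neg]
    linear_combination -algebraMap (𝓞 F) K d * hετ - algebraMap (𝓞 F) K b * hε + τ * hdetK
  exact ⟨⟨⟨ε, hmem⟩, ⟨_, hmem'⟩, Subtype.ext hinv, Subtype.ext ((mul_comm _ _).trans hinv)⟩,
    hnorm, hετ, rfl⟩

end Cycle

end HilbertEisenstein

namespace HilbertEisenstein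

/-! ### Unfolding -/

open MeasureTheory in
/-- Integration over a fundamental domain of a sum over translates. -/
theorem integral_unfold {E Q : Type*} [AddCommGroup E] [MeasurableSpace E] [MeasurableAdd E]
    {μ : Measure E} [μ.IsAddLeftInvariant] (Λ : AddSubgroup E) [Countable Λ] [Countable Q]
    {S : Set E} (hS : IsAddFundamentalDomain Λ S μ) {h : Q → E → ℂ}
    (hint : ∀ q, Integrable (h q) μ) (hsum : Summable fun q => ∫ x, ‖h q x‖ ∂μ) :
    IntegrableOn (fun t => ∑' p : Q × Λ, h p.1 (t + p.2)) S μ ∧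
      ∫ t in S, ∑' p : Q × Λ, h p.1 (t + p.2) ∂μ = ∑' q, ∫ t, h q t ∂μ := by
  have hmp : ∀ l : Λ, MeasurePreserving (fun t : E => t + (l : E)) μ μ := fun l => by
    simp_rw [add_comm _ (l : E)]
    exact measurePreserving_add_left μ _
  have hint' : ∀ (q : Q) (l : Λ), Integrable (fun t => h q (t + l)) μ := fun q l =>
    (hmp l).integrable_comp_of_integrable (hint q)
  have hvadd : ∀ (l : Λ) (x : E), l +ᵥ x = x + l := fun l x => add_comm _ _
  -- For fixed `q` the translates of `S` tile the space, so the sum over `Λ` is the full `L¹` norm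
  -- of `h q`. Finiteness of the total justifies all the interchanges below.
  have hl : ∑' p : Q × Λ, ∫⁻ t in S, ‖h p.1 (t + p.2)‖ₑ ∂μ ≠ ⊤ := by
    rw [ENNReal.tsum_prod']
    have h1 : ∀ q, ∑' l : Λ, ∫⁻ t in S, ‖h q (t + l)‖ₑ ∂μ = ENNReal.ofReal (∫ x, ‖h q x‖ ∂μ) := by
      intro q
      rw [ofReal_integral_norm_eq_lintegral_enorm (hint q),
        hS.lintegral_eq_tsum'' (fun x => ‖h q x‖ₑ)]
      simp_rw [hvadd]
    simp_rw [h1]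
    exact hsum.tsum_ofReal_ne_top
  have hmeas : ∀ p : Q × Λ, AEStronglyMeasurable (fun t => h p.1 (t + p.2)) (μ.restrict S) :=
    fun p => (hint' p.1 p.2).aestronglyMeasurable.restrict
  refine ⟨⟨(AEMeasurable.tsum fun p => (hmeas p).aemeasurable).aestronglyMeasurable, ?_⟩, ?_⟩
  · refine lt_of_le_of_lt (lintegral_mono fun t => enorm_tsum_le_tsum_enorm) ?_
    rw [lintegral_tsum fun p => (hmeas p).enorm]
    exact hl.lt_top
  · rw [integral_tsum hmeas hl]
    have hs : Summable fun p : Q × Λ => ∫ t in S, h p.1 (t + p.2) ∂μ := by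
      refine Summable.of_norm_bounded (ENNReal.summable_toReal hl) fun p => ?_
      rw [← integral_norm_eq_lintegral_enorm (hmeas p)]
      exact norm_integral_le_integral_norm _
    rw [hs.tsum_prod]
    refine tsum_congr fun q => ?_
    rw [hS.integral_eq_tsum'' (h q) (hint q)]
    simp_rw [hvadd]

/-! ### The fundamental domain as one for a group of translations -/

section Lattice

variable {F K : Type*} [Field F] [NumberField F] [Field K] [NumberField K] [Algebra F K]
  {c r : ℕ} {I : Ideal (𝓞 F)} {M : Submodule (conductorOrder K I) K}

theorem unit_coe_ne_zero (ε : (conductorOrder K I)ˣ) : ((ε : conductorOrder K I) : K) ≠ 0 := by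
  intro h
  exact ε.ne_zero (Subtype.ext h)

variable (I) in
/-- The translations of the cycle by the units of the order. -/
def ArchData.translation (A : ArchData F K c r) :
    Additive (conductorOrder K I)ˣ →+ (Fin r → ℝ) where
  toFun ε := A.logRatio ((ε.toMul : conductorOrder K I) : K)
  map_zero' := by
    rw [toMul_zero, Units.val_one]
    simpa using A.logRatio_algebraMap 1
  map_add' ε δ := A.logRatio_mul (unit_coe_ne_zero _) (unit_coe_ne_zero _)

variable (I) in
/-- The group of the translations of the cycle by the units of relative norm one. -/
def ArchData.translations (A : ArchData F K c r) : AddSubgroup (Fin r → ℝ) :=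
  (unitsRelNormOne K I).toAddSubgroup.map (A.translation I)

theorem ArchData.mem_translations {A : ArchData F K c r} {t : Fin r → ℝ} :
    t ∈ A.translations I ↔
      ∃ ε ∈ unitsRelNormOne K I, A.logRatio ((ε : conductorOrder K I) : K) = t := Iff.rfl

instance ArchData.countable_translations (A : ArchData F K c r) : Countable (A.translations I) := by
  have := countable_units_conductorOrder (K := K) (I := I)
  have h1 : Countable (Additive (conductorOrder K I)ˣ) := this
  have h2 : (A.translations I : Set (Fin r → ℝ)).Countable :=
    (Set.countable_range (A.translation I)).mono (by
      rintro _ ⟨ε, -, rfl⟩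
      exact ⟨ε, rfl⟩)
  exact h2

variable {A : ArchData F K c r} {Δ : Set (Fin c ⊕ Fin r → ℂ)}

theorem ArchData.IsFundDomain.volume_eq_zero (hFK : finrank F K = 2) (ω : Basis (Fin 2) (𝓞 F) M)
    (hΔ : A.IsFundDomain ((ω 1 : K) / (ω 0 : K)) Δ) {ε : (conductorOrder K I)ˣ}
    (hε : ε ∈ unitsRelNormOne K I) (h1 : ((ε : conductorOrder K I) : K) ≠ 1)
    (h2 : ((ε : conductorOrder K I) : K) ≠ -1) :
    MeasureTheory.volume {x : Fin r → ℝ | A.param ((ω 1 : K) / (ω 0 : K)) x ∈ Δ ∧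
      A.param ((ω 1 : K) / (ω 0 : K)) (x + A.logRatio ((ε : conductorOrder K I) : K)) ∈ Δ} = 0 := by
  obtain ⟨γ, hγ⟩ := exists_represents ω hFK hε
  have h := hΔ.disjoint γ (hγ.mem_fixing (unit_coe_ne_zero ε)) ?_ ?_
  · simpa only [hγ.moebius_param hFK hε] using h
  · rintro rfl
    exact h1 (by simpa using hγ.2.symm)
  · rintro rfl
    exact h2 (by simpa using hγ.2.symm)

/-- Elements of `Γ_τ` act on the parameter as the translations by units of relative norm one.
Covering uses that every element of `Γ_τ` comes from a unit, disjointness that every such unit gives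
an element of `Γ_τ`. -/
theorem ArchData.IsFundDomain.isAddFundamentalDomain (hFK : finrank F K = 2) (hI : I ≠ ⊥)
    (hM : Module.Projective (conductorOrder K I) M) (ω : Basis (Fin 2) (𝓞 F) M)
    (hΔ : A.IsFundDomain ((ω 1 : K) / (ω 0 : K)) Δ) :
    MeasureTheory.IsAddFundamentalDomain (A.translations I)
      (A.param ((ω 1 : K) / (ω 0 : K)) ⁻¹' Δ) MeasureTheory.volume := by
  refine MeasureTheory.IsAddFundamentalDomain.mk'' hΔ.nullMeasurable ?_ ?_
    fun g => (MeasureTheory.measurePreserving_vadd g _).quasiMeasurePreserving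
  · filter_upwards [hΔ.covers] with x hx
    obtain ⟨γ, hγ, h⟩ := hx
    obtain ⟨ε, hε, hr⟩ := exists_unit_represents ω hFK hI hM hγ
    rw [hr.moebius_param hFK hε] at h
    refine ⟨⟨_, ArchData.mem_translations.2 ⟨ε, hε, rfl⟩⟩, ?_⟩
    rw [add_comm] at h
    exact h
  · intro g hg
    obtain ⟨ε, hε, he⟩ := ArchData.mem_translations.1 (-g).2
    have h0 : A.logRatio ((ε : conductorOrder K I) : K) ≠ 0 := by
      rw [he]
      simpa using hg
    have hone : A.logRatio (1 : K) = 0 := by simpa using A.logRatio_algebraMap 1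
    have h := ArchData.IsFundDomain.volume_eq_zero hFK ω hΔ hε (fun h => h0 (by rw [h, hone]))
      (fun h => h0 (by rw [h, A.logRatio_neg, hone]))
    refine MeasureTheory.measure_mono_null ?_ h
    rintro x ⟨⟨y, hy, rfl⟩, hx⟩
    refine ⟨hx, ?_⟩
    rw [he]
    have : (g +ᵥ y) + ((-g : A.translations I) : Fin r → ℝ) = y := by
      change ((g : Fin r → ℝ) + y) + -(g : Fin r → ℝ) = y
      abel
    simp only
    rw [this]
    exact hy

/-- Only `±1` act trivially on the cycle. -/
theorem ArchData.IsFundDomain.eq_one_or_eq_neg_one (hFK : finrank F K = 2) (hI : I ≠ ⊥)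
    (hM : Module.Projective (conductorOrder K I) M) (ω : Basis (Fin 2) (𝓞 F) M)
    (hΔ : A.IsFundDomain ((ω 1 : K) / (ω 0 : K)) Δ)
    {ε : (conductorOrder K I)ˣ}
    (hε : ε ∈ unitsRelNormOne K I) (h : A.logRatio ((ε : conductorOrder K I) : K) = 0) :
    ((ε : conductorOrder K I) : K) = 1 ∨ ((ε : conductorOrder K I) : K) = -1 := by
  by_contra! hne
  have h1 := ArchData.IsFundDomain.volume_eq_zero hFK ω hΔ hε hne.1 hne.2
  simp only [h, add_zero, and_self] at h1
  -- A further unit acting trivially would make `Δ` meet its translate in all of `Δ`, hence be null;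
  -- but countably many translates of `Δ` cover a space of nonzero measure. This includes `r = 0`,
  -- where the space is a point.
  exact (ArchData.IsFundDomain.isAddFundamentalDomain hFK hI hM ω hΔ).measure_ne_zero
    (NeZero.ne MeasureTheory.volume) h1

end Lattice

end HilbertEisenstein

namespace HilbertEisenstein

/-! ### Pairs of integers and elements of the module -/

section Bijection

variable {F K : Type*} [Field F] [NumberField F] [Field K] [NumberField K] [Algebra F K]
  {c r : ℕ} {I : Ideal (𝓞 F)} {M : Submodule (conductorOrder K I) K}

/-- The pair `(μ, ν)` with `x = μ ω₂ + ν ω₁`. -/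
def basisPair (ω : Basis (Fin 2) (𝓞 F) M) (x : M) : 𝓞 F × 𝓞 F := (ω.repr x 1, ω.repr x 0)

theorem basisPair_bijective (ω : Basis (Fin 2) (𝓞 F) M) : Function.Bijective (basisPair ω) := by
  constructor
  · intro x y h
    simp only [basisPair, Prod.mk.injEq] at h
    apply ω.repr.injective
    ext i
    fin_cases i
    · exact congrArg _ h.2
    · exact congrArg _ h.1
  · rintro ⟨a, b⟩
    refine ⟨a • ω 1 + b • ω 0, ?_⟩
    simp [basisPair]

theorem basisPair_ne_zero (ω : Basis (Fin 2) (𝓞 F) M) {x : M} (hx : x ≠ 0) :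
    basisPair ω x ≠ 0 := by
  intro h
  exact hx ((basisPair_bijective ω).1 (h.trans (by simp [basisPair]; rfl)))

variable (K I) in
/-- The units of `F` in the order. -/
abbrev baseUnit : (𝓞 F)ˣ →* (conductorOrder K I)ˣ :=
  Units.map (algebraMap (𝓞 F) (conductorOrder K I)).toMonoidHom

theorem basisPair_baseUnit_smul (ω : Basis (Fin 2) (𝓞 F) M) (u : (𝓞 F)ˣ) (x : M) :
    basisPair ω (baseUnit K I u • x) = u • basisPair ω x := by
  have h : baseUnit K I u • x = (u : 𝓞 F) • x := by
    apply Subtype.ext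
    exact (Algebra.smul_def (u : 𝓞 F) (x : K)).symm
  rw [h]
  simp [basisPair, Units.smul_def]

theorem mk_basisPair_eq_iff (ω : Basis (Fin 2) (𝓞 F) M) {x y : M} :
    (Quotient.mk _ (basisPair ω x) : PairClass F) = Quotient.mk _ (basisPair ω y) ↔
      ∃ u : (𝓞 F)ˣ, baseUnit K I u • y = x := by
  rw [Quotient.eq, MulAction.orbitRel_apply]
  constructor
  · rintro ⟨u, hu⟩
    refine ⟨u, (basisPair_bijective ω).1 ?_⟩
    rw [basisPair_baseUnit_smul]
    exact hu
  · rintro ⟨u, rfl⟩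
    exact ⟨u, (basisPair_baseUnit_smul ω u y).symm⟩

theorem coe_units_smul (ε : (conductorOrder K I)ˣ) (x : M) :
    ((ε • x : M) : K) = ((ε : conductorOrder K I) : K) * (x : K) := rfl

theorem units_smul_left_injective {x : M} (hx : (x : K) ≠ 0) {ε δ : (conductorOrder K I)ˣ}
    (h : ε • x = δ • x) : ε = δ := by
  have h1 := congrArg (Subtype.val : M → K) h
  rw [coe_units_smul, coe_units_smul] at h1
  exact Units.ext (Subtype.ext (mul_right_cancel₀ hx h1))

theorem units_smul_ne_zero (ε : (conductorOrder K I)ˣ) {x : M} (hx : (x : K) ≠ 0) :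
    ((ε • x : M) : K) ≠ 0 := by
  rw [coe_units_smul]
  exact mul_ne_zero (unit_coe_ne_zero ε) hx

theorem baseUnit_mem_tildeUnits (u : (𝓞 F)ˣ) : baseUnit K I u ∈ tildeUnits K I :=
  Subgroup.mem_sup_right ⟨u, rfl⟩

/-- A unit of relative norm one with prescribed translation. -/
def ArchData.liftTranslation {A : ArchData F K c r} (l : A.translations I) :
    (conductorOrder K I)ˣ := (ArchData.mem_translations.1 l.2).choose

theorem ArchData.liftTranslation_mem {A : ArchData F K c r} (l : A.translations I) :
    ArchData.liftTranslation l ∈ unitsRelNormOne K I :=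
  (ArchData.mem_translations.1 l.2).choose_spec.1

theorem ArchData.logRatio_liftTranslation {A : ArchData F K c r} (l : A.translations I) :
    A.logRatio ((ArchData.liftTranslation l : conductorOrder K I) : K) = l :=
  (ArchData.mem_translations.1 l.2).choose_spec.2

theorem ArchData.logRatio_baseUnit (A : ArchData F K c r) (u : (𝓞 F)ˣ) :
    A.logRatio ((baseUnit K I u : conductorOrder K I) : K) = 0 :=
  A.logRatio_algebraMap ((u : 𝓞 F) : F)

theorem ArchData.logRatio_units_mul (A : ArchData F K c r) (ε δ : (conductorOrder K I)ˣ) :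
    A.logRatio (((ε * δ : (conductorOrder K I)ˣ) : conductorOrder K I) : K) =
      A.logRatio ((ε : conductorOrder K I) : K) + A.logRatio ((δ : conductorOrder K I) : K) :=
  A.logRatio_mul (unit_coe_ne_zero ε) (unit_coe_ne_zero δ)

theorem ArchData.logRatio_units_inv (A : ArchData F K c r) (ε : (conductorOrder K I)ˣ) :
    A.logRatio (((ε⁻¹ : (conductorOrder K I)ˣ) : conductorOrder K I) : K) =
      -A.logRatio ((ε : conductorOrder K I) : K) := by
  rw [eq_neg_iff_add_eq_zero, ← A.logRatio_units_mul, inv_mul_cancel, Units.val_one]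
  simpa using A.logRatio_algebraMap 1

/-- The nonzero classes of `M / V` together with the classes of `V` modulo the subgroup `Ṽ`. -/
abbrev UnfoldIndex (M : Submodule (conductorOrder K I) K) : Type _ :=
  {q : ModuleClass M // q ≠ Quotient.mk _ 0} ×
    (unitsNormOne K I ⧸ (tildeUnits K I).subgroupOf (unitsNormOne K I))

/-- The representative in `M` of an index. -/
def UnfoldIndex.rep (p : UnfoldIndex M) : M :=
  ((Quotient.out p.2 : unitsNormOne K I) : (conductorOrder K I)ˣ) • Quotient.out p.1.1

theorem UnfoldIndex.rep_ne_zero (p : UnfoldIndex M) : ((UnfoldIndex.rep p : M) : K) ≠ 0 :=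
  units_smul_ne_zero _ (out_coe_ne_zero p.1)

theorem mk_ne_zero {m : 𝓞 F × 𝓞 F} (hm : m ≠ 0) :
    (Quotient.mk _ m : PairClass F) ≠ Quotient.mk _ 0 := by
  rw [Ne, Quotient.eq, MulAction.orbitRel_apply]
  rintro ⟨u, hu⟩
  simp only [smul_zero] at hu
  exact hm hu.symm

/-- The parametrisation of the classes of pairs. -/
def ArchData.unfoldMap (A : ArchData F K c r) (ω : Basis (Fin 2) (𝓞 F) M)
    (p : UnfoldIndex M × A.translations I) : {q : PairClass F // q ≠ Quotient.mk _ 0} :=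
  ⟨Quotient.mk _ (basisPair ω (ArchData.liftTranslation p.2 • UnfoldIndex.rep p.1)),
    mk_ne_zero (basisPair_ne_zero ω fun h => units_smul_ne_zero (ArchData.liftTranslation p.2)
      (UnfoldIndex.rep_ne_zero p.1) (congrArg Subtype.val h))⟩

/-- The group `V` acts freely on the nonzero elements of `M`, and `Ṽ` is generated by `V₁` and the
units of `F`. By `hker` an element of `V₁` is determined up to sign by its translation, and the sign
is absorbed by the units of `F`. -/
theorem ArchData.unfoldMap_bijective (A : ArchData F K c r) (hFK : finrank F K = 2)
    (ω : Basis (Fin 2) (𝓞 F) M)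
    (hker : ∀ ε ∈ unitsRelNormOne K I, A.logRatio ((ε : conductorOrder K I) : K) = 0 →
      ((ε : conductorOrder K I) : K) = 1 ∨ ((ε : conductorOrder K I) : K) = -1) :
    Function.Bijective (A.unfoldMap ω) := by
  have hlift : ∀ l : A.translations I, ArchData.liftTranslation l ∈ tildeUnits K I := fun l =>
    Subgroup.mem_sup_left (ArchData.liftTranslation_mem l)
  constructor
  · rintro ⟨⟨q, p⟩, l⟩ ⟨⟨q', p'⟩, l'⟩ h
    obtain ⟨u, hu⟩ := (mk_basisPair_eq_iff ω).1 (congrArg Subtype.val h)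
    simp only [UnfoldIndex.rep, smul_smul] at hu
    -- All the units in the relation lie in `V`, so they do not change the class in `M / V`.
    have hq : q = q' := by
      apply Subtype.ext
      rw [← Quotient.out_eq q.1, ← Quotient.out_eq q'.1, Quotient.eq, MulAction.orbitRel_apply]
      refine ⟨⟨(ArchData.liftTranslation l * (Quotient.out p : unitsNormOne K I))⁻¹ *
        (baseUnit K I u * (ArchData.liftTranslation l' * (Quotient.out p' : unitsNormOne K I))),
        ?_⟩, ?_⟩
      · exact mul_mem (inv_mem (mul_mem (tildeUnits_le hFK (hlift l)) (Quotient.out p).2))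
          (mul_mem (tildeUnits_le hFK (baseUnit_mem_tildeUnits u))
            (mul_mem (tildeUnits_le hFK (hlift l')) (Quotient.out p').2))
      · change ((ArchData.liftTranslation l * (Quotient.out p : unitsNormOne K I))⁻¹ *
          (baseUnit K I u * (ArchData.liftTranslation l' * (Quotient.out p' : unitsNormOne K I)))) •
            Quotient.out q'.1 = Quotient.out q.1
        rw [mul_smul, inv_smul_eq_iff]
        exact hu
    subst hq
    have hε := units_smul_left_injective (out_coe_ne_zero q) hu
    -- The remaining units lie in `Ṽ`, so the two representatives of `V / Ṽ` agree modulo `Ṽ`.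
    have hp : p = p' := by
      rw [← Quotient.out_eq p, ← Quotient.out_eq p']
      refine QuotientGroup.eq.2 ?_
      rw [Subgroup.mem_subgroupOf]
      have : (((Quotient.out p)⁻¹ * Quotient.out p' : unitsNormOne K I) : (conductorOrder K I)ˣ) =
          ArchData.liftTranslation l * (baseUnit K I u)⁻¹ * (ArchData.liftTranslation l')⁻¹ := by
        rw [Subgroup.coe_mul, Subgroup.coe_inv, inv_mul_eq_iff_eq_mul]
        calc _ = (baseUnit K I u * (ArchData.liftTranslation l' *
                (Quotient.out p' : unitsNormOne K I))) * (baseUnit K I u)⁻¹ *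
                (ArchData.liftTranslation l')⁻¹ := by
              rw [mul_comm (baseUnit K I u), mul_inv_cancel_right, mul_comm, inv_mul_cancel_left]
          _ = _ := by
              rw [hε, mul_comm (ArchData.liftTranslation l), mul_assoc, mul_assoc, mul_assoc]
      rw [this]
      exact mul_mem (mul_mem (hlift l) (inv_mem (baseUnit_mem_tildeUnits u))) (inv_mem (hlift l'))
    subst hp
    have hl : l = l' := by
      apply Subtype.ext
      have h1 := congrArg (fun ε : (conductorOrder K I)ˣ => A.logRatio ((ε : conductorOrder K I) : K))
        (mul_right_cancel ((mul_assoc _ _ _).trans hε))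
      simp only [A.logRatio_units_mul, ArchData.logRatio_liftTranslation,
        A.logRatio_baseUnit, zero_add] at h1
      exact h1.symm
    rw [hl]
  · rintro ⟨q, hq⟩
    obtain ⟨m, rfl⟩ := Quotient.exists_rep q
    obtain ⟨x, rfl⟩ := (basisPair_bijective ω).2 m
    have hx : x ≠ 0 := by
      rintro rfl
      exact hq (by simp [basisPair]; rfl)
    let q₀ : ModuleClass M := Quotient.mk _ x
    have hq₀ : q₀ ≠ Quotient.mk _ 0 := by
      rw [Ne, Quotient.eq, MulAction.orbitRel_apply]
      rintro ⟨v, hv⟩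
      simp only [smul_zero] at hv
      exact hx hv.symm
    obtain ⟨v, hv⟩ : ∃ v : unitsNormOne K I, v • Quotient.out q₀ = x := by
      have h1 : (Quotient.mk _ x : ModuleClass M) = Quotient.mk _ (Quotient.out q₀) :=
        (Quotient.out_eq q₀).symm
      rw [Quotient.eq, MulAction.orbitRel_apply] at h1
      exact h1
    let N := (tildeUnits K I).subgroupOf (unitsNormOne K I)
    obtain ⟨w, hw⟩ := QuotientGroup.mk_out_eq_mul N v
    obtain ⟨ε, hε, u, hu⟩ := mem_tildeUnits.1 (inv_mem (Subgroup.mem_subgroupOf.1 w.2))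
    let l : A.translations I := ⟨_, ArchData.mem_translations.2 ⟨ε, hε, rfl⟩⟩
    -- The unit `ε` and the chosen lift of its translation differ by `±1`, which is a unit of `F`.
    obtain ⟨e, he⟩ : ∃ e : (𝓞 F)ˣ, ε = baseUnit K I e * ArchData.liftTranslation l := by
      have h0 : A.logRatio (((ε * (ArchData.liftTranslation l)⁻¹ : (conductorOrder K I)ˣ) :
          conductorOrder K I) : K) = 0 := by
        rw [A.logRatio_units_mul, A.logRatio_units_inv, ArchData.logRatio_liftTranslation]
        exact add_neg_cancel _
      rcases hker _ (mul_mem hε (inv_mem (ArchData.liftTranslation_mem l))) h0 with h | h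
      · refine ⟨1, ?_⟩
        rw [map_one, one_mul, ← mul_inv_eq_one]
        exact Units.ext (Subtype.ext h)
      · refine ⟨-1, ?_⟩
        rw [← mul_inv_eq_iff_eq_mul]
        refine Units.ext (Subtype.ext (h.trans ?_))
        simp
    refine ⟨⟨⟨⟨q₀, hq₀⟩, (v : unitsNormOne K I ⧸ N)⟩, l⟩, Subtype.ext ?_⟩
    refine ((mk_basisPair_eq_iff ω).2 ⟨u * e, ?_⟩).symm
    have hvw : (v : (conductorOrder K I)ˣ) =
        ((Quotient.out (v : unitsNormOne K I ⧸ N) : unitsNormOne K I) : (conductorOrder K I)ˣ) *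
          ((w : unitsNormOne K I) : (conductorOrder K I)ˣ)⁻¹ := by
      have := congrArg (Subtype.val : unitsNormOne K I → (conductorOrder K I)ˣ) hw
      rw [Subgroup.coe_mul] at this
      rw [eq_mul_inv_iff_mul_eq]
      exact this.symm
    rw [← hv]
    simp only [UnfoldIndex.rep, smul_smul]
    change _ = (v : (conductorOrder K I)ˣ) • Quotient.out q₀
    congr 1
    have hcomm : ∀ a b x y : (conductorOrder K I)ˣ, a * b * (x * y) = y * (b * x * a) := by
      intro a b x y
      ac_rfl
    rw [hvw, ← hu, he, map_mul]
    exact hcomm _ _ _ _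

end Bijection

end HilbertEisenstein

namespace HilbertEisenstein

/-! ### The terms of the Eisenstein series on the cycle -/

section Powers

theorem ofReal_prod_cpow {ι : Type*} (t : Finset ι) {a : ι → ℝ} (ha : ∀ i, 0 ≤ a i) (s : ℂ) :
    ((∏ i ∈ t, a i : ℝ) : ℂ) ^ s = ∏ i ∈ t, ((a i : ℝ) : ℂ) ^ s := by
  classical
  induction t using Finset.induction_on with
  | empty => simp
  | insert i t hi ih =>
    rw [Finset.prod_insert hi, Finset.prod_insert hi, Complex.ofReal_mul,
      Complex.mul_cpow_ofReal_nonneg (ha i) (Finset.prod_nonneg fun i _ => ha i), ih]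

theorem ofReal_cpow_ne_zero {a : ℝ} (ha : 0 < a) (s : ℂ) : ((a : ℝ) : ℂ) ^ s ≠ 0 := by
  rw [Complex.cpow_ne_zero_iff]
  exact Or.inl (by exact_mod_cast ha.ne')

theorem ofReal_div_cpow {a b : ℝ} (ha : 0 ≤ a) (hb : 0 < b) (s : ℂ) :
    ((a / b : ℝ) : ℂ) ^ s = ((a : ℝ) : ℂ) ^ s * ((b : ℝ) : ℂ) ^ (-s) := by
  rw [Complex.cpow_neg, ← div_eq_mul_inv, eq_div_iff (ofReal_cpow_ne_zero hb s),
    ← Complex.mul_cpow_ofReal_nonneg (div_nonneg ha hb.le) hb.le, ← Complex.ofReal_mul,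
    div_mul_cancel₀ _ hb.ne']

theorem ofReal_sq_cpow {a : ℝ} (ha : 0 < a) (s : ℂ) :
    ((a ^ 2 : ℝ) : ℂ) ^ s = ((a : ℝ) : ℂ) ^ (2 * s) := by
  rw [two_mul, Complex.cpow_add _ _ (by exact_mod_cast ha.ne'),
    ← Complex.mul_cpow_ofReal_nonneg ha.le ha.le, ← Complex.ofReal_mul, sq]

theorem sign_mul_sign_div (x : ℝ) {w : ℝ} (hw : w ≠ 0) :
    (SignType.sign w : ℝ) * (SignType.sign (x / w) : ℝ) = ((SignType.sign x : ℤ) : ℝ) := by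
  rcases hw.lt_or_gt with hw | hw
  · rw [div_eq_mul_inv, sign_mul, sign_neg hw, sign_neg (inv_lt_zero.2 hw)]
    simp
  · rw [div_eq_mul_inv, sign_mul, sign_pos hw, sign_pos (inv_pos.2 hw)]
    simp

end Powers

section EisensteinTerm

variable {F : Type*} [Field F] [NumberField F] [IsTotallyReal F] {ι : Type*} [Fintype ι]

theorem eisensteinTerm_mk (v : ι ≃ (F →+* ℝ)) (s : ℂ) {m : 𝓞 F × 𝓞 F} (hm : m ≠ 0) {z : ι → ℂ}
    (hz : z ∈ halfPlanes ι) : eisensteinTerm v z s (Quotient.mk _ m) =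
      ∏ i, localFactor s (pairCoord v m i) (z i) := by
  change ((∏ i, (z i).im : ℝ) : ℂ) ^ s /
    ((‖∏ i, (((v i (m.1 : F) : ℝ) : ℂ) * z i + ((v i (m.2 : F) : ℝ) : ℂ))‖ : ℝ) : ℂ) ^ (2 * s) = _
  have hne : ∀ i, (((v i (m.1 : F) : ℝ) : ℂ) * z i + ((v i (m.2 : F) : ℝ) : ℂ)) ≠ 0 := fun i =>
    mul_add_ne_zero (pairCoord_ne_zero v hm i) (hz i)
  have hpos : 0 < ‖∏ i, (((v i (m.1 : F) : ℝ) : ℂ) * z i + ((v i (m.2 : F) : ℝ) : ℂ))‖ :=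
    norm_pos_iff.2 (Finset.prod_ne_zero_iff.2 fun i _ => hne i)
  simp only [localFactor, pairCoord]
  rw [← ofReal_prod_cpow Finset.univ
    (fun i => div_nonneg (hz i).le (Complex.normSq_nonneg _)), Finset.prod_div_distrib,
    ← map_prod, Complex.normSq_eq_norm_sq,
    ofReal_div_cpow (Finset.prod_nonneg fun i _ => (hz i).le) (by positivity), Complex.cpow_neg,
    ofReal_sq_cpow hpos, div_eq_mul_inv]

theorem summableSmooth_eisensteinTerm [DecidableEq ι] (v : ι ≃ (F →+* ℝ)) {s : ℂ} (hs : 1 < s.re) :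
    SummableSmooth (fun (q : {q : PairClass F // q ≠ Quotient.mk _ 0}) z =>
      eisensteinTerm v z s q.1) (halfPlanes ι) := by
  refine (summableSmooth_prod_localFactor s
    (fun (q : {q : PairClass F // q ≠ Quotient.mk _ 0}) => pairCoord v (Quotient.out q.1))
    (fun q => pairCoord_ne_zero v (out_ne_zero q)) (summable_pairCoord v hs)).congr
    isOpen_halfPlanes fun q z hz => ?_
  rw [← eisensteinTerm_mk v s (out_ne_zero q) hz, Quotient.out_eq]

end EisensteinTerm

/-! ### Values of one term on the cycle -/

section CycleTerm

variable {F K : Type*} [Field F] [Field K] [Algebra F K] {c r : ℕ}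

/-- The pull-back to the cycle of the term of the Eisenstein series attached to `y`. -/
def ArchData.cycleTerm (A : ArchData F K c r) (s : ℂ) (τ y : K) (t : Fin r → ℝ) : ℂ :=
  (∏ j, (((A.toComplex j τ).im / Complex.normSq (A.toComplex j y) : ℝ) : ℂ) ^ s) *
    ∏ j, localForm s (A.fst j τ) (A.snd j τ) (A.fst j y) (A.snd j y) (t j)

variable {A : ArchData F K c r} {ω₁ ω₂ : K}

theorem ArchData.im_toComplex (h0 : ω₁ ≠ 0) (j : Fin c) :
    (A.toComplex j (ω₂ / ω₁)).im =
      A.det ω₁ ω₂ (Sum.inl j) / Complex.normSq (A.toComplex j ω₁) := by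
  have h1 : Complex.normSq (A.toComplex j ω₁) ≠ 0 := by simpa using h0
  rw [map_div₀, Complex.div_im]
  simp only [ArchData.det, Sum.elim_inl]
  field_simp

theorem ArchData.snd_sub_fst (h0 : ω₁ ≠ 0) (j : Fin r) :
    A.snd j (ω₂ / ω₁) - A.fst j (ω₂ / ω₁) =
      A.det ω₁ ω₂ (Sum.inr j) / (A.fst j ω₁ * A.snd j ω₁) := by
  have h1 : A.fst j ω₁ ≠ 0 := by simpa using h0
  have h2 : A.snd j ω₁ ≠ 0 := by simpa using h0
  rw [map_div₀, map_div₀]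
  simp only [ArchData.det, Sum.elim_inr]
  field_simp

theorem ArchData.IsPositive.fst_ne_snd (h : A.IsPositive ω₁ ω₂) (h0 : ω₁ ≠ 0) (j : Fin r) :
    A.fst j (ω₂ / ω₁) ≠ A.snd j (ω₂ / ω₁) := by
  have h1 : A.fst j ω₁ ≠ 0 := by simpa using h0
  have h2 : A.snd j ω₁ ≠ 0 := by simpa using h0
  intro h3
  have h4 := A.snd_sub_fst (ω₂ := ω₂) h0 j
  rw [h3, sub_self, eq_comm, div_eq_zero_iff] at h4
  exact h4.elim (h.det_pos _).ne' (mul_ne_zero h1 h2)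

theorem ArchData.IsPositive.im_pos (h : A.IsPositive ω₁ ω₂) (h0 : ω₁ ≠ 0) (j : Fin c) :
    0 < (A.toComplex j (ω₂ / ω₁)).im := by
  rw [A.im_toComplex h0]
  exact div_pos (h.det_pos _) (Complex.normSq_pos.2 (by simpa using h0))

theorem ArchData.IsPositive.param_mem (h : A.IsPositive ω₁ ω₂) (h0 : ω₁ ≠ 0) (t : Fin r → ℝ) :
    A.param (ω₂ / ω₁) t ∈ halfPlanes (Fin c ⊕ Fin r) := by
  rintro (j | j)
  · exact h.im_pos h0 j
  · exact geodesic_im_pos (h.fst_ne_snd h0 j) _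

/-- The scalars that come out at the complex and split places multiply to the norm of `ε` to the
power `-s`, which is `1` by `hnorm`; only the translation remains. -/
theorem ArchData.cycleTerm_mul {s : ℂ} {τ ε y : K} (him : ∀ j, 0 ≤ (A.toComplex j τ).im)
    (hε0 : ε ≠ 0) (hpos : ∀ j, 0 < A.fst j ε * A.snd j ε)
    (hnorm : (∏ j, Complex.normSq (A.toComplex j ε)) * ∏ j, (A.fst j ε * A.snd j ε) = 1)
    (t : Fin r → ℝ) :
    A.cycleTerm s τ (ε * y) t = A.cycleTerm s τ y (t + A.logRatio ε) := by
  have hsq : ∀ j, 0 < Complex.normSq (A.toComplex j ε) := fun j =>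
    Complex.normSq_pos.2 (by simpa using hε0)
  have h1 : ∀ j, (((A.toComplex j τ).im / Complex.normSq (A.toComplex j (ε * y)) : ℝ) : ℂ) ^ s =
      ((Complex.normSq (A.toComplex j ε) : ℝ) : ℂ) ^ (-s) *
        (((A.toComplex j τ).im / Complex.normSq (A.toComplex j y) : ℝ) : ℂ) ^ s := by
    intro j
    rw [map_mul, map_mul, mul_comm (Complex.normSq _), ← div_div, ofReal_div_cpow
      (div_nonneg (him j) (Complex.normSq_nonneg _)) (hsq j), mul_comm]
  have h2 : ∀ j, localForm s (A.fst j τ) (A.snd j τ) (A.fst j (ε * y)) (A.snd j (ε * y)) (t j) =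
      ((A.fst j ε * A.snd j ε : ℝ) : ℂ) ^ (-s) *
        localForm s (A.fst j τ) (A.snd j τ) (A.fst j y) (A.snd j y) ((t + A.logRatio ε) j) := by
    intro j
    rw [map_mul, map_mul, localForm_smul _ _ _ _ _ _ _ _ (hpos j)]
    rfl
  have h3 : (∏ j, ((Complex.normSq (A.toComplex j ε) : ℝ) : ℂ) ^ (-s)) *
      ∏ j, ((A.fst j ε * A.snd j ε : ℝ) : ℂ) ^ (-s) = 1 := by
    rw [← ofReal_prod_cpow _ fun j => (hsq j).le, ← ofReal_prod_cpow _ fun j => (hpos j).le,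
      ← Complex.mul_cpow_ofReal_nonneg (Finset.prod_nonneg fun j _ => (hsq j).le)
        (Finset.prod_nonneg fun j _ => (hpos j).le), ← Complex.ofReal_mul, hnorm,
      Complex.ofReal_one, Complex.one_cpow]
  rw [ArchData.cycleTerm, Finset.prod_congr rfl fun j _ => h1 j,
    Finset.prod_congr rfl fun j _ => h2 j, Finset.prod_mul_distrib, Finset.prod_mul_distrib,
    mul_mul_mul_comm, h3, one_mul, ArchData.cycleTerm]

theorem ArchData.integrable_cycleTerm {s : ℂ} (hs : 0 < s.re) (τ : K) {y : K} (hy : y ≠ 0) :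
    MeasureTheory.Integrable (A.cycleTerm s τ y) := by
  refine MeasureTheory.Integrable.const_mul ?_ _
  exact MeasureTheory.Integrable.fintype_prod (f := fun j x => localForm s (A.fst j τ) (A.snd j τ)
    (A.fst j y) (A.snd j y) x) fun j => integrable_localForm hs _ _ (by simpa using hy)
      (by simpa using hy)

end CycleTerm

/-! ### Integration of one term over all of `ℝ^r` -/

section Integrals

variable {F K : Type*} [Field F] [NumberField F] [IsTotallyReal F] [Field K] [NumberField K]
  [Algebra F K] {c r : ℕ} {A : ArchData F K c r} {ω₁ ω₂ : K}

/-- The integral is a product over the places. At each place the powers of `ω₁` in the height of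
`τ`, or in `|τ' - τ|`, cancel those in `x / ω₁`, leaving the orientation determinant and the local
norm of `x`. -/
theorem ArchData.integral_cycleTerm (hFK : finrank F K = 2) (h : A.IsPositive ω₁ ω₂) (h0 : ω₁ ≠ 0)
    {s : ℂ} (hs : 0 < s.re) {x : K} (hx : x ≠ 0) :
    ∫ t, A.cycleTerm s (ω₂ / ω₁) (x / ω₁) t =
      (Complex.Gamma ((s + 1) / 2) ^ 2 / (2 * Complex.I * Complex.Gamma s)) ^ r *
        ((∏ i, A.det ω₁ ω₂ i : ℝ) : ℂ) ^ s *
        (((SignType.sign (Algebra.norm ℚ x) : ℤ) : ℂ) *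
          ((|(Algebra.norm ℚ x : ℝ)| : ℝ) : ℂ) ^ (-s)) := by
  have hfst : ∀ {y : K}, y ≠ 0 → ∀ j, A.fst j y ≠ 0 := fun hy j => by simpa using hy
  have hsnd : ∀ {y : K}, y ≠ 0 → ∀ j, A.snd j y ≠ 0 := fun hy j => by simpa using hy
  have hsq : ∀ {y : K}, y ≠ 0 → ∀ j, 0 < Complex.normSq (A.toComplex j y) := fun hy j =>
    Complex.normSq_pos.2 (by simpa using hy)
  have h1 : ∀ j, (((A.toComplex j (ω₂ / ω₁)).im /
      Complex.normSq (A.toComplex j (x / ω₁)) : ℝ) : ℂ) ^ s =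
      ((A.det ω₁ ω₂ (Sum.inl j) : ℝ) : ℂ) ^ s *
        ((Complex.normSq (A.toComplex j x) : ℝ) : ℂ) ^ (-s) := by
    intro j
    rw [← ofReal_div_cpow (h.det_pos _).le (hsq hx j), A.im_toComplex h0, map_div₀, map_div₀,
      div_div_div_cancel_right₀ (hsq h0 j).ne']
  have h2 : ∀ j, ∫ t, localForm s (A.fst j (ω₂ / ω₁)) (A.snd j (ω₂ / ω₁)) (A.fst j (x / ω₁))
      (A.snd j (x / ω₁)) t = Complex.Gamma ((s + 1) / 2) ^ 2 / (2 * Complex.I * Complex.Gamma s) *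
        ((A.det ω₁ ω₂ (Sum.inr j) : ℝ) : ℂ) ^ s *
        (((SignType.sign (A.fst j x * A.snd j x) : ℤ) : ℂ) *
          ((|A.fst j x * A.snd j x| : ℝ) : ℂ) ^ (-s)) := by
    intro j
    have hd := h.det_pos (Sum.inr j)
    have hw : A.fst j ω₁ * A.snd j ω₁ ≠ 0 := mul_ne_zero (hfst h0 j) (hsnd h0 j)
    have hxx : A.fst j x * A.snd j x ≠ 0 := mul_ne_zero (hfst hx j) (hsnd hx j)
    have hy : x / ω₁ ≠ 0 := div_ne_zero hx h0
    have e1 : A.fst j (x / ω₁) * A.snd j (x / ω₁) =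
        (A.fst j x * A.snd j x) / (A.fst j ω₁ * A.snd j ω₁) := by
      rw [map_div₀, map_div₀, div_mul_div_comm]
    have e2 := A.snd_sub_fst (ω₂ := ω₂) h0 j
    rw [integral_localForm hs _ _ (hfst hy j) (hsnd hy j), e1, e2]
    -- Since the basis is positive, `τ' - τ` has the sign of the local norm of `ω₁`. This sign turns
    -- that of the local norm of `x / ω₁` into that of `x`.
    have e3 : orient (A.fst j (ω₂ / ω₁)) (A.snd j (ω₂ / ω₁)) =
        SignType.sign (A.fst j ω₁ * A.snd j ω₁) := by
      have e4 := orient_mul (A.fst j (ω₂ / ω₁)) (A.snd j (ω₂ / ω₁))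
      rw [e2] at e4
      have e5 : A.det ω₁ ω₂ (Sum.inr j) / (A.fst j ω₁ * A.snd j ω₁) ≠ 0 := div_ne_zero hd.ne' hw
      apply mul_right_cancel₀ e5
      rw [e4, ← sign_mul_self]
      congr 2
      rcases hw.lt_or_gt with hw | hw
      · rw [sign_neg hw, sign_neg (div_neg_of_pos_of_neg hd hw)]
      · rw [sign_pos hw, sign_pos (div_pos hd hw)]
    have e6 : orient (A.fst j (ω₂ / ω₁)) (A.snd j (ω₂ / ω₁)) *
        (SignType.sign ((A.fst j x * A.snd j x) / (A.fst j ω₁ * A.snd j ω₁)) : ℝ) =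
        ((SignType.sign (A.fst j x * A.snd j x) : ℤ) : ℝ) := by
      rw [e3, sign_mul_sign_div _ hw]
    rw [e6, abs_div, abs_div, abs_of_pos hd]
    have hwa := abs_pos.2 hw
    have hxa := abs_pos.2 hxx
    have e7 : ((|A.fst j ω₁ * A.snd j ω₁| : ℝ) : ℂ) ^ (-s) *
        ((|A.fst j ω₁ * A.snd j ω₁| : ℝ) : ℂ) ^ s = 1 := by
      rw [Complex.cpow_neg, inv_mul_cancel₀ (ofReal_cpow_ne_zero hwa s)]
    rw [ofReal_div_cpow hd.le hwa, ofReal_div_cpow hxa.le hwa, neg_neg, Complex.ofReal_intCast]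
    linear_combination (Complex.Gamma ((s + 1) / 2) ^ 2 / (2 * Complex.I * Complex.Gamma s) *
      ((A.det ω₁ ω₂ (Sum.inr j) : ℝ) : ℂ) ^ s *
      (((SignType.sign (A.fst j x * A.snd j x) : ℤ) : ℂ) *
        ((|A.fst j x * A.snd j x| : ℝ) : ℂ) ^ (-s))) * e7
  have hN : (Algebra.norm ℚ x : ℝ) = (∏ j, Complex.normSq (A.toComplex j x)) *
      ∏ j, (A.fst j x * A.snd j x) := A.norm_eq hFK x
  have hsign : ((SignType.sign (Algebra.norm ℚ x) : ℤ) : ℂ) =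
      ∏ j, ((SignType.sign (A.fst j x * A.snd j x) : ℤ) : ℂ) := by
    have e1 : SignType.sign (Algebra.norm ℚ x) = SignType.sign (Algebra.norm ℚ x : ℝ) := by
      rcases lt_trichotomy (Algebra.norm ℚ x) 0 with h | h | h
      · rw [sign_neg h, sign_neg (by exact_mod_cast h)]
      · simp [h]
      · rw [sign_pos h, sign_pos (by exact_mod_cast h)]
    rw [e1, hN, sign_mul, sign_pos (Finset.prod_pos fun j _ => hsq hx j), one_mul]
    have e2 : SignType.sign (∏ j, (A.fst j x * A.snd j x)) =
        ∏ j, SignType.sign (A.fst j x * A.snd j x) := map_prod (signHom (α := ℝ)) _ _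
    rw [e2]
    exact map_prod ((Int.castRingHom ℂ).toMonoidHom.comp
      (SignType.castHom (α := ℤ) : SignType →*₀ ℤ).toMonoidHom) _ _
  have habs : ((|(Algebra.norm ℚ x : ℝ)| : ℝ) : ℂ) ^ (-s) =
      (∏ j, ((Complex.normSq (A.toComplex j x) : ℝ) : ℂ) ^ (-s)) *
        ∏ j, ((|A.fst j x * A.snd j x| : ℝ) : ℂ) ^ (-s) := by
    rw [hN, abs_mul, Finset.abs_prod, Finset.abs_prod, Complex.ofReal_mul,
      Complex.mul_cpow_ofReal_nonneg (Finset.prod_nonneg fun j _ => abs_nonneg _)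
        (Finset.prod_nonneg fun j _ => abs_nonneg _),
      ofReal_prod_cpow _ fun j => abs_nonneg _, ofReal_prod_cpow _ fun j => abs_nonneg _]
    simp_rw [abs_of_pos (hsq hx _)]
  simp only [ArchData.cycleTerm]
  rw [MeasureTheory.integral_const_mul, MeasureTheory.integral_fintype_prod_volume_eq_prod
    (fun j t => localForm s (A.fst j (ω₂ / ω₁)) (A.snd j (ω₂ / ω₁)) (A.fst j (x / ω₁))
      (A.snd j (x / ω₁)) t), Finset.prod_congr rfl fun j _ => h1 j,
    Finset.prod_congr rfl fun j _ => h2 j, hsign, habs,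
    ofReal_prod_cpow _ fun i => (h.det_pos i).le, Fintype.prod_sum_type]
  simp only [Finset.prod_mul_distrib, Finset.prod_const, Finset.card_univ, Fintype.card_fin]
  ring

theorem ArchData.integral_norm_cycleTerm (hFK : finrank F K = 2) (h : A.IsPositive ω₁ ω₂)
    (h0 : ω₁ ≠ 0) (s : ℂ) : ∃ C : ℝ, ∀ x : K, x ≠ 0 →
      ∫ t, ‖A.cycleTerm s (ω₂ / ω₁) (x / ω₁) t‖ = C * |(Algebra.norm ℚ x : ℝ)| ^ (-s.re) := by
  choose C hC using fun j => integral_norm_localForm (s := s) (h.fst_ne_snd h0 j)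
  set D : Fin c → ℝ := fun j => (A.det ω₁ ω₂ (Sum.inl j)) ^ s.re with hD
  refine ⟨(∏ j, D j) * ∏ j, (C j * |A.fst j ω₁ * A.snd j ω₁| ^ s.re), fun x hx => ?_⟩
  have hfst : ∀ {y : K}, y ≠ 0 → ∀ j, A.fst j y ≠ 0 := fun hy j => by simpa using hy
  have hsnd : ∀ {y : K}, y ≠ 0 → ∀ j, A.snd j y ≠ 0 := fun hy j => by simpa using hy
  have hsq : ∀ {y : K}, y ≠ 0 → ∀ j, 0 < Complex.normSq (A.toComplex j y) := fun hy j =>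
    Complex.normSq_pos.2 (by simpa using hy)
  have hy : x / ω₁ ≠ 0 := div_ne_zero hx h0
  have h1 : ∀ j, ‖(((A.toComplex j (ω₂ / ω₁)).im /
      Complex.normSq (A.toComplex j (x / ω₁)) : ℝ) : ℂ) ^ s‖ =
      D j * (Complex.normSq (A.toComplex j x)) ^ (-s.re) := by
    intro j
    rw [A.im_toComplex h0, map_div₀, map_div₀, div_div_div_cancel_right₀ (hsq h0 j).ne',
      Complex.norm_cpow_eq_rpow_re_of_pos (div_pos (h.det_pos _) (hsq hx j)),
      Real.div_rpow (h.det_pos _).le (hsq hx j).le, Real.rpow_neg (hsq hx j).le, div_eq_mul_inv]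
  have h2 : ∀ j, ∫ t, ‖localForm s (A.fst j (ω₂ / ω₁)) (A.snd j (ω₂ / ω₁)) (A.fst j (x / ω₁))
      (A.snd j (x / ω₁)) t‖ =
      (C j * |A.fst j ω₁ * A.snd j ω₁| ^ s.re) * |A.fst j x * A.snd j x| ^ (-s.re) := by
    intro j
    have hwa := abs_pos.2 (mul_ne_zero (hfst h0 j) (hsnd h0 j))
    rw [hC j _ _ (hfst hy j) (hsnd hy j), map_div₀, map_div₀, div_mul_div_comm, abs_div,
      Real.div_rpow (abs_nonneg _) (abs_nonneg _), Real.rpow_neg hwa.le, div_inv_eq_mul]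
    ring
  have hN : |(Algebra.norm ℚ x : ℝ)| ^ (-s.re) =
      (∏ j, (Complex.normSq (A.toComplex j x)) ^ (-s.re)) *
        ∏ j, |A.fst j x * A.snd j x| ^ (-s.re) := by
    rw [A.norm_eq hFK x, abs_mul, Finset.abs_prod, Finset.abs_prod,
      Real.mul_rpow (Finset.prod_nonneg fun j _ => abs_nonneg _)
        (Finset.prod_nonneg fun j _ => abs_nonneg _),
      ← Real.finsetProd_rpow _ _ fun j _ => abs_nonneg _,
      ← Real.finsetProd_rpow _ _ fun j _ => abs_nonneg _]
    simp_rw [abs_of_pos (hsq hx _)]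
  simp only [ArchData.cycleTerm, norm_mul, norm_prod]
  rw [MeasureTheory.integral_const_mul, MeasureTheory.integral_fintype_prod_volume_eq_prod
    (fun j t => ‖localForm s (A.fst j (ω₂ / ω₁)) (A.snd j (ω₂ / ω₁)) (A.fst j (x / ω₁))
      (A.snd j (x / ω₁)) t‖), Finset.prod_congr rfl fun j _ => h1 j,
    Finset.prod_congr rfl fun j _ => h2 j, hN]
  simp only [Finset.prod_mul_distrib]
  ring

end Integrals

end HilbertEisenstein

namespace HilbertEisenstein

/-! ### The integral over the cycle -/

section Pullback

variable {F K : Type*} [Field F] [NumberField F] [IsTotallyReal F] [Field K] [NumberField K]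
  [Algebra F K] {c r : ℕ} {A : ArchData F K c r} {I : Ideal (𝓞 F)}
  {M : Submodule (conductorOrder K I) K}

/-- Here `x / ω₁ = μ τ + ν`, so its images at the two end points are exactly the values `u` and `w`
of the local form. -/
theorem ArchData.pullback_eisensteinTerm (ω : Basis (Fin 2) (𝓞 F) M)
    (hω : A.IsPositive (ω 0 : K) (ω 1 : K)) (s : ℂ) {x : M} (hx : x ≠ 0) (t : Fin r → ℝ) :
    A.pullback ((ω 1 : K) / (ω 0 : K)) (mixedWirtinger fun z =>
      eisensteinTerm A.v z s (Quotient.mk _ (basisPair ω x))) t =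
      A.cycleTerm s ((ω 1 : K) / (ω 0 : K)) ((x : K) / (ω 0 : K)) t := by
  have h0 := basis_coe_ne_zero ω 0
  set τ := (ω 1 : K) / (ω 0 : K) with hτ
  have hm := basisPair_ne_zero ω hx
  have hy : (x : K) / (ω 0 : K) = algebraMap F K (basisPair ω x).1 * τ +
      algebraMap F K (basisPair ω x).2 := by
    rw [div_eq_iff h0, add_mul, mul_assoc, hτ, div_mul_cancel₀ _ h0]
    exact coe_eq_basis ω x
  have h1 : mixedWirtinger (fun z => eisensteinTerm A.v z s (Quotient.mk _ (basisPair ω x)))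
      (A.param τ t) = mixedWirtinger (fun z : Fin c ⊕ Fin r → ℂ =>
        ∏ i, localFactor s (pairCoord A.v (basisPair ω x) i) (z i)) (A.param τ t) :=
    foldr_wirtinger_congr isOpen_halfPlanes (fun z hz => eisensteinTerm_mk A.v s hm hz) _
      (hω.param_mem h0 t)
  rw [ArchData.pullback, h1, mixedWirtinger_prod
    (fun i => localFactor s (pairCoord A.v (basisPair ω x) i)), mul_assoc, ← Finset.prod_mul_distrib,
    ArchData.cycleTerm]
  congr 1
  · refine Finset.prod_congr rfl fun j _ => ?_
    simp only [localFactor, pairCoord, ArchData.param, Sum.elim_inl, hy, map_add, map_mul,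
      A.toComplex_algebraMap]
  · refine Finset.prod_congr rfl fun j _ => ?_
    have hab : A.v (Sum.inr j) ((basisPair ω x).1 : F) ≠ 0 ∨
        A.v (Sum.inr j) ((basisPair ω x).2 : F) ≠ 0 := by
      by_contra! hab
      exact pairCoord_ne_zero A.v hm (Sum.inr j) (Prod.ext hab.1 hab.2)
    simp only [pairCoord, ArchData.param, Sum.elim_inr]
    rw [localForm_eq s (hω.fst_ne_snd h0 j) _ _ _ hab, hy]
    simp only [map_add, map_mul, A.fst_algebraMap, A.snd_algebraMap]
    rfl

theorem ArchData.pullback_eisenstein {ω₁ ω₂ : K} (hω : A.IsPositive ω₁ ω₂) (h0 : ω₁ ≠ 0) {s : ℂ}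
    (hs : 1 < s.re) (t : Fin r → ℝ) :
    A.pullback (ω₂ / ω₁) (mixedWirtinger fun z => eisenstein A.v z s) t =
      ∑' q : {q : PairClass F // q ≠ Quotient.mk _ 0},
        A.pullback (ω₂ / ω₁) (mixedWirtinger fun z => eisensteinTerm A.v z s q.1) t := by
  have h := (foldr_wirtinger_tsum (summableSmooth_eisensteinTerm A.v hs) isOpen_halfPlanes
    (List.finRange r)).2 (hω.param_mem h0 t)
  simp only [ArchData.pullback]
  rw [tsum_mul_right]
  exact congrArg (· * _) h

theorem ArchData.cycleTerm_smul (hFK : finrank F K = 2) {s : ℂ} {τ y : K}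
    (him : ∀ j, 0 ≤ (A.toComplex j τ).im) {ε : (conductorOrder K I)ˣ}
    (hε : ε ∈ unitsRelNormOne K I) (t : Fin r → ℝ) :
    A.cycleTerm s τ (((ε : conductorOrder K I) : K) * y) t =
      A.cycleTerm s τ y (t + A.logRatio ((ε : conductorOrder K I) : K)) := by
  have hε' : Algebra.norm F ((ε : conductorOrder K I) : K) = 1 := hε
  refine ArchData.cycleTerm_mul him (unit_coe_ne_zero ε) (fun j => ?_) ?_ t
  · rw [A.fst_mul_snd hFK, hε', map_one]
    exact one_pos
  · simp [A.fst_mul_snd hFK, A.normSq_toComplex hFK, hε']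

theorem ArchData.pullback_unfoldMap (hFK : finrank F K = 2) (ω : Basis (Fin 2) (𝓞 F) M)
    (hω : A.IsPositive (ω 0 : K) (ω 1 : K)) (s : ℂ) (p : UnfoldIndex M × A.translations I)
    (t : Fin r → ℝ) :
    A.pullback ((ω 1 : K) / (ω 0 : K)) (mixedWirtinger fun z =>
      eisensteinTerm A.v z s (A.unfoldMap ω p).1) t =
      A.cycleTerm s ((ω 1 : K) / (ω 0 : K)) ((UnfoldIndex.rep p.1 : K) / (ω 0 : K)) (t + p.2) := by
  have hx := units_smul_ne_zero (ArchData.liftTranslation p.2) (UnfoldIndex.rep_ne_zero p.1)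
  refine (ArchData.pullback_eisensteinTerm ω hω s
    (fun h => hx (congrArg Subtype.val h)) t).trans ?_
  rw [coe_units_smul, mul_div_assoc, ArchData.cycleTerm_smul hFK
    (fun j => (hω.im_pos (basis_coe_ne_zero ω 0) j).le) (ArchData.liftTranslation_mem p.2),
    ArchData.logRatio_liftTranslation]

end Pullback

/-! ### The terms of the `L`-series -/

section LSeries

variable {F K : Type*} [Field F] [NumberField F] [Field K] [NumberField K] [Algebra F K]
  {I : Ideal (𝓞 F)} {M : Submodule (conductorOrder K I) K}

theorem UnfoldIndex.norm_rep (p : UnfoldIndex M) :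
    Algebra.norm ℚ (UnfoldIndex.rep p : K) = Algebra.norm ℚ ((Quotient.out p.1.1 : M) : K) := by
  have h : Algebra.norm ℚ ((((Quotient.out p.2 : unitsNormOne K I) : (conductorOrder K I)ˣ) :
      conductorOrder K I) : K) = 1 := (Quotient.out p.2 : unitsNormOne K I).2
  rw [UnfoldIndex.rep, coe_units_smul, map_mul, h, one_mul]

theorem lTerm_eq (s : ℂ) (q : ModuleClass M) : lTerm M s q =
    ((SignType.sign (Algebra.norm ℚ ((Quotient.out q : M) : K)) : ℤ) : ℂ) *
      ((|(Algebra.norm ℚ ((Quotient.out q : M) : K) : ℝ)| : ℝ) : ℂ) ^ (-s) := by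
  conv_lhs => rw [← Quotient.out_eq q]
  rfl

theorem summable_norm_lTerm (hI : I ≠ ⊥) (ω : Basis (Fin 2) (𝓞 F) M) {s : ℂ} (hs : 1 < s.re) :
    Summable fun q : {q : ModuleClass M // q ≠ Quotient.mk _ 0} => ‖lTerm M s q.1‖ := by
  refine (summable_moduleClass hI ω hs).congr fun q => ?_
  have hN : Algebra.norm ℚ ((Quotient.out q.1 : M) : K) ≠ 0 :=
    Algebra.norm_ne_zero_iff.2 (out_coe_ne_zero q)
  have hN' : 0 < |(Algebra.norm ℚ ((Quotient.out q.1 : M) : K) : ℝ)| :=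
    abs_pos.2 (by exact_mod_cast hN)
  have hsign : ‖((SignType.sign (Algebra.norm ℚ ((Quotient.out q.1 : M) : K)) : ℤ) : ℂ)‖ = 1 := by
    rcases hN.lt_or_gt with h | h
    · simp [sign_neg h]
    · simp [sign_pos h]
  rw [lTerm_eq, norm_mul, hsign, one_mul, Complex.norm_cpow_eq_rpow_re_of_pos hN', Complex.neg_re]

end LSeries

/-! ### Summation and the final formula -/

section Main

variable {F K : Type*} [Field F] [NumberField F] [IsTotallyReal F] [Field K] [NumberField K]
  [Algebra F K] {c r : ℕ} {A : ArchData F K c r} {I : Ideal (𝓞 F)}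
  {M : Submodule (conductorOrder K I) K}

theorem tsum_one_eq_unitIndex (hFK : finrank F K = 2) :
    ∑' _ : unitsNormOne K I ⧸ (tildeUnits K I).subgroupOf (unitsNormOne K I), (1 : ℂ) =
      unitIndex K I := by
  have := finite_quotient_tildeUnits (K := K) (I := I) hFK
  have := Fintype.ofFinite (unitsNormOne K I ⧸ (tildeUnits K I).subgroupOf (unitsNormOne K I))
  rw [tsum_fintype, unitIndex_eq, Nat.card_eq_fintype_card]
  simp

theorem tsum_unfoldIndex_lTerm (hFK : finrank F K = 2) (hI : I ≠ ⊥) (ω : Basis (Fin 2) (𝓞 F) M)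
    {s : ℂ} (hs : 1 < s.re) : ∑' p : UnfoldIndex M, lTerm M s p.1.1 =
      (∑' q : {q : ModuleClass M // q ≠ Quotient.mk _ 0}, lTerm M s q.1) * unitIndex K I := by
  have := finite_quotient_tildeUnits (K := K) (I := I) hFK
  rw [← tsum_one_eq_unitIndex hFK]
  refine Eq.trans ?_ (tsum_mul_tsum_of_summable_norm (summable_norm_lTerm hI ω hs)
    (Summable.of_finite (f := fun _ => ‖(1 : ℂ)‖))).symm
  exact tsum_congr fun p => (mul_one _).symm

theorem ArchData.summable_integral_norm_cycleTerm (hFK : finrank F K = 2) (hI : I ≠ ⊥)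
    (ω : Basis (Fin 2) (𝓞 F) M) (hω : A.IsPositive (ω 0 : K) (ω 1 : K)) {s : ℂ} (hs : 1 < s.re) :
    Summable fun p : UnfoldIndex M => ∫ t, ‖A.cycleTerm s ((ω 1 : K) / (ω 0 : K))
      ((UnfoldIndex.rep p : K) / (ω 0 : K)) t‖ := by
  have := finite_quotient_tildeUnits (K := K) (I := I) hFK
  obtain ⟨C, hC⟩ := ArchData.integral_norm_cycleTerm hFK hω (basis_coe_ne_zero ω 0) s
  have h1 : Summable fun p : UnfoldIndex M =>
      |(Algebra.norm ℚ ((Quotient.out p.1.1 : M) : K) : ℝ)| ^ (-s.re) * 1 :=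
    (summable_moduleClass hI ω hs).mul_of_nonneg (Summable.of_finite (f := fun _ => (1 : ℝ)))
      (fun q => by positivity) fun _ => zero_le_one
  refine (h1.mul_left C).congr fun p => ?_
  rw [hC _ (UnfoldIndex.rep_ne_zero p), UnfoldIndex.norm_rep, mul_one]

/-- Multiplication by `V` does not change the norm, so the sum over `V / Ṽ` only contributes the
index. The product of the determinants is `N M / d_F`. -/
theorem ArchData.tsum_integral_cycleTerm (hFK : finrank F K = 2) (hI : I ≠ ⊥)
    (ω : Basis (Fin 2) (𝓞 F) M) (hω : A.IsPositive (ω 0 : K) (ω 1 : K)) {s : ℂ} (hs : 1 < s.re) :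
    ∑' p : UnfoldIndex M, ∫ t, A.cycleTerm s ((ω 1 : K) / (ω 0 : K))
      ((UnfoldIndex.rep p : K) / (ω 0 : K)) t =
      (Complex.Gamma ((s + 1) / 2) ^ 2 / (2 * Complex.I * Complex.Gamma s)) ^ r *
        (discr F : ℂ) ^ (-s) * lSeries M s := by
  have hd := discr_pos A.v
  have hdet : 0 ≤ ∏ i, A.det (ω 0 : K) (ω 1 : K) i :=
    Finset.prod_nonneg fun i _ => (hω.det_pos i).le
  have hterm : ∀ p : UnfoldIndex M, ∫ t, A.cycleTerm s ((ω 1 : K) / (ω 0 : K))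
      ((UnfoldIndex.rep p : K) / (ω 0 : K)) t =
      (Complex.Gamma ((s + 1) / 2) ^ 2 / (2 * Complex.I * Complex.Gamma s)) ^ r *
        ((∏ i, A.det (ω 0 : K) (ω 1 : K) i : ℝ) : ℂ) ^ s * lTerm M s p.1.1 := by
    intro p
    rw [ArchData.integral_cycleTerm hFK hω (basis_coe_ne_zero ω 0) (one_pos.trans hs)
      (UnfoldIndex.rep_ne_zero p), UnfoldIndex.norm_rep, lTerm_eq]
  have hd' : (discr F : ℂ) ^ s ≠ 0 := by
    rw [← Complex.ofReal_intCast]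
    exact ofReal_cpow_ne_zero hd s
  rw [tsum_congr hterm, tsum_mul_left, tsum_unfoldIndex_lTerm hFK hI ω hs, lSeries,
    moduleNorm_eq A hFK M ω hω, Complex.ofReal_mul, Complex.mul_cpow_ofReal_nonneg hd.le hdet,
    Complex.cpow_neg, Complex.ofReal_intCast]
  field_simp

theorem countable_unfoldIndex (hFK : finrank F K = 2) : Countable (UnfoldIndex M) := by
  have : Countable K := (Module.finBasis ℚ K).equivFun.toEquiv.countable_iff.2 inferInstance
  have := finite_quotient_tildeUnits (K := K) (I := I) hFK
  have : Countable (ModuleClass M) := Quotient.countable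
  infer_instance

theorem ArchData.integral_eisenstein (hFK : finrank F K = 2) (hI : I ≠ ⊥)
    (hM : Module.Projective (conductorOrder K I) M) (ω : Basis (Fin 2) (𝓞 F) M)
    (hω : A.IsPositive (ω 0 : K) (ω 1 : K)) {Δ : Set (Fin c ⊕ Fin r → ℂ)}
    (hΔ : A.IsFundDomain ((ω 1 : K) / (ω 0 : K)) Δ) {s : ℂ} (hs : 1 < s.re) :
    MeasureTheory.IntegrableOn (A.pullback ((ω 1 : K) / (ω 0 : K))
      (mixedWirtinger fun z => eisenstein A.v z s)) (A.param ((ω 1 : K) / (ω 0 : K)) ⁻¹' Δ) ∧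
    A.integral ((ω 1 : K) / (ω 0 : K)) Δ (mixedWirtinger fun z => eisenstein A.v z s) =
      (Complex.Gamma ((s + 1) / 2) ^ 2 / (2 * Complex.I * Complex.Gamma s)) ^ r *
        (discr F : ℂ) ^ (-s) * lSeries M s := by
  have h0 := basis_coe_ne_zero ω 0
  have := countable_unfoldIndex (M := M) hFK
  have hbij := A.unfoldMap_bijective hFK ω fun ε hε hl =>
    ArchData.IsFundDomain.eq_one_or_eq_neg_one hFK hI hM ω hΔ hε hl
  have hunf := integral_unfold (A.translations I)
    (ArchData.IsFundDomain.isAddFundamentalDomain hFK hI hM ω hΔ)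
    (h := fun p : UnfoldIndex M => A.cycleTerm s ((ω 1 : K) / (ω 0 : K))
      ((UnfoldIndex.rep p : K) / (ω 0 : K)))
    (fun p => ArchData.integrable_cycleTerm (one_pos.trans hs) _
      (div_ne_zero (UnfoldIndex.rep_ne_zero p) h0))
    (ArchData.summable_integral_norm_cycleTerm hFK hI ω hω hs)
  -- Term by term differentiation is followed by reindexing along the bijection, under which the
  -- component in `Λ` acts as a translation of the argument.
  have hpull : A.pullback ((ω 1 : K) / (ω 0 : K)) (mixedWirtinger fun z => eisenstein A.v z s) =
      fun t => ∑' p : UnfoldIndex M × A.translations I, A.cycleTerm s ((ω 1 : K) / (ω 0 : K))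
        ((UnfoldIndex.rep p.1 : K) / (ω 0 : K)) (t + p.2) := by
    funext t
    rw [ArchData.pullback_eisenstein hω h0 hs, ← (Equiv.ofBijective _ hbij).tsum_eq]
    exact tsum_congr fun p => ArchData.pullback_unfoldMap hFK ω hω s p t
  rw [ArchData.integral, hpull]
  exact ⟨hunf.1, hunf.2.trans (ArchData.tsum_integral_cycleTerm hFK hI ω hω hs)⟩

end Main

end HilbertEisenstein

end

open HilbertEisenstein
theorem mainTheorem3 {F K : Type*} [Field F] [NumberField F] [IsTotallyReal F]
    [Field K] [NumberField K] [Algebra F K] (hFK : Module.finrank F K = 2)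
    {c r : ℕ} (A : ArchData F K c r)
    (I : Ideal (𝓞 F)) (hI : I ≠ ⊥)
    (M : Submodule (conductorOrder K I) K) (hM : Module.Projective (conductorOrder K I) M)
    (ω : Module.Basis (Fin 2) (𝓞 F) M) (hω : A.IsPositive (ω 0 : K) (ω 1 : K))
    (τ : K) (hτ : τ = (ω 1 : K) / (ω 0 : K))
    (Δ : Set (Fin c ⊕ Fin r → ℂ)) (hΔ : A.IsFundDomain τ Δ)
    (s : ℂ) (hs : 1 < s.re) :
    (∀ z ∈ halfPlanes (Fin c ⊕ Fin r),
      Summable fun q : {q : PairClass F // q ≠ Quotient.mk _ 0} => eisensteinTerm A.v z s q) ∧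
    ContDiffOn ℝ r (fun z => eisenstein A.v z s) (halfPlanes (Fin c ⊕ Fin r)) ∧
    (Summable fun q : {q : ModuleClass M // q ≠ Quotient.mk _ 0} => lTerm M s q) ∧
    MeasureTheory.IntegrableOn
      (A.pullback τ (mixedWirtinger fun z => eisenstein A.v z s)) (A.param τ ⁻¹' Δ) ∧
    A.integral τ Δ (mixedWirtinger fun z => eisenstein A.v z s) =
      (Complex.Gamma ((s + 1) / 2) ^ 2 / (2 * Complex.I * Complex.Gamma s)) ^ r *
        (discr F : ℂ) ^ (-s) * lSeries M s := by
  subst hτ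
  have hsmooth := summableSmooth_eisensteinTerm A.v hs
  exact ⟨fun z hz => hsmooth.summable hz, hsmooth.contDiffOn_tsum isOpen_halfPlanes r,
    (summable_norm_lTerm hI ω hs).of_norm,
    ArchData.integral_eisenstein hFK hI hM ω hω hΔ hs⟩
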